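/- **Setting.** Let $\mathbb F_v$ be a finite field with $q_v$ elements, $A_v=\mathbb F_v[[z]]$ and $Q_v=\mathbb F_v((z))$. Let $R$ be a complete discrete valuation ring with finite residue field and fraction field $L$ which is an $\mathbb F_v$-algebra, and let $\zeta\ne 0$ be an element of its maximal ideal. This gives $\gamma\colon A_v\hookrightarrow R$, $z\mapsto\zeta$, and $\gamma\colon Q_v\hookrightarrow L$. Let $\hat\sigma$ be the endomorphism of $R[[z]]$ (and of $L^{\rm sep}[[z]]$) with $\hat\sigma(z)=z$ and $\hat\sigma(b)=b^{q_v}$ on coefficients, and write $\hat\sigma^*\hat M:=\hat M\otimes_{R[[z]],\hat\sigma}R[[z]]$. A *local shtuka* $\underline{\hat M}=(\hat M,\tau)$ over $R$ is a free $R[[z]]$-module $\hat M$ of finite rank with an isomorphism $\tau\colon\hat\sigma^*\hat M[\frac1{z-\zeta}]\to\hat M[\frac1{z-\zeta}]$. $\mathrm{End}_R(\underline{\hat M})$ is the $A_v$-algebra of $R[[z]]$-endomorphisms $f$ of $\hat M$ with $\tau\circ\hat\sigma^*f=f\circ\tau$, and $\mathrm{QEnd}_R(\underline{\hat M}):=\mathrm{End}_R(\underline{\hat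 M})\otimes_{A_v}Q_v$. It has *complex multiplication* by a finite-dimensional commutative semi-simple $Q_v$-algebra $E_v$ (a finite product of finite field extensions $E_{v,i}$ of $Q_v$) if $E_v\subset\mathrm{QEnd}_R(\underline{\hat M})$ as $Q_v$-algebras and $\dim_{Q_v}E_v=\mathrm{rk}\,\hat M$. Put - $H^1_v(\underline{\hat M},A_v):=\{m\in\hat M\otimes_{R[[z]]}L^{\rm sep}[[z]]:\tau(\hat\sigma^*m)=m\}$ and $H^1_v(\underline{\hat M},Q_v):=H^1_v(\underline{\hat M},A_v)\otimes_{A_v}Q_v$; - $H^1_{\rm dR}(\underline{\hat M},L[[z-\zeta]]):=\hat\sigma^*\hat M\otimes_{R[[z]]}L[[z-\zeta]]$ with $z\mapsto\zeta+(z-\zeta)$, and for $B=R$ or $L$, $H^1_{\rm dR}(\underline{\hat M},B):=\hat\sigma^*\hat M\otimes_{R[[z]],\,z\mapsto\zeta}B$. An endomorphism $a$ acts on these de Rham realizations through $[a]^*:=\hat\sigma^*a\otimes\mathrm{id}$. **Proposition 3.6.** Let $\underline{\hat M}$ have complex multiplication by $E_v$. (a) $H^1_v(\underline{\hat M},Q_v)$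 is a free $E_v$-module of rank $1$. (b) $H^1_{\rm dR}(\underline{\hat M},L[[z-\zeta]])$ is a free $E_v\otimes_{Q_v}L[[z-\zeta]]$-module of rank $1$, where $Q_v\to L[[z-\zeta]]$ is given by $z\mapsto\zeta+(z-\zeta)$. Assume now that $\psi(E_v)\subset L$ for every $\psi\in H_{E_v}$, the set of $Q_v$-homomorphisms from $E_v$ to an algebraic closure of $L$. For $\psi\in H_{E_v}$ let $E_{v,i(\psi)}$ be the factor field of $E_v$ through which $\psi$ factors. (c) Let $y_\psi$ be a uniformizer of $E_{v,i(\psi)}$ for every $\psi$, and let $L[[y_\psi-\psi(y_\psi)]]$ be the power series ring over $L$ in a variable denoted $y_\psi-\psi(y_\psi)$. For each $\psi$ there is a unique $L$-algebra homomorphism $E_v\otimes_{Q_v}L[[z-\zeta]]\to L[[y_\psi-\psi(y_\psi)]]$ which on $E_v$ is congruent to $\psi$ modulo $y_\psi-\psi(y_\psi)$ and sends (every lift to $E_v$ of) $y_\psi$ to $\psi(y_\psi)+(y_\psi-\psi(y_\psi))$. Together they form an isomorphism $E_v\otimes_{Q_v}L[[z-\zeta]]\cong\prod_{\psi}L[[y_\psi-\psi(y_\psi)]]$,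 which induces a decomposition $$H^1_{\rm dR}(\underline{\hat M},L[[z-\zeta]])=\bigoplus_{\psi\in H_{E_v}}H^\psi(\underline{\hat M},L[[y_\psi-\psi(y_\psi)]]),$$ where $H^\psi(\underline{\hat M},L[[y_\psi-\psi(y_\psi)]]):=H^1_{\rm dR}(\underline{\hat M},L[[z-\zeta]])\otimes_{E_v\otimes L[[z-\zeta]]}L[[y_\psi-\psi(y_\psi)]]$ is free of rank $1$ over $L[[y_\psi-\psi(y_\psi)]]$. (d) For $a\in E_v\cap\mathrm{End}_R(\underline{\hat M})$ one has $\psi(a)\in R$. Let $$H^\psi(\underline{\hat M},R):=\{\omega\in H^1_{\rm dR}(\underline{\hat M},R):\text{for all }a\in E_v\cap\mathrm{End}_R(\underline{\hat M}),\ ([a]^*-\psi(a))^n\omega=0\text{ for }n\gg0\}.$$ Then $$H^1_{\rm dR}(\underline{\hat M},L)=\bigoplus_{\psi\in H_{E_v}}H^\psi(\underline{\hat M},R)\otimes_RL,$$ and this is the decomposition into generalized eigenspaces of the $E_v$-action, i.e. the image of $H^\psi(\underline{\hat M},R)\otimes_RL$ is $\{\omega\in H^1_{\rm dR}(\underline{\hat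 M},L):\text{for all }a\in E_v,\ (a-\psi(a))^n\omega=0\text{ for }n\gg0\}$. (e) $H^\psi(\underline{\hat M},R)$ is a free $R$-module of finite rank equal to the inseparability degree of $E_{v,i(\psi)}$ over $Q_v$. -/

import Mathlib

open scoped PowerSeries LaurentSeries TensorProduct

noncomputable section

/-- The base change `M ⊗_{A,f} B` of an `A`-module `M` along a ring homomorphism `f : A → B`. -/
def BaseChange {A B : Type*} [CommRing A] [CommRing B] (f : A →+* B)
    (M : Type*) [AddCommGroup M] [Module A M] : Type _ :=
  letI := f.toAlgebra
  B ⊗[A] M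

namespace BaseChange

section basic

variable {A B C : Type*} [CommRing A] [CommRing B] [CommRing C] (f : A →+* B)
  (M : Type*) [AddCommGroup M] [Module A M]

instance : AddCommGroup (BaseChange f M) :=
  letI := f.toAlgebra
  (TensorProduct.addCommGroup : AddCommGroup (B ⊗[A] M))

instance : Module B (BaseChange f M) :=
  letI := f.toAlgebra
  (TensorProduct.leftModule : Module B (B ⊗[A] M))

variable {M}

/-- The canonical `f`-semilinear map `m ↦ m ⊗ 1`. -/
def mk : M →ₛₗ[f] BaseChange f M :=
  letI := f.toAlgebra
  { toFun := fun m => (1 : B) ⊗ₜ[A] m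
    map_add' := fun x y => TensorProduct.tmul_add _ _ _
    map_smul' := fun a x => by
      change (1 : B) ⊗ₜ[A] (a • x) = f a • ((1 : B) ⊗ₜ[A] x)
      rw [TensorProduct.tmul_smul, TensorProduct.smul_tmul', TensorProduct.smul_tmul',
        Algebra.smul_def, smul_eq_mul]
      rfl }

theorem induction {p : BaseChange f M → Prop} (h : ∀ (b : B) (m : M), p (b • mk f m))
    (hadd : ∀ x y, p x → p y → p (x + y)) (x : BaseChange f M) : p x := by
  letI := f.toAlgebra
  refine TensorProduct.induction_on (motive := p) x ?_ ?_ hadd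
  · have := h 0 0
    rwa [zero_smul] at this
  · intro b m
    have := h b m
    change p (b • ((1 : B) ⊗ₜ[A] m)) at this
    rwa [TensorProduct.smul_tmul', smul_eq_mul, mul_one] at this

variable {f}

/-- For a ring homomorphism `s : B → C`, an `s ∘ f`-semilinear map `g : M → P` extends uniquely to
an `s`-semilinear map `M ⊗_{A,f} B → P`, `m ⊗ b ↦ s(b) g(m)`. -/
def extend {P : Type*} [AddCommGroup P] [Module C P] (s : B →+* C) (g : M →ₛₗ[s.comp f] P) :
    BaseChange f M →ₛₗ[s] P :=
  letI := f.toAlgebra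
  letI : Module B P := Module.compHom P s
  letI : Module A P := Module.compHom P (s.comp f)
  haveI : IsScalarTower A B P := ⟨fun a b x => by
    change s (f a * b) • x = s (f a) • s b • x
    rw [map_mul, mul_smul]⟩
  let g' : M →ₗ[A] P :=
    { toFun := g
      map_add' := g.map_add
      map_smul' := fun a x => g.map_smulₛₗ a x }
  let h : B ⊗[A] M →ₗ[B] P := g'.liftBaseChange B
  { toFun := h
    map_add' := h.map_add
    map_smul' := fun b x => h.map_smul b x }

theorem extend_mk {P : Type*} [AddCommGroup P] [Module C P] (s : B →+* C)
    (g : M →ₛₗ[s.comp f] P) (m : M) : extend s g (mk f m) = g m := by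
  letI := f.toAlgebra
  letI : Module B P := Module.compHom P s
  change s 1 • g m = g m
  rw [map_one, one_smul]

/-- The homomorphism `M ⊗_{A,f} B → N ⊗_{A,f} B` induced by an `A`-linear map `M → N`. -/
def map (f : A →+* B) {N : Type*} [AddCommGroup N] [Module A N] (g : M →ₗ[A] N) :
    BaseChange f M →ₗ[B] BaseChange f N :=
  letI := f.toAlgebra
  g.baseChange B

theorem map_mk {N : Type*} [AddCommGroup N] [Module A N] (g : M →ₗ[A] N) (m : M) :
    map f g (mk f m) = mk f (g m) := rfl

theorem linear_ext {P : Type*} [AddCommGroup P] [Module C P] {s : B →+* C}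
    {g h : BaseChange f M →ₛₗ[s] P} (H : ∀ m, g (mk f m) = h (mk f m)) : g = h := by
  ext x
  refine induction (f := f) (p := fun x => g x = h x) ?_ ?_ x
  · intro b m; rw [map_smulₛₗ, map_smulₛₗ, H]
  · intro x y hx hy; rw [_root_.map_add, _root_.map_add, hx, hy]

variable (f) (M) in
/-- `map f` as a ring homomorphism on endomorphism rings. -/
def mapEnd : Module.End A M →+* Module.End B (BaseChange f M) where
  toFun g := map f g
  map_one' := linear_ext fun m => rfl
  map_mul' g h := linear_ext fun m => rfl
  map_zero' := linear_ext fun m => by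
    rw [map_mk, LinearMap.zero_apply, LinearMap.zero_apply, _root_.map_zero]
  map_add' g h := linear_ext fun m => by
    rw [map_mk, LinearMap.add_apply, LinearMap.add_apply, _root_.map_add, map_mk, map_mk]

theorem map_mul (g h : Module.End A M) : map f (g * h) = map f g * map f h :=
  (mapEnd f M).map_mul g h

theorem map_add (g h : Module.End A M) : map f (g + h) = map f g + map f h :=
  (mapEnd f M).map_add g h

theorem map_algebraMap (a : A) : map f (algebraMap A (Module.End A M) a) =
    algebraMap B (Module.End B (BaseChange f M)) (f a) :=
  linear_ext fun m => by
    rw [map_mk, Module.algebraMap_end_apply, map_smulₛₗ, Module.algebraMap_end_apply]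

/-- For `h : B → C`, the canonical `h`-semilinear map `M ⊗_{A,f} B → M ⊗_{A, h ∘ f} C`,
`m ⊗ b ↦ m ⊗ h(b)`. Here `g` is a name for the composite `h ∘ f`. -/
def along (f : A →+* B) (h : B →+* C) (g : A →+* C) (hg : h.comp f = g) :
    BaseChange f M →ₛₗ[h] BaseChange g M :=
  extend h
    { toFun := mk g
      map_add' := (mk g).map_add
      map_smul' := fun a x => by subst hg; exact (mk (h.comp f)).map_smulₛₗ a x }

theorem along_mk (h : B →+* C) (g : A →+* C) (hg : h.comp f = g) (m : M) :
    along f h g hg (mk f m) = mk g m := extend_mk _ _ _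

end basic

section ring

variable {A B : Type*} [CommRing A] [CommRing B]

/-- The base change `E ⊗_{A,f} B` of a commutative `A`-algebra, as a commutative ring. -/
def Ring (f : A →+* B) (E : Type*) [CommRing E] [Algebra A E] : Type _ :=
  letI := f.toAlgebra
  B ⊗[A] E

variable (f : A →+* B) (E : Type*) [CommRing E] [Algebra A E]

instance : CommRing (Ring f E) :=
  letI := f.toAlgebra
  (Algebra.TensorProduct.instCommRing : CommRing (B ⊗[A] E))

/-- The ring homomorphism `b ↦ 1 ⊗ b`. -/
def Ring.inl : B →+* Ring f E :=
  letI := f.toAlgebra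
  (Algebra.TensorProduct.includeLeft : B →ₐ[A] B ⊗[A] E).toRingHom

/-- The ring homomorphism `e ↦ e ⊗ 1`. -/
def Ring.inr : E →+* Ring f E :=
  letI := f.toAlgebra
  (Algebra.TensorProduct.includeRight : E →ₐ[A] B ⊗[A] E).toRingHom

end ring

end BaseChange

/-- The ring homomorphism `B ⊗_A D → T`, `b ⊗ d ↦ f(b) g(d)`, attached to ring homomorphisms
`f : B → T` with central image and `g : D → T` that agree on `A`. -/
def tensorLift {A B D T : Type*} [CommRing A] [CommRing B] [Ring D] [Ring T] [Algebra A B]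
    [Algebra A D] (f : B →+* T) (hf : ∀ b x, f b * x = x * f b) (g : D →+* T)
    (h : ∀ a, g (algebraMap A D a) = f (algebraMap A B a)) : B ⊗[A] D →+* T :=
  letI : Algebra A T := (f.comp (algebraMap A B)).toAlgebra' fun _ x => hf _ x
  let f' : B →ₐ[A] T := { f with commutes' := fun _ => rfl }
  let g' : D →ₐ[A] T := { g with commutes' := fun a => h a }
  (Algebra.TensorProduct.lift f' g' fun b d => hf b (g d)).toRingHom

theorem tensorLift_tmul {A B D T : Type*} [CommRing A] [CommRing B] [Ring D] [Ring T] [Algebra A B]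
    [Algebra A D] (f : B →+* T) (hf : ∀ b x, f b * x = x * f b) (g : D →+* T)
    (h : ∀ a, g (algebraMap A D a) = f (algebraMap A B a)) (b : B) (d : D) :
    tensorLift f hf g h (b ⊗ₜ d) = f b * g d := rfl

/-- The ring homomorphism `E ⊗_{A,f} B → T`, `e ⊗ b ↦ g(e) u(b)`, attached to ring homomorphisms
`u : B → T` with central image and `g : E → T` that agree on `A`. -/
def BaseChange.Ring.lift {A B E T : Type*} [CommRing A] [CommRing B] [CommRing E] [_root_.Ring T]
    [Algebra A E] (f : A →+* B) (u : B →+* T) (hu : ∀ b x, u b * x = x * u b) (g : E →+* T)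
    (h : ∀ a, g (algebraMap A E a) = u (f a)) : BaseChange.Ring f E →+* T :=
  letI := f.toAlgebra
  tensorLift u hu g h

/-- A point `ζ` of the punctured open unit disc of a local ring `R`: a nonzero element of the maximal
ideal of `R`. It plays the role of the image of `z` under `γ : 𝔽_v⟦z⟧ → R`. -/
structure CharPoint (R : Type*) [CommRing R] [IsLocalRing R] where
  /-- the element `ζ` -/
  ζ : R
  mem : ζ ∈ IsLocalRing.maximalIdeal R
  ne_zero : ζ ≠ 0

open scoped PowerSeries.WithPiTopology in
theorem continuousSMul_powerSeries {R : Type*} [CommRing R] [TopologicalSpace R]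
    [IsTopologicalRing R] : ContinuousSMul R R⟦X⟧ := ⟨by
  have h : (fun p : R × R⟦X⟧ => p.1 • p.2) = fun p => PowerSeries.C p.1 * p.2 := by
    funext p; exact PowerSeries.smul_eq_C_mul _ _
  rw [h]
  exact (PowerSeries.WithPiTopology.continuous_C.comp continuous_fst).mul continuous_snd⟩

section shift

variable {R : Type*} [CommRing R] [IsLocalRing R] [IsAdicComplete (IsLocalRing.maximalIdeal R) R]

open scoped PowerSeries.WithPiTopology in
/-- The `R`-algebra homomorphism `R⟦z⟧ → R⟦t⟧`, `z ↦ ζ + t` (so `t = z - ζ`), i.e. evaluation of a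
power series at `ζ + t`, convergent for the `𝔪_R`-adic topology of the complete local ring `R` and
the coefficientwise topology of `R⟦t⟧`. -/
def taylorShift (P : CharPoint R) : R⟦X⟧ →ₐ[R] R⟦X⟧ :=
  letI : WithIdeal R := ⟨IsLocalRing.maximalIdeal R⟩
  have hc : CompleteSpace R ∧ T2Space R :=
    (IsAdic.isAdicComplete_iff (I := IsLocalRing.maximalIdeal R) rfl).1 inferInstance
  haveI := hc.1
  haveI := hc.2
  haveI : IsLinearTopology R⟦X⟧ R⟦X⟧ :=
    inferInstanceAs (IsLinearTopology (MvPowerSeries Unit R) (MvPowerSeries Unit R))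
  haveI : ContinuousSMul R R⟦X⟧ := continuousSMul_powerSeries
  PowerSeries.aeval (R := R) (S := R⟦X⟧) (a := PowerSeries.C P.ζ + PowerSeries.X)
    (PowerSeries.HasEval.add
      (PowerSeries.HasEval.map PowerSeries.WithPiTopology.continuous_C
        (WithIdeal.isTopologicallyNilpotent_of_mem P.mem))
      PowerSeries.HasEval.X)

open scoped PowerSeries.WithPiTopology in
theorem taylorShift_X (P : CharPoint R) :
    taylorShift P PowerSeries.X = PowerSeries.C P.ζ + PowerSeries.X := by
  let : WithIdeal R := ⟨IsLocalRing.maximalIdeal R⟩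
  have hc : CompleteSpace R ∧ T2Space R :=
    (IsAdic.isAdicComplete_iff (I := IsLocalRing.maximalIdeal R) rfl).1 inferInstance
  have := hc.1
  have := hc.2
  have : IsLinearTopology R⟦X⟧ R⟦X⟧ :=
    inferInstanceAs (IsLinearTopology (MvPowerSeries Unit R) (MvPowerSeries Unit R))
  have : ContinuousSMul R R⟦X⟧ := continuousSMul_powerSeries
  have ha : PowerSeries.HasEval (PowerSeries.C P.ζ + PowerSeries.X : R⟦X⟧) :=
    PowerSeries.HasEval.add
      (PowerSeries.HasEval.map PowerSeries.WithPiTopology.continuous_C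
        (WithIdeal.isTopologicallyNilpotent_of_mem P.mem))
      PowerSeries.HasEval.X
  exact (congrArg (taylorShift P) (Polynomial.coe_X (R := R)).symm).trans
    ((PowerSeries.aeval_coe ha _).trans (Polynomial.aeval_X _))

end shift

/-- The endomorphism `∑ bᵢ zⁱ ↦ ∑ bᵢ^q zⁱ` of `S⟦z⟧`, for a ring `S` over the finite field `k` with
`q` elements. -/
def frobSeries {k S : Type*} [Field k] [Fintype k] [CommRing S] (φ : k →+* S) : S⟦X⟧ →+* S⟦X⟧ :=
  letI := φ.toAlgebra
  PowerSeries.map (FiniteField.frobeniusAlgHom k S).toRingHom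

theorem coeff_frobSeries {k S : Type*} [Field k] [Fintype k] [CommRing S] (φ : k →+* S)
    (f : S⟦X⟧) (n : ℕ) :
    PowerSeries.coeff n (frobSeries φ f) = PowerSeries.coeff n f ^ Fintype.card k := rfl

theorem frobSeries_map {k S : Type*} [Field k] [Fintype k] [CommRing S] (φ : k →+* S) (a : k⟦X⟧) :
    frobSeries φ (PowerSeries.map φ a) = PowerSeries.map φ a := by
  ext n
  rw [coeff_frobSeries, PowerSeries.coeff_map, ← map_pow, FiniteField.pow_card]

section shtuka

variable (k : Type*) {R : Type*} [Field k] [Fintype k] [CommRing R] [IsLocalRing R] [Algebra k R]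

/-- The element `z - ζ` of `R⟦z⟧`. -/
def CharPoint.zSubZeta (P : CharPoint R) : R⟦X⟧ := PowerSeries.X - PowerSeries.C P.ζ

/-- The ring `R⟦z⟧[1/(z-ζ)]`. -/
abbrev CharPoint.Loc (P : CharPoint R) : Type _ := Localization.Away P.zSubZeta

/-- The homomorphism `R⟦z⟧ → R⟦z⟧[1/(z-ζ)]`. -/
abbrev CharPoint.toLoc (P : CharPoint R) : R⟦X⟧ →+* P.Loc := algebraMap R⟦X⟧ P.Loc

variable (R) in
/-- The Frobenius `σ̂` of `R⟦z⟧`. -/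
abbrev sigmaHat : R⟦X⟧ →+* R⟦X⟧ := frobSeries (algebraMap k R)

/-- A local `σ̂`-shtuka over `R`: a free `R⟦z⟧`-module `M` of finite rank together with an
isomorphism `τ : σ̂^*M[1/(z-ζ)] ≃ M[1/(z-ζ)]`. -/
structure LocalShtuka.{w, u, v} (k : Type u) {R : Type v} [Field k] [Fintype k] [CommRing R]
    [IsLocalRing R] [Algebra k R] (P : CharPoint R) where
  /-- the underlying module `M` -/
  carrier : Type w
  [addCommGroup : AddCommGroup carrier]
  [module : Module R⟦X⟧ carrier]
  [free : Module.Free R⟦X⟧ carrier]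
  [finite : Module.Finite R⟦X⟧ carrier]
  /-- the isomorphism `τ` -/
  τ : BaseChange P.toLoc (BaseChange (sigmaHat k R) carrier) ≃ₗ[P.Loc] BaseChange P.toLoc carrier

namespace LocalShtuka

attribute [instance] addCommGroup module free finite

variable {k} {P : CharPoint R} (M : LocalShtuka k P)

/-- The rank of a local shtuka. -/
def rank : ℕ := Module.finrank R⟦X⟧ M.carrier

/-- The `R⟦z⟧`-module `σ̂^*M`. -/
abbrev sigmaPullback : Type _ := BaseChange (sigmaHat k R) M.carrier

/-- The action of `A_v = k⟦z⟧ ⊆ R⟦z⟧` on `M`. -/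
instance instModuleA : Module k⟦X⟧ M.carrier :=
  Module.compHom M.carrier (algebraMap k⟦X⟧ R⟦X⟧)

instance : IsScalarTower k⟦X⟧ R⟦X⟧ M.carrier :=
  ⟨fun a b x => by
    rw [Algebra.smul_def, mul_smul]; rfl⟩

theorem map_sigmaHat_algebraMap (a : k⟦X⟧) :
    BaseChange.map (sigmaHat k R) (algebraMap k⟦X⟧ (Module.End R⟦X⟧ M.carrier) a) =
      algebraMap R⟦X⟧ (Module.End R⟦X⟧ M.sigmaPullback) (algebraMap k⟦X⟧ R⟦X⟧ a) := by
  refine (BaseChange.map_algebraMap (algebraMap k⟦X⟧ R⟦X⟧ a)).trans ?_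
  exact congrArg _ (frobSeries_map (algebraMap k R) a)

/-- The `A_v`-algebra `End_R(M)` of endomorphisms of the local shtuka `M`, i.e. of `R⟦z⟧`-linear
endomorphisms `f` of the underlying module with `τ ∘ σ̂^*f = f ∘ τ`. -/
def End : Subalgebra k⟦X⟧ (Module.End R⟦X⟧ M.carrier) where
  carrier := {f | ∀ x, M.τ (BaseChange.map P.toLoc (BaseChange.map (sigmaHat k R) f) x) =
    BaseChange.map P.toLoc f (M.τ x)}
  mul_mem' {f g} hf hg x := by
    rw [BaseChange.map_mul, BaseChange.map_mul, BaseChange.map_mul, Module.End.mul_apply,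
      Module.End.mul_apply, hf, hg]
  add_mem' {f g} hf hg x := by
    rw [BaseChange.map_add, BaseChange.map_add, BaseChange.map_add, LinearMap.add_apply,
      LinearMap.add_apply, _root_.map_add, hf, hg]
  algebraMap_mem' a x := by
    have h : BaseChange.map P.toLoc (algebraMap k⟦X⟧ (Module.End R⟦X⟧ M.carrier) a) =
        algebraMap P.Loc _ (P.toLoc (algebraMap k⟦X⟧ R⟦X⟧ a)) :=
      BaseChange.map_algebraMap (algebraMap k⟦X⟧ R⟦X⟧ a)
    rw [map_sigmaHat_algebraMap, BaseChange.map_algebraMap, h, Module.algebraMap_end_apply,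
      Module.algebraMap_end_apply, _root_.map_smul]

/-- `QEnd_R(M) = Q_v ⊗_{A_v} End_R(M)`, where `Q_v = k((z))`. -/
abbrev QEnd : Type _ := k⸨X⸩ ⊗[k⟦X⟧] M.End

section tate

variable (L : Type*) [Field L] [Algebra R L] [IsFractionRing R L]

variable (k R) in
/-- The embedding of the finite field `k` into the separable closure of `L`. -/
def toSep : k →+* SeparableClosure L :=
  ((algebraMap L (SeparableClosure L)).comp (algebraMap R L)).comp (algebraMap k R)

variable (R) in
/-- The homomorphism `R⟦z⟧ → L^sep⟦z⟧`. -/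
def seriesToSep : R⟦X⟧ →+* (SeparableClosure L)⟦X⟧ :=
  PowerSeries.map ((algebraMap L (SeparableClosure L)).comp (algebraMap R L))

variable (k R) in
/-- The Frobenius `σ̂` of `L^sep⟦z⟧`. -/
def sigmaSep : (SeparableClosure L)⟦X⟧ →+* (SeparableClosure L)⟦X⟧ := frobSeries (toSep k R L)

theorem sigmaSep_comp : (sigmaSep k R L).comp (seriesToSep R L) =
    (seriesToSep R L).comp (sigmaHat k R) := by
  ext f n
  simp only [sigmaSep, seriesToSep, RingHom.comp_apply, coeff_frobSeries, PowerSeries.coeff_map,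
    map_pow]

theorem isUnit_zSubZeta (P : CharPoint R) : IsUnit (seriesToSep R L P.zSubZeta) := by
  rw [PowerSeries.isUnit_iff_constantCoeff]
  simp [seriesToSep, CharPoint.zSubZeta, P.ne_zero]

/-- The homomorphism `R⟦z⟧[1/(z-ζ)] → L^sep⟦z⟧`; note that `z - ζ` is a unit in `L^sep⟦z⟧`. -/
def locToSep (P : CharPoint R) : P.Loc →+* (SeparableClosure L)⟦X⟧ :=
  IsLocalization.Away.lift P.zSubZeta (isUnit_zSubZeta L P)

theorem locToSep_comp (P : CharPoint R) : (locToSep L P).comp P.toLoc = seriesToSep R L :=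
  IsLocalization.Away.lift_comp _ _

/-- The `L^sep⟦z⟧`-module `M ⊗_{R⟦z⟧} L^sep⟦z⟧`. -/
abbrev sepModule : Type _ := BaseChange (seriesToSep R L) M.carrier

/-- The `σ̂`-semilinear map `m ↦ τ(σ̂_M^* m)`, `M → M[1/(z-ζ)] → M ⊗ L^sep⟦z⟧`. -/
def tauSepAux : M.carrier →ₛₗ[(sigmaSep k R L).comp (seriesToSep R L)] M.sepModule L where
  toFun m := BaseChange.along P.toLoc (locToSep L P) (seriesToSep R L) (locToSep_comp L P)
    (M.τ (BaseChange.mk P.toLoc (BaseChange.mk (sigmaHat k R) m)))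
  map_add' x y := by simp only [_root_.map_add]
  map_smul' a x := by
    rw [map_smulₛₗ, map_smulₛₗ, _root_.map_smul, map_smulₛₗ]
    have h : (sigmaSep k R L).comp (seriesToSep R L) a =
        locToSep L P (P.toLoc (sigmaHat k R a)) := by
      rw [sigmaSep_comp, ← locToSep_comp L P]
      rfl
    rw [h]

/-- The `σ̂`-semilinear endomorphism `m ↦ τ_M(σ̂_M^* m)` of `M ⊗_{R⟦z⟧} L^sep⟦z⟧`,
given by `m ⊗ b ↦ σ̂(b) · τ(σ̂_M^* m)`. -/
def tauSep : M.sepModule L →ₛₗ[sigmaSep k R L] M.sepModule L :=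
  BaseChange.extend (sigmaSep k R L) (M.tauSepAux L)

/-- The action of `A_v = k⟦z⟧` on `M ⊗_{R⟦z⟧} L^sep⟦z⟧`. -/
instance instModuleASep : Module k⟦X⟧ (M.sepModule L) :=
  Module.compHom _ (PowerSeries.map (toSep k R L))

/-- The `v`-adic realization (dual Tate module)
`H¹_v(M, A_v) = {m ∈ M ⊗_{R⟦z⟧} L^sep⟦z⟧ : τ_M(σ̂_M^* m) = m}`. -/
def tateModule : Submodule k⟦X⟧ (M.sepModule L) where
  carrier := {m | M.tauSep L m = m}
  add_mem' {x y} hx hy := by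
    change M.tauSep L (x + y) = x + y
    rw [_root_.map_add, show M.tauSep L x = x from hx, show M.tauSep L y = y from hy]
  zero_mem' := _root_.map_zero _
  smul_mem' a x hx := by
    change M.tauSep L (PowerSeries.map (toSep k R L) a • x) = PowerSeries.map (toSep k R L) a • x
    rw [map_smulₛₗ, show M.tauSep L x = x from hx, sigmaSep, frobSeries_map]

theorem tauSep_map (f : M.End) (x : M.sepModule L) :
    M.tauSep L (BaseChange.map (seriesToSep R L) f.1 x) =
      BaseChange.map (seriesToSep R L) f.1 (M.tauSep L x) := by
  have h : ∀ y : BaseChange P.toLoc M.carrier,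
      BaseChange.along P.toLoc (locToSep L P) (seriesToSep R L) (locToSep_comp L P)
        (BaseChange.map P.toLoc f.1 y) = BaseChange.map (seriesToSep R L) f.1
      (BaseChange.along P.toLoc (locToSep L P) (seriesToSep R L) (locToSep_comp L P) y) := by
    refine BaseChange.induction P.toLoc ?_ ?_
    · intro b m
      rw [_root_.map_smul, map_smulₛₗ, map_smulₛₗ, _root_.map_smul, BaseChange.map_mk,
        BaseChange.along_mk, BaseChange.along_mk, BaseChange.map_mk]
    · intro x y hx hy
      simp only [_root_.map_add, hx, hy]
  refine BaseChange.induction (seriesToSep R L) (p := fun x => M.tauSep L (BaseChange.map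
    (seriesToSep R L) f.1 x) = BaseChange.map (seriesToSep R L) f.1 (M.tauSep L x)) ?_ ?_ x
  · intro b m
    rw [_root_.map_smul, map_smulₛₗ, map_smulₛₗ, _root_.map_smul, BaseChange.map_mk, tauSep,
      BaseChange.extend_mk, BaseChange.extend_mk]
    congr 1
    change BaseChange.along P.toLoc _ _ (locToSep_comp L P) (M.τ _) =
      BaseChange.map _ _ (BaseChange.along P.toLoc _ _ (locToSep_comp L P) (M.τ _))
    rw [← h, ← f.2]
    rfl
  · intro x y hx hy
    simp only [_root_.map_add, hx, hy]

/-- The action of `End_R(M)` on `H¹_v(M, A_v)`. -/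
def endTate : M.End →+* Module.End k⟦X⟧ (M.tateModule L) where
  toFun f :=
    { toFun := fun m => ⟨BaseChange.map (seriesToSep R L) f.1 m.1, by
        change M.tauSep L _ = _
        rw [tauSep_map, show M.tauSep L m.1 = m.1 from m.2]⟩
      map_add' := fun x y => Subtype.ext ((BaseChange.map (seriesToSep R L) f.1).map_add _ _)
      map_smul' := fun a x => Subtype.ext ((BaseChange.map (seriesToSep R L) f.1).map_smul
        (PowerSeries.map (toSep k R L) a) x.1) }
  map_one' := LinearMap.ext fun m => Subtype.ext
    (LinearMap.congr_fun (BaseChange.mapEnd (seriesToSep R L) M.carrier).map_one m.1)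
  map_mul' f g := LinearMap.ext fun m => Subtype.ext
    (LinearMap.congr_fun (BaseChange.map_mul f.1 g.1) m.1)
  map_zero' := LinearMap.ext fun m => Subtype.ext
    (LinearMap.congr_fun (BaseChange.mapEnd (seriesToSep R L) M.carrier).map_zero m.1)
  map_add' f g := LinearMap.ext fun m => Subtype.ext
    (LinearMap.congr_fun (BaseChange.map_add f.1 g.1) m.1)

/-- The rational `v`-adic realization `H¹_v(M, Q_v) = Q_v ⊗_{A_v} H¹_v(M, A_v)`. -/
abbrev rationalTate : Type _ := k⸨X⸩ ⊗[k⟦X⟧] M.tateModule L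

theorem endTate_algebraMap (a : k⟦X⟧) :
    M.endTate L (algebraMap k⟦X⟧ M.End a) = algebraMap k⟦X⟧ (Module.End k⟦X⟧ (M.tateModule L)) a := by
  ext m
  refine (LinearMap.congr_fun (BaseChange.map_algebraMap (f := seriesToSep R L) (M := M.carrier)
    (algebraMap k⟦X⟧ R⟦X⟧ a)) m.1).trans ?_
  rw [Module.algebraMap_end_apply]
  change _ = PowerSeries.map (toSep k R L) a • m.1
  congr 1

/-- The action of `QEnd_R(M)` on `H¹_v(M, Q_v)`, `q ⊗ f ↦ q · (id ⊗ f)`. -/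
def qEndTate : M.QEnd →+* Module.End k⸨X⸩ (M.rationalTate L) :=
  tensorLift (A := k⟦X⟧) (B := k⸨X⸩) (D := M.End) (T := Module.End k⸨X⸩ (M.rationalTate L))
    (algebraMap k⸨X⸩ _) (fun b x => Algebra.commutes b x)
    ((Module.End.baseChangeHom k⟦X⟧ k⸨X⸩ (M.tateModule L)).toRingHom.comp (M.endTate L))
    (fun a => by
      rw [RingHom.comp_apply, endTate_algebraMap]
      refine ((Module.End.baseChangeHom k⟦X⟧ k⸨X⸩ (M.tateModule L)).commutes a).trans ?_
      rw [IsScalarTower.algebraMap_apply k⟦X⟧ k⸨X⸩])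

end tate

section deRham

variable [IsAdicComplete (IsLocalRing.maximalIdeal R) R]
variable (L : Type*) [Field L] [Algebra R L] [IsFractionRing R L]

/-- The homomorphism `R⟦z⟧ → L⟦z-ζ⟧`, `z ↦ z = ζ + (z-ζ)`. Here `L⟦z-ζ⟧` is the power series ring
over `L`, whose variable `X` stands for `z - ζ`. -/
def toSeries (P : CharPoint R) : R⟦X⟧ →+* L⟦X⟧ :=
  (PowerSeries.map (algebraMap R L)).comp (taylorShift P).toRingHom

/-- The evaluation `R⟦z⟧ → R`, `z ↦ ζ`. -/
def evalZeta (P : CharPoint R) : R⟦X⟧ →+* R :=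
  (PowerSeries.constantCoeff (R := R)).comp (taylorShift P).toRingHom

variable (k)

theorem isUnit_toSeries_X (P : CharPoint R) :
    IsUnit ((toSeries L P).comp (algebraMap k⟦X⟧ R⟦X⟧) PowerSeries.X) := by
  have h : (toSeries L P).comp (algebraMap k⟦X⟧ R⟦X⟧) PowerSeries.X =
      PowerSeries.C (algebraMap R L P.ζ) + PowerSeries.X := by
    rw [RingHom.comp_apply, PowerSeries.algebraMap_apply'', PowerSeries.map_X]
    change PowerSeries.map (algebraMap R L) (taylorShift P PowerSeries.X) = _
    rw [taylorShift_X]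
    simp
  rw [h, PowerSeries.isUnit_iff_constantCoeff]
  simp [P.ne_zero]

/-- The homomorphism `Q_v = k((z)) → L⟦z-ζ⟧`, `z ↦ z = ζ + (z-ζ)`. -/
def qToSeries (P : CharPoint R) : k⸨X⸩ →+* L⟦X⟧ :=
  IsLocalization.Away.lift (PowerSeries.X : k⟦X⟧) (isUnit_toSeries_X k L P)

theorem qToSeries_algebraMap (P : CharPoint R) (a : k⟦X⟧) :
    qToSeries k L P (algebraMap k⟦X⟧ k⸨X⸩ a) = toSeries L P (algebraMap k⟦X⟧ R⟦X⟧ a) :=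
  IsLocalization.Away.lift_eq _ _ _

/-- The embedding `γ : Q_v = k((z)) → L`, `z ↦ ζ`. -/
def gamma (P : CharPoint R) : k⸨X⸩ →+* L :=
  (PowerSeries.constantCoeff (R := L)).comp (qToSeries k L P)

variable {k}

theorem gamma_algebraMap (P : CharPoint R) (a : k⟦X⟧) :
    gamma k L P (algebraMap k⟦X⟧ k⸨X⸩ a) =
      algebraMap R L (evalZeta P (algebraMap k⟦X⟧ R⟦X⟧ a)) := by
  rw [gamma, RingHom.comp_apply, qToSeries_algebraMap]
  rw [← PowerSeries.coeff_zero_eq_constantCoeff_apply, evalZeta, RingHom.comp_apply,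
    ← PowerSeries.coeff_zero_eq_constantCoeff_apply, toSeries, RingHom.comp_apply,
    PowerSeries.coeff_map]

/-- For a homomorphism `g` from `R⟦z⟧` to a ring `B`, the action of `End_R(M)` on
`σ̂^*M ⊗_{R⟦z⟧, g} B`, where `f` acts as `σ̂^*f ⊗ id`. -/
def endPullback {B : Type*} [CommRing B] (g : R⟦X⟧ →+* B) :
    M.End →+* Module.End B (BaseChange g M.sigmaPullback) :=
  (BaseChange.mapEnd g M.sigmaPullback).comp
    ((BaseChange.mapEnd (sigmaHat k R) M.carrier).comp M.End.val.toRingHom)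

theorem endPullback_algebraMap {B : Type*} [CommRing B] (g : R⟦X⟧ →+* B) (a : k⟦X⟧) :
    M.endPullback g (algebraMap k⟦X⟧ M.End a) = algebraMap B _ (g (algebraMap k⟦X⟧ R⟦X⟧ a)) :=
  (congrArg (BaseChange.map g) (M.map_sigmaHat_algebraMap a)).trans
    (BaseChange.map_algebraMap _)

/-- The de Rham realization `H¹_dR(M, R) = σ̂^*M ⊗_{R⟦z⟧, z ↦ ζ} R`. -/
abbrev deRhamR : Type _ := BaseChange (evalZeta P) M.sigmaPullback

/-- The de Rham realization `H¹_dR(M, L) = σ̂^*M ⊗_{R⟦z⟧, z ↦ ζ} L`. -/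
abbrev deRhamL : Type _ := BaseChange ((algebraMap R L).comp (evalZeta P)) M.sigmaPullback

/-- The de Rham realization `H¹_dR(M, L⟦z-ζ⟧) = σ̂^*M ⊗_{R⟦z⟧} L⟦z-ζ⟧`. -/
abbrev deRhamSeries : Type _ := BaseChange (toSeries L P) M.sigmaPullback

/-- The canonical map `H¹_dR(M, R) → H¹_dR(M, L)`. -/
def deRhamRtoL : M.deRhamR →ₛₗ[algebraMap R L] M.deRhamL L :=
  BaseChange.along (evalZeta P) (algebraMap R L) _ rfl

/-- The action of `QEnd_R(M)` on `H¹_dR(M, L⟦z-ζ⟧)`. -/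
def qEndSeries : M.QEnd →+* Module.End L⟦X⟧ (M.deRhamSeries L) :=
  tensorLift ((algebraMap L⟦X⟧ _).comp (qToSeries k L P)) (fun _ x => Algebra.commutes _ x)
    (M.endPullback (toSeries L P)) (fun a => by
      rw [endPullback_algebraMap, RingHom.comp_apply, qToSeries_algebraMap])

/-- The action of `QEnd_R(M)` on `H¹_dR(M, L)`. -/
def qEndL : M.QEnd →+* Module.End L (M.deRhamL L) :=
  tensorLift ((algebraMap L _).comp (gamma k L P)) (fun _ x => Algebra.commutes _ x)
    (M.endPullback ((algebraMap R L).comp (evalZeta P))) (fun a => by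
      rw [endPullback_algebraMap, RingHom.comp_apply, RingHom.comp_apply, gamma_algebraMap])

end deRham

section cm

variable (E : Type*) [CommRing E] [Algebra k⸨X⸩ E]

/-- Complex multiplication of the local shtuka `M` by a commutative `Q_v`-algebra `E`: an
embedding `E ⊆ QEnd_R(M)` of `Q_v`-algebras, where `dim_{Q_v} E = rk M`. -/
structure CM where
  /-- the embedding -/
  ι : E →ₐ[k⸨X⸩] M.QEnd
  injective : Function.Injective ι
  finrank_eq : Module.finrank k⸨X⸩ E = M.rank

variable (k) in
/-- For a homomorphism `g : Q_v → K`, the set of `Q_v`-homomorphisms `ψ : E → K`. -/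
def Emb {K : Type*} [CommRing K] (g : k⸨X⸩ →+* K) : Type _ :=
  {ψ : E →+* K // ψ.comp (algebraMap k⸨X⸩ E) = g}

namespace CM

variable {M E} (C : M.CM E)
variable (L : Type*) [Field L] [Algebra R L] [IsFractionRing R L]

/-- `H¹_v(M, Q_v)` with the `E`-module structure given by the complex multiplication. -/
def tate (_C : M.CM E) : Type _ := M.rationalTate L

instance : AddCommGroup (C.tate L) :=
  (TensorProduct.addCommGroup : AddCommGroup (M.rationalTate L))

instance : Module E (C.tate L) :=
  Module.compHom (M.rationalTate L) ((M.qEndTate L).comp C.ι.toRingHom)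

variable [IsAdicComplete (IsLocalRing.maximalIdeal R) R]

variable (k P E) in
/-- The ring `E ⊗_{Q_v} L⟦z-ζ⟧`. -/
abbrev ESeries : Type _ := BaseChange.Ring (qToSeries k L P) E

/-- `H¹_dR(M, L⟦z-ζ⟧)` with the `E ⊗_{Q_v} L⟦z-ζ⟧`-module structure given by the complex
multiplication. -/
def deRham (_C : M.CM E) : Type _ := M.deRhamSeries L

instance : AddCommGroup (C.deRham L) := inferInstanceAs (AddCommGroup (M.deRhamSeries L))

/-- The action of `E ⊗_{Q_v} L⟦z-ζ⟧` on `H¹_dR(M, L⟦z-ζ⟧)`. -/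
def seriesAction : ESeries k P E L →+* Module.End L⟦X⟧ (M.deRhamSeries L) :=
  BaseChange.Ring.lift (qToSeries k L P) (algebraMap L⟦X⟧ _) (fun b x => Algebra.commutes b x)
    ((M.qEndSeries L).comp C.ι.toRingHom) (fun a => by
      have h : (C.ι.toRingHom (algebraMap k⸨X⸩ E a) : M.QEnd) = a ⊗ₜ 1 := C.ι.commutes a
      rw [RingHom.comp_apply, h, qEndSeries, tensorLift_tmul, map_one, mul_one,
        RingHom.comp_apply])

instance : Module (ESeries k P E L) (C.deRham L) :=
  Module.compHom (M.deRhamSeries L) (C.seriesAction L)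

/-- The action of `E` on `H¹_dR(M, L)`. -/
def actionL : E →+* Module.End L (M.deRhamL L) := (M.qEndL L).comp C.ι.toRingHom

variable {L}

/-- The factor field `E_{i(ψ)}` of `E` through which `ψ : E → L` factors. -/
abbrev Factor {g : k⸨X⸩ →+* L} (ψ : Emb k E g) : Type _ := E ⧸ RingHom.ker ψ.1

variable (k) in
/-- `y` is a uniformizer of the finite field extension `F` of `Q_v`, i.e. a prime element of the
integral closure of `A_v` in `F`. -/
def IsUniformizer {F : Type*} [CommRing F] [Algebra k⸨X⸩ F] (y : F) : Prop :=
  letI : Algebra k⟦X⟧ F := ((algebraMap k⸨X⸩ F).comp (algebraMap k⟦X⟧ k⸨X⸩)).toAlgebra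
  ∃ h : y ∈ integralClosure k⟦X⟧ F, Irreducible (⟨y, h⟩ : integralClosure k⟦X⟧ F)

/-- The inseparability degree of `E_{i(ψ)}` over `Q_v`. -/
def insepDegree [Module.Finite k⸨X⸩ E] {g : k⸨X⸩ →+* L} (ψ : Emb k E g) : ℕ :=
  haveI : IsArtinianRing E := IsArtinianRing.of_finite k⸨X⸩ E
  haveI : (RingHom.ker ψ.1).IsPrime := RingHom.ker_isPrime ψ.1
  haveI : (RingHom.ker ψ.1).IsMaximal := IsArtinianRing.isMaximal_of_isPrime _
  letI : Field (Factor ψ) := Ideal.Quotient.field _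
  Field.finInsepDegree k⸨X⸩ (Factor ψ)

/-- `L⟦y-ψ(y)⟧` as an `E ⊗_{Q_v} L⟦z-ζ⟧`-algebra, where `y ∈ E_{i(ψ)}`: the power series ring `L⟦Y⟧`
in the variable `Y = y - ψ(y)`, together with an `L`-algebra homomorphism
`E ⊗_{Q_v} L⟦z-ζ⟧ → L⟦Y⟧` that sends `y` to `ψ(y) + Y` and reduces to `ψ` on `E` modulo `Y`. -/
@[ext]
structure Expansion (ψ : Emb k E (gamma k L P)) (y : Factor ψ) where
  /-- the homomorphism `E ⊗_{Q_v} L⟦z-ζ⟧ → L⟦y-ψ(y)⟧` -/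
  toRingHom : ESeries k P E L →+* L⟦X⟧
  map_C : ∀ c : L, toRingHom (BaseChange.Ring.inl _ E (PowerSeries.C c)) = PowerSeries.C c
  constantCoeff_map : ∀ e : E,
    PowerSeries.constantCoeff (toRingHom (BaseChange.Ring.inr _ E e)) = ψ.1 e
  map_uniformizer : ∀ e : E, Ideal.Quotient.mk _ e = y →
    toRingHom (BaseChange.Ring.inr _ E e) = PowerSeries.C (ψ.1 e) + PowerSeries.X

/-- `H^ψ(M, L⟦y-ψ(y)⟧) = H¹_dR(M, L⟦z-ζ⟧) ⊗_{E ⊗ L⟦z-ζ⟧} L⟦y-ψ(y)⟧`. -/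
abbrev HPsiSeries {ψ : Emb k E (gamma k L P)} {y : Factor ψ} (Θ : Expansion ψ y) : Type _ :=
  BaseChange Θ.toRingHom (C.deRham L)

/-- The generalized `ψ`-eigenspace of the `E`-action on `H¹_dR(M, L)`. -/
def genEigenspace (ψ : Emb k E (gamma k L P)) : Submodule L (M.deRhamL L) :=
  ⨅ a : E, (C.actionL L a).maxGenEigenspace (ψ.1 a)

/-- `H^ψ(M, R)`, the set of `ω ∈ H¹_dR(M, R)` such that for every `a ∈ E ∩ End_R(M)` one has
`([a]^* - ψ(a))^n ω = 0` for `n ≫ 0`. Here `f ∈ End_R(M)` is the element `a` of `E ∩ End_R(M)` and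
`r` is `ψ(a)` as an element of `R`. -/
def HPsiR (ψ : Emb k E (gamma k L P)) : Submodule R M.deRhamR :=
  ⨅ (a : E) (f : M.End) (r : R) (_ : C.ι a = 1 ⊗ₜ f) (_ : algebraMap R L r = ψ.1 a),
    (M.endPullback (evalZeta P) f).maxGenEigenspace r

/-- The canonical `L`-linear map `H^ψ(M, R) ⊗_R L → H¹_dR(M, L)`. -/
def HPsiRtoL (ψ : Emb k E (gamma k L P)) :
    BaseChange (algebraMap R L) (C.HPsiR ψ) →ₗ[L] M.deRhamL L :=
  BaseChange.extend (RingHom.id L)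
    { toFun := fun ω => M.deRhamRtoL L ω.1
      map_add' := fun x y => (M.deRhamRtoL L).map_add x.1 y.1
      map_smul' := fun a x => (M.deRhamRtoL L).map_smulₛₗ a x.1 }

end CM

end cm

end LocalShtuka

end shtuka

end

/-!
By Lang's theorem for `σ`-linear equations over the separably closed field `L^sep`, solved one
power of `z` at a time, the Tate module of a local shtuka of rank `r` is free of rank `r` over
`A_v`. A faithful module over the semisimple algebra `E` whose dimension over `Q_v` is that of `E`
is free of rank one, which is (a). Some orbit determinant, that is, the determinant of
`x ↦ x • v` on a `Q_v`-basis of `E` for a suitable `v`, is therefore nonzero on the Tate module.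
Orbit determinants exist over `R⟦X⟧`, and Frobenius equivariance of `τ` shows that the one on
`σ̂^* M` becomes a unit over `L⟦X⟧` under `z ↦ ζ + X`; this gives (b).

For (c), a finite extension `F` of `Q_v` has `[F : F^p] = p`, so it is generated over `F^(p^n)` by
a uniformizer `y`, and a homomorphism `ψ : F → L` has a unique Taylor expansion `F → L⟦X⟧` sending
`y` to `ψ(y) + X`. The image of `z - ζ` is divisible by the power of `X` given by the inseparable
degree of `F`, these degrees add up to `dim E`, and the constant terms `ψ` are pairwise distinct.
Hence approximation modulo `X` and a dimension count identify `E ⊗ L⟦z - ζ⟧` with the product.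

For (d) and (e), reducing the generator of (b) modulo `z - ζ` exhibits the `ψ`-generalized
eigenspace as having at least the inseparable degree as its dimension; the same count gives
equality. Each `a ∈ E` has a multiple by a power of `z` in `End_R(M)`, and multiplication by a
nonzero element of `R` moves any vector into the lattice `H¹_dR(M, R)`, so that the eigenspaces
over `L` are spanned by their intersections with it.
-/

section FrobeniusModules

open Polynomial

section Roots

variable {K : Type*} [Field K] {q : ℕ}

theorem exists_ne_zero_eval_eq_self [IsSepClosed K] {f : K[X]} (hf : f ≠ 0)
    (hder : derivative f = 0) (hX : X ^ 2 ∣ f) : ∃ c, c ≠ 0 ∧ f.eval c = c := by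
  obtain ⟨h, rfl⟩ := hX
  have hh : h ≠ 0 := right_ne_zero_of_mul hf
  have hfactor : X ^ 2 * h - X = X * (X * h - 1) := by ring
  have hsep : (X * h - 1 : K[X]).Separable := by
    refine Separable.of_mul_right (f := X) ?_
    rw [← hfactor, separable_def, derivative_sub, hder, derivative_X, zero_sub]
    exact ⟨0, -1, by ring⟩
  have hdeg : (X * h - 1 : K[X]).natDegree = h.natDegree + 1 := by
    rw [← C_1, natDegree_sub_C, natDegree_X_mul hh]
  obtain ⟨c, hc⟩ := IsSepClosed.exists_root _
    (degree_ne_of_natDegree_ne (n := 0) (by rw [hdeg]; omega)) hsep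
  have hc1 : c * h.eval c = 1 := by simpa [IsRoot, sub_eq_zero] using hc
  refine ⟨c, left_ne_zero_of_mul_eq_one hc1, ?_⟩
  rw [eval_mul, eval_pow, eval_X, sq, mul_assoc, hc1, mul_one]

theorem exists_pow_sub_eq [IsSepClosed K] (hq : 1 < q) (hq0 : (q : K) = 0) (a : K) :
    ∃ c : K, c ^ q - c = a := by
  have hsep : (X ^ q - X - C a : K[X]).Separable := by
    rw [separable_def]
    simp only [derivative_sub, derivative_X_pow, hq0, derivative_X, derivative_C]
    exact ⟨0, -1, by simp⟩
  have hdeg : (X ^ q - X - C a : K[X]).natDegree = q := by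
    rw [natDegree_sub_C, natDegree_sub_eq_left_of_natDegree_lt, natDegree_X_pow]
    rwa [natDegree_X_pow, natDegree_X]
  obtain ⟨c, hc⟩ := IsSepClosed.exists_root _
    (degree_ne_of_natDegree_ne (n := 0) (by rw [hdeg]; omega)) hsep
  exact ⟨c, by simpa [IsRoot, sub_eq_zero] using hc⟩

/-- The additive polynomials `f₀ = a₀ X^q`, `fᵢ₊₁ = fᵢ^q + aᵢ₊₁ X^q`: the coordinates of a fixed
vector of a cyclic Frobenius module, written as functions of its last coordinate `X`. -/
noncomputable def cyclicCoord (q : ℕ) (a : ℕ → K) : ℕ → K[X]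
  | 0 => C (a 0) * X ^ q
  | i + 1 => cyclicCoord q a i ^ q + C (a (i + 1)) * X ^ q

theorem le_natDegree_cyclicCoord (hq : 1 < q) {a : ℕ → K} (ha : a 0 ≠ 0) (i : ℕ) :
    q ≤ (cyclicCoord q a i).natDegree := by
  induction i with
  | zero => rw [cyclicCoord, natDegree_C_mul_X_pow _ _ ha]
  | succ i ih =>
    have hlow : (C (a (i + 1)) * X ^ q).natDegree ≤ q := natDegree_C_mul_X_pow_le _ _
    have hhigh : q < (cyclicCoord q a i ^ q).natDegree := by rw [natDegree_pow]; nlinarith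
    rw [cyclicCoord, natDegree_add_eq_left_of_natDegree_lt (hlow.trans_lt hhigh)]
    exact hhigh.le

theorem derivative_cyclicCoord (hq0 : (q : K) = 0) (a : ℕ → K) (i : ℕ) :
    derivative (cyclicCoord q a i) = 0 := by
  cases i <;> simp [cyclicCoord, derivative_pow, hq0]

theorem X_pow_dvd_cyclicCoord (hq : q ≠ 0) (a : ℕ → K) (i : ℕ) : X ^ q ∣ cyclicCoord q a i := by
  induction i with
  | zero => exact dvd_mul_left _ _
  | succ i ih => exact dvd_add (ih.trans (dvd_pow_self _ hq)) (dvd_mul_left _ _)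

theorem exists_cyclic_solution [IsSepClosed K] (hq : 1 < q) (hq0 : (q : K) = 0) {a : ℕ → K}
    (ha : a 0 ≠ 0) (m : ℕ) :
    ∃ c : ℕ → K, c m ≠ 0 ∧ c 0 = a 0 * c m ^ q ∧
      ∀ i, c (i + 1) = c i ^ q + a (i + 1) * c m ^ q := by
  have hne : cyclicCoord q a m ≠ 0 := by
    rintro h
    have := le_natDegree_cyclicCoord hq ha m
    rw [h, natDegree_zero] at this
    omega
  obtain ⟨c, hc0, hc⟩ := exists_ne_zero_eval_eq_self hne (derivative_cyclicCoord hq0 a m)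
    ((pow_dvd_pow X hq).trans (X_pow_dvd_cyclicCoord (by omega) a m))
  exact ⟨fun i => (cyclicCoord q a i).eval c, by simpa only [hc], by simp [hc, cyclicCoord],
    fun i => by simp [hc, cyclicCoord]⟩

end Roots

variable {K V : Type*} [Field K] [AddCommGroup V] [Module K V] {s : K →+* K} {q : ℕ}

theorem linearIndependent_semilinear_comp [FiniteDimensional K V] (φ : V →ₛₗ[s] V)
    (hφ : Submodule.span K (Set.range φ) = ⊤) {n : Type*} {v : n → V}
    (hv : LinearIndependent K v) : LinearIndependent K (φ ∘ v) := by
  have basis_case {ι : Type _} [Fintype ι] (b : Module.Basis ι K V) :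
      LinearIndependent K (φ ∘ b) := by
    refine linearIndependent_of_top_le_span_of_card_eq_finrank ?_
      (Module.finrank_eq_card_basis b).symm
    rw [← hφ, Submodule.span_le]
    rintro _ ⟨x, rfl⟩
    rw [← b.sum_repr x, map_sum]
    refine Submodule.sum_mem _ fun i _ => ?_
    rw [map_smulₛₗ]
    exact Submodule.smul_mem _ _ (Submodule.subset_span ⟨i, rfl⟩)
  have hli := hv.linearIndepOn_id
  let b := Module.Basis.extend hli
  have := Module.Finite.finite_basis b
  have := Fintype.ofFinite (hli.extend (Set.subset_univ _))
  let j (i : n) : hli.extend (Set.subset_univ _) := ⟨v i, hli.subset_extend _ ⟨i, rfl⟩⟩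
  have hbj : b ∘ j = v := funext fun i => Module.Basis.extend_apply_self hli (j i)
  have hj : Function.Injective j := .of_comp (f := b) (hbj.symm ▸ hv.injective)
  exact hbj ▸ (basis_case b).comp j hj

/-- The orbit of a nonzero vector spans a cyclic submodule `⊕_{i ≤ m} K φⁱ(v)`; as `φ` preserves
linear independence, `v` itself occurs in the relation expressing `φᵐ⁺¹(v)`. -/
theorem exists_cyclic_relation [FiniteDimensional K V] [Nontrivial V] (φ : V →ₛₗ[s] V)
    (hφ : Submodule.span K (Set.range φ) = ⊤) :
    ∃ (m : ℕ) (w : ℕ → V) (a : ℕ → K), (∀ i, φ (w i) = w (i + 1)) ∧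
      LinearIndependent K (fun i : Fin (m + 1) => w i) ∧ a 0 ≠ 0 ∧
      ∑ i ∈ Finset.range (m + 1), a i • w i = w (m + 1) := by
  classical
  obtain ⟨v, hv⟩ := exists_ne (0 : V)
  let w : ℕ → V := fun i => φ^[i] v
  have hw : ∀ i, φ (w i) = w (i + 1) := fun i => (Function.iterate_succ_apply' φ i v).symm
  have hdep : ∃ m, ¬ LinearIndependent K (fun i : Fin (m + 2) => w i) := by
    refine ⟨Module.finrank K V, fun hl => ?_⟩
    have := hl.fintype_card_le_finrank
    simp at this
  obtain ⟨m, hm, hmin⟩ : ∃ m, ¬ LinearIndependent K (fun i : Fin (m + 2) => w i) ∧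
      ∀ j < m, LinearIndependent K (fun i : Fin (j + 2) => w i) :=
    ⟨Nat.find hdep, Nat.find_spec hdep, fun j hj => not_not.1 (Nat.find_min hdep hj)⟩
  have hli : LinearIndependent K (fun i : Fin (m + 1) => w i) := by
    cases m with
    | zero => exact (linearIndependent_unique_iff (ι := Fin 1)).2 hv
    | succ j => exact hmin j j.lt_succ_self
  have hmem : w (m + 1) ∈ Submodule.span K (Set.range fun i : Fin (m + 1) => w i) := by
    by_contra hn
    exact hm (linearIndependent_finSucc'.2 ⟨hli, hn⟩)
  obtain ⟨a', ha'⟩ := (Submodule.mem_span_range_iff_exists_fun K).1 hmem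
  obtain ⟨a, ha⟩ : ∃ a : ℕ → K, ∀ i : Fin (m + 1), a i = a' i :=
    ⟨fun n => if h : n < m + 1 then a' ⟨n, h⟩ else 0, fun i => dif_pos i.2⟩
  have hsum : ∑ i ∈ Finset.range (m + 1), a i • w i = w (m + 1) := by
    simp only [Finset.sum_range, ha, ha']
  refine ⟨m, w, a, hw, hli, fun ha0 => ?_, hsum⟩
  have hshift : LinearIndependent K (fun i : Fin (m + 1) => w (i + 1)) :=
    (funext fun i : Fin (m + 1) => hw i) ▸ linearIndependent_semilinear_comp φ hφ hli
  refine (linearIndependent_finSucc'.1 hshift).2 ?_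
  rw [Fin.val_last, ← hsum, Finset.sum_range_succ', ha0, zero_smul, add_zero, Finset.sum_range]
  exact Submodule.sum_mem _ fun i _ => Submodule.smul_mem _ _ (Submodule.subset_span ⟨i, rfl⟩)

theorem exists_fixed_ne_zero [IsSepClosed K] [FiniteDimensional K V] [Nontrivial V] (hq : 1 < q)
    (hq0 : (q : K) = 0) (hs : ∀ a, s a = a ^ q) (φ : V →ₛₗ[s] V)
    (hφ : Submodule.span K (Set.range φ) = ⊤) : ∃ x, φ x = x ∧ x ≠ 0 := by
  obtain ⟨m, w, a, hw, hli, ha0, hsum⟩ := exists_cyclic_relation φ hφ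
  obtain ⟨c, hcm, hc0, hc⟩ := exists_cyclic_solution hq hq0 ha0 m
  refine ⟨∑ i ∈ Finset.range (m + 1), c i • w i, ?_, fun h0 => ?_⟩
  · rw [map_sum]
    simp only [map_smulₛₗ, hs, hw]
    rw [Finset.sum_range_succ, ← hsum, Finset.smul_sum, Finset.sum_range_succ' _ m,
      Finset.sum_range_succ' (fun i => c i • w i) m, hc0, ← add_assoc, ← Finset.sum_add_distrib]
    congr 1
    · refine Finset.sum_congr rfl fun i _ => ?_
      rw [hc i, add_smul, smul_smul, mul_comm]
    · rw [smul_smul, mul_comm]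
  · rw [Finset.sum_range] at h0
    exact hcm (Fintype.linearIndependent_iff.1 hli (fun i => c i) h0 (Fin.last m))

theorem exists_sub_eq_of_mem_span_fixed [IsSepClosed K] (hq : 1 < q) (hq0 : (q : K) = 0)
    (hs : ∀ a, s a = a ^ q) (φ : V →ₛₗ[s] V) {w : V}
    (hw : w ∈ Submodule.span K {x | φ x = x}) :
    ∃ u ∈ Submodule.span K {x | φ x = x}, φ u - u = w := by
  induction hw using Submodule.closure_induction with
  | zero => exact ⟨0, zero_mem _, by simp⟩
  | add x y _ _ hx hy =>
    obtain ⟨u, hu, rfl⟩ := hx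
    obtain ⟨v, hv, rfl⟩ := hy
    exact ⟨u + v, add_mem hu hv, by rw [map_add]; abel⟩
  | smul_mem a x hx =>
    obtain ⟨c, hc⟩ := exists_pow_sub_eq hq hq0 a
    refine ⟨c • x, Submodule.smul_mem _ _ (Submodule.subset_span hx), ?_⟩
    rw [map_smulₛₗ, hs, show φ x = x from hx, ← sub_smul, hc]

theorem span_fixed_eq_top [IsSepClosed K] [FiniteDimensional K V] (hq : 1 < q)
    (hq0 : (q : K) = 0) (hs : ∀ a, s a = a ^ q) (φ : V →ₛₗ[s] V)
    (hφ : Submodule.span K (Set.range φ) = ⊤) : Submodule.span K {x | φ x = x} = ⊤ := by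
  by_contra hne
  set W := Submodule.span K {x | φ x = x} with hW
  have hWφ : W ≤ W.comap φ := by
    rw [hW, Submodule.span_le]
    intro x (hx : φ x = x)
    exact Submodule.subset_span ((congrArg φ hx :))
  let ψ : V ⧸ W →ₛₗ[s] V ⧸ W := W.mapQ W φ hWφ
  have hψ : Submodule.span K (Set.range ψ) = ⊤ := by
    have hrange : W.mkQ '' Set.range φ ⊆ Set.range ψ := by
      rintro _ ⟨_, ⟨y, rfl⟩, rfl⟩
      exact ⟨W.mkQ y, rfl⟩
    have := Submodule.span_mono (R := K) hrange
    rwa [← Submodule.map_span, hφ, Submodule.map_top, W.range_mkQ, top_le_iff] at this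
  have : Nontrivial (V ⧸ W) := Submodule.Quotient.nontrivial_iff.2 hne
  obtain ⟨x, hx, hx0⟩ := exists_fixed_ne_zero hq hq0 hs ψ hψ
  obtain ⟨x, rfl⟩ := W.mkQ_surjective x
  obtain ⟨u, hu, hux⟩ := exists_sub_eq_of_mem_span_fixed hq hq0 hs φ
    ((Submodule.Quotient.eq W).1 hx)
  have hxu : x - u ∈ W := Submodule.subset_span (by
    change φ (x - u) = x - u
    rw [map_sub, sub_eq_sub_iff_sub_eq_sub, hux])
  exact hx0 ((Submodule.Quotient.mk_eq_zero W).2 (by simpa using W.add_mem hxu hu))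

section Matrix

variable {n : Type*} [Fintype n] [DecidableEq n]

theorem exists_lang_matrix [IsSepClosed K] (hq : 1 < q) (hq0 : (q : K) = 0) (hs : ∀ a, s a = a ^ q)
    {A : Matrix n n K} (hA : IsUnit A.det) :
    ∃ U : Matrix n n K, IsUnit U.det ∧ A * U.map s = U := by
  let φ : (n → K) →ₛₗ[s] (n → K) :=
    { toFun := fun x => A.mulVec (s ∘ x)
      map_add' := fun x y => by rw [← Matrix.mulVec_add]; congr 1; funext j; simp
      map_smul' := fun a x => by rw [← Matrix.mulVec_smul]; congr 1; funext j; simp }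
  have hφ : Submodule.span K (Set.range φ) = ⊤ := by
    have hcol : Set.range A.col ⊆ Set.range φ := by
      rintro _ ⟨j, rfl⟩
      have hj : s ∘ Pi.single j 1 = Pi.single j 1 := by
        ext i
        simp [Pi.single_apply, apply_ite s]
      exact ⟨Pi.single j 1, (congrArg A.mulVec hj).trans (A.mulVec_single_one j)⟩
    have hsurj : Function.Surjective A.mulVecLin :=
      Matrix.mulVec_surjective_iff_isUnit.2 ((Matrix.isUnit_iff_isUnit_det A).2 hA)
    rw [← top_le_iff, ← LinearMap.range_eq_top.2 hsurj, A.range_mulVecLin]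
    exact Submodule.span_mono hcol
  let b₀ := Module.Basis.ofSpan (span_fixed_eq_top hq hq0 hs φ hφ).ge
  let b := b₀.reindex (b₀.indexEquiv (Pi.basisFun K n))
  have hb (j : n) : φ (b j) = b j := by
    rw [Module.Basis.reindex_apply]
    exact Module.Basis.ofSpan_subset (span_fixed_eq_top hq hq0 hs φ hφ).ge ⟨_, rfl⟩
  refine ⟨(Pi.basisFun K n).toMatrix b, ?_, ?_⟩
  · rw [← Module.Basis.det_apply]
    exact (Pi.basisFun K n).isUnit_det b
  · ext i j
    exact congrFun (hb j) i

theorem exists_seq_of_initial_segments {α : Type*} (a : α) (F : ∀ m, (Fin (m + 1) → α) → α) :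
    ∃ c : ℕ → α, c 0 = a ∧ ∀ m, c (m + 1) = F m fun k => c k := by
  let next : ∀ m, (∀ k < m, α) → α
    | 0, _ => a
    | m + 1, c => F m fun k => c k k.2
  exact ⟨Nat.strongRec next, Nat.strongRec_eq next 0, fun m => Nat.strongRec_eq next (m + 1)⟩

/-- Modulo `X` the matrix is the identity, so the coefficients of `U` are found successively from
Artin–Schreier equations. -/
theorem exists_lang_matrix_one_add (hs : ∀ a, ∃ c, s c - c = a) (Ψ : Matrix n n K⟦X⟧) :
    ∃ U : Matrix n n K⟦X⟧, U.map PowerSeries.constantCoeff = 1 ∧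
      (1 + (PowerSeries.X : K⟦X⟧) • Ψ) * U.map (PowerSeries.map s) = U := by
  choose r hr using hs
  obtain ⟨c, hc0, hc⟩ := exists_seq_of_initial_segments (1 : Matrix n n K) fun m c =>
    (-∑ k : Fin (m + 1), Ψ.map (PowerSeries.coeff (m - k)) * (c k).map s).map r
  refine ⟨.of fun i j => PowerSeries.mk fun m => c m i j, ?_, ?_⟩
  · ext i j
    simp [hc0]
  ext i j m
  rw [add_mul, one_mul, Matrix.smul_mul, Matrix.add_apply, Matrix.smul_apply, smul_eq_mul, map_add]
  cases m with
  | zero => simp [hc0, Matrix.one_apply, apply_ite s]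
  | succ m =>
    have hcm := hr ((-∑ k : Fin (m + 1), Ψ.map (PowerSeries.coeff (m - k)) * (c k).map s) i j)
    rw [← Matrix.map_apply (f := r), ← hc m, Matrix.neg_apply, sub_eq_iff_eq_add, neg_add_eq_sub,
      eq_sub_iff_add_eq] at hcm
    simp only [Matrix.map_apply, Matrix.of_apply, PowerSeries.coeff_map, PowerSeries.coeff_mk,
      PowerSeries.coeff_succ_X_mul]
    conv_rhs => rw [← hcm]
    congr 1
    simp only [Matrix.mul_apply, Matrix.sum_apply, map_sum, mul_comm (Ψ i _),
      PowerSeries.coeff_mul, Finset.Nat.sum_antidiagonal_eq_sum_range_succ_mk]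
    rw [Finset.sum_comm, Finset.sum_range]
    simp [mul_comm]

theorem exists_lang_powerSeries_matrix [IsSepClosed K] (hq : 1 < q) (hq0 : (q : K) = 0)
    (hs : ∀ a, s a = a ^ q) {Φ : Matrix n n K⟦X⟧} (hΦ : IsUnit Φ.det) :
    ∃ U : Matrix n n K⟦X⟧, IsUnit U.det ∧ Φ * U.map (PowerSeries.map s) = U := by
  obtain ⟨U₀, hU₀, hlang₀⟩ := exists_lang_matrix hq hq0 hs
    (A := Φ.map PowerSeries.constantCoeff) (by
      rw [← RingHom.mapMatrix_apply, ← RingHom.map_det]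
      exact hΦ.map _)
  let toSeries : Matrix n n K →+* Matrix n n K⟦X⟧ := PowerSeries.C.mapMatrix
  let modX : Matrix n n K⟦X⟧ →+* Matrix n n K := PowerSeries.constantCoeff.mapMatrix
  let frob : Matrix n n K⟦X⟧ →+* Matrix n n K⟦X⟧ := (PowerSeries.map s).mapMatrix
  have hmodX (B : Matrix n n K) : modX (toSeries B) = B := by ext; simp [modX, toSeries]
  have hfrob (B : Matrix n n K) : frob (toSeries B) = toSeries (B.map s) := by
    ext1; simp [frob, toSeries]
  obtain ⟨Ψ, hΨ⟩ : ∃ Ψ : Matrix n n K⟦X⟧,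
      toSeries U₀⁻¹ * Φ * frob (toSeries U₀) = 1 + (PowerSeries.X : K⟦X⟧) • Ψ := by
    let D := toSeries U₀⁻¹ * Φ * frob (toSeries U₀) - 1
    have hD : modX D = 0 := by
      simp only [D]
      rw [hfrob, map_sub, map_mul, map_mul, hmodX, hmodX, map_one, mul_assoc,
        show modX Φ * U₀.map s = U₀ from hlang₀, Matrix.nonsing_inv_mul _ hU₀, sub_self]
    choose Ψ hΨ using fun i j => PowerSeries.X_dvd_iff.2
      (show PowerSeries.constantCoeff (D i j) = 0 from congrFun₂ hD i j)
    exact ⟨.of Ψ, eq_add_of_sub_eq' (Matrix.ext hΨ)⟩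
  obtain ⟨V, hV, hlang⟩ := exists_lang_matrix_one_add (s := s)
    (fun a => by simpa only [hs] using exists_pow_sub_eq hq hq0 a) Ψ
  have hV1 : IsUnit V := by
    rw [Matrix.isUnit_iff_isUnit_det, PowerSeries.isUnit_iff_constantCoeff, RingHom.map_det,
      RingHom.mapMatrix_apply, hV, Matrix.det_one]
    exact isUnit_one
  have hU₀1 : IsUnit U₀ := (Matrix.isUnit_iff_isUnit_det _).2 hU₀
  refine ⟨toSeries U₀ * V, (Matrix.isUnit_iff_isUnit_det _).1 ((hU₀1.map toSeries).mul hV1), ?_⟩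
  calc Φ * frob (toSeries U₀ * V)
      = toSeries U₀ * (toSeries U₀⁻¹ * Φ * frob (toSeries U₀)) * frob V := by
        simp only [← mul_assoc]
        rw [← map_mul toSeries, Matrix.mul_nonsing_inv _ hU₀, map_one, one_mul, map_mul, mul_assoc]
    _ = toSeries U₀ * V := by
        rw [hΨ, mul_assoc]
        exact congrArg _ hlang

end Matrix

end FrobeniusModules

namespace BaseChange

variable {A B : Type*} [CommRing A] [CommRing B] (f : A →+* B)
  {M : Type*} [AddCommGroup M] [Module A M] {n : Type*}

/-- The basis of a base change induced by a basis. -/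
noncomputable def basis (b : Module.Basis n A M) : Module.Basis n B (BaseChange f M) :=
  letI := f.toAlgebra
  b.baseChange B

theorem basis_apply (b : Module.Basis n A M) (i : n) : basis f b i = mk f (b i) :=
  let := f.toAlgebra
  Module.Basis.baseChange_apply B b i

theorem basis_repr_mk [Finite n] (b : Module.Basis n A M) (m : M) (i : n) :
    (basis f b).repr (mk f m) i = f (b.repr m i) := by
  have := Fintype.ofFinite n
  conv_lhs => rw [← b.sum_repr m, _root_.map_sum (mk f)]
  simp only [map_smulₛₗ, ← basis_apply, Module.Basis.repr_sum_self]

theorem toMatrix_map [Fintype n] [DecidableEq n] (b : Module.Basis n A M) (g : Module.End A M) :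
    LinearMap.toMatrix (basis f b) (basis f b) (map f g) = (LinearMap.toMatrix b b g).map f := by
  ext i j
  rw [LinearMap.toMatrix_apply, basis_apply, map_mk, basis_repr_mk, Matrix.map_apply,
    LinearMap.toMatrix_apply]

theorem mk_injective [Finite n] (b : Module.Basis n A M) (hf : Function.Injective f) :
    Function.Injective (mk f : M → BaseChange f M) := fun x y hxy =>
  b.ext_elem fun i => hf (by rw [← basis_repr_mk, ← basis_repr_mk, hxy])

theorem basis_repr_along [Finite n] {C : Type*} [CommRing C] (h : B →+* C) (g : A →+* C)
    (hg : h.comp f = g) (b : Module.Basis n A M) (x : BaseChange f M) (i : n) :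
    (basis g b).repr (along f h g hg x) i = h ((basis f b).repr x i) := by
  have := Fintype.ofFinite n
  have hb (j : n) : along f h g hg (basis f b j) = basis g b j := by
    rw [basis_apply, along_mk, basis_apply]
  conv_lhs => rw [← (basis f b).sum_repr x, _root_.map_sum (along f h g hg)]
  simp only [map_smulₛₗ, hb, Module.Basis.repr_sum_self]

theorem along_surjective {C : Type*} [CommRing C] {h : B →+* C} (hsurj : Function.Surjective h)
    {g : A →+* C} (hg : h.comp f = g) :
    Function.Surjective (along f h g hg : BaseChange f M → BaseChange g M) := by
  refine fun x => induction (f := g) (p := fun x => ∃ y, along f h g hg y = x) (fun c m => ?_) ?_ x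
  · obtain ⟨b, rfl⟩ := hsurj c
    exact ⟨b • mk f m, by rw [map_smulₛₗ, along_mk]⟩
  · rintro _ _ ⟨x, rfl⟩ ⟨y, rfl⟩
    exact ⟨x + y, _root_.map_add _ _ _⟩

namespace Ring

variable {E : Type*} [CommRing E] [Algebra A E]

instance : Algebra B (Ring f E) :=
  letI := f.toAlgebra
  (Algebra.TensorProduct.leftAlgebra : Algebra B (B ⊗[A] E))

theorem smul_eq_inl_mul (c : B) (x : Ring f E) : c • x = inl f E c * x :=
  Algebra.smul_def c x

/-- The `B`-basis of `E ⊗_{A,f} B` induced by an `A`-basis of `E`. -/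
noncomputable def basis (b : Module.Basis n A E) : Module.Basis n B (Ring f E) :=
  letI := f.toAlgebra
  b.baseChange B

theorem basis_apply (b : Module.Basis n A E) (i : n) : basis f b i = inr f E (b i) :=
  let := f.toAlgebra
  Module.Basis.baseChange_apply B b i

theorem inr_algebraMap (a : A) : inr f E (algebraMap A E a) = inl f E (f a) := by
  let := f.toAlgebra
  exact ((Algebra.TensorProduct.includeRight : E →ₐ[A] B ⊗[A] E).commutes a).trans
    ((Algebra.TensorProduct.includeLeft : B →ₐ[A] B ⊗[A] E).commutes a).symm

theorem ringHom_ext {T : Type*} [_root_.Ring T] {g h : Ring f E →+* T}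
    (hl : ∀ c, g (inl f E c) = h (inl f E c)) (hr : ∀ e, g (inr f E e) = h (inr f E e)) :
    g = h := by
  let := f.toAlgebra
  ext x
  induction x using (TensorProduct.induction_on (R := A) (M := B) (N := E)) with
  | zero => exact (_root_.map_zero g).trans (_root_.map_zero h).symm
  | tmul c e =>
    have hce : c ⊗ₜ[A] e = (inl f E c * inr f E e : Ring f E) := by
      refine Eq.trans ?_ (Algebra.TensorProduct.tmul_mul_tmul (R := A) c 1 1 e).symm
      rw [mul_one, one_mul]
    rw [hce, _root_.map_mul, _root_.map_mul, hl, hr]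
  | add x y hx hy =>
    exact (_root_.map_add g x y).trans ((congrArg₂ _ hx hy).trans (_root_.map_add h x y).symm)

variable {T : Type*} [_root_.Ring T] (u : B →+* T) (hu : ∀ b x, u b * x = x * u b) (g : E →+* T)
    (h : ∀ a, g (algebraMap A E a) = u (f a))

theorem lift_inl (c : B) : lift f u hu g h (inl f E c) = u c :=
  let := f.toAlgebra
  (tensorLift_tmul u hu g h c 1).trans (by rw [map_one, mul_one])

theorem lift_inr (e : E) : lift f u hu g h (inr f E e) = g e :=
  let := f.toAlgebra
  (tensorLift_tmul u hu g h 1 e).trans (by rw [map_one, one_mul])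

end Ring

end BaseChange

section OrbitDet

variable {A : Type*} [CommRing A] {M : Type*} [AddCommGroup M] [Module A M]
  {n : Type*} [Fintype n] [DecidableEq n]

/-- The polynomial whose value at the coordinates of `x` is the determinant of `(fⱼ x)ⱼ`. Its
non-vanishing is insensitive to extension of scalars, whereas a particular `x` need not descend. -/
noncomputable def orbitDet (b : Module.Basis n A M) (f : n → Module.End A M) : MvPolynomial n A :=
  (Matrix.of fun i j => ∑ l, MvPolynomial.C (LinearMap.toMatrix b b (f j) i l) *
    MvPolynomial.X l : Matrix n n (MvPolynomial n A)).det

theorem eval_orbitDet (b : Module.Basis n A M) (f : n → Module.End A M) (x : M) :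
    MvPolynomial.eval (fun l => b.repr x l) (orbitDet b f) = b.det fun j => f j x := by
  rw [orbitDet, RingHom.map_det, Module.Basis.det_apply]
  congr 1
  ext i j
  rw [Module.Basis.toMatrix_apply, ← congrFun (LinearMap.toMatrix_mulVec_repr b b (f j) x) i]
  simp [Matrix.mulVec, dotProduct]

theorem map_orbitDet {B : Type*} [CommRing B] (g : A →+* B) (b : Module.Basis n A M)
    (f : n → Module.End A M) :
    MvPolynomial.map g (orbitDet b f) =
      orbitDet (BaseChange.basis g b) (fun j => BaseChange.map g (f j)) := by
  rw [orbitDet, orbitDet, RingHom.map_det]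
  congr 1
  ext1 i j
  simp [BaseChange.toMatrix_map]

theorem exists_det_ne_zero [IsDomain A] [Infinite A] {b : Module.Basis n A M}
    {f : n → Module.End A M} (h : orbitDet b f ≠ 0) : ∃ x : M, b.det (fun j => f j x) ≠ 0 := by
  obtain ⟨c, hc⟩ : ∃ c, MvPolynomial.eval c (orbitDet b f) ≠ 0 := by
    by_contra! hn
    exact h (MvPolynomial.funext fun c => by rw [hn, map_zero])
  refine ⟨∑ i, c i • b i, ?_⟩
  rwa [← eval_orbitDet, b.repr_sum_self]

theorem orbitDet_ne_zero {b : Module.Basis n A M} {f : n → Module.End A M} {x : M}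
    (hx : b.det (fun j => f j x) ≠ 0) : orbitDet b f ≠ 0 := by
  rintro h
  rw [← eval_orbitDet, h, map_zero] at hx
  exact hx rfl

theorem det_ne_zero_iff_linearIndependent [IsDomain A] (b : Module.Basis n A M) {v : n → M} :
    b.det v ≠ 0 ↔ LinearIndependent A v := by
  have hcol : LinearIndependent A (b.toMatrix v).col ↔ LinearIndependent A v :=
    b.equivFun.toLinearMap.linearIndependent_iff_of_injOn b.equivFun.injective.injOn
  rw [← hcol, ← Matrix.mulVec_injective_iff, b.det_apply, ne_eq,
    ← Matrix.exists_mulVec_eq_zero_iff, ← Matrix.coe_mulVecLin, injective_iff_map_eq_zero]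
  simp only [Matrix.mulVecLin_apply]
  grind

end OrbitDet

theorem mem_range_of_pow_card_eq {k K : Type*} [Field k] [Fintype k] [Field K] (φ : k →+* K)
    {a : K} (ha : a ^ Fintype.card k = a) : a ∈ Set.range φ := by
  have hprod : ∏ c : k, (Polynomial.X - Polynomial.C c) =
      Polynomial.X ^ Fintype.card k - Polynomial.X := by
    have h := Polynomial.prod_multiset_X_sub_C_of_monic_of_roots_card_eq
      (p := (Polynomial.X ^ Fintype.card k - Polynomial.X : Polynomial k))
      (Polynomial.monic_X_pow_sub (by rw [Polynomial.degree_X]; exact_mod_cast Fintype.one_lt_card))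
      (by
        rw [FiniteField.roots_X_pow_card_sub_X,
          FiniteField.X_pow_card_sub_X_natDegree_eq _ Fintype.one_lt_card]
        rfl)
    rwa [FiniteField.roots_X_pow_card_sub_X] at h
  apply_fun Polynomial.eval₂ φ a at hprod
  rw [Polynomial.eval₂_finsetProd] at hprod
  simp only [Polynomial.eval₂_sub, Polynomial.eval₂_X, Polynomial.eval₂_C, Polynomial.eval₂_pow, ha,
    sub_self] at hprod
  obtain ⟨c, -, hc⟩ := Finset.prod_eq_zero_iff.1 hprod
  exact ⟨c, (sub_eq_zero.1 hc).symm⟩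

theorem mem_range_map_of_frobSeries_eq {k K : Type*} [Field k] [Fintype k] [Field K] (φ : k →+* K)
    {f : K⟦X⟧} (hf : frobSeries φ f = f) : f ∈ Set.range (PowerSeries.map φ) := by
  have hcoeff (m : ℕ) : PowerSeries.coeff m f ∈ Set.range φ :=
    mem_range_of_pow_card_eq φ (by rw [← coeff_frobSeries φ, hf])
  choose c hc using hcoeff
  exact ⟨PowerSeries.mk c, by ext m; rw [PowerSeries.coeff_map, PowerSeries.coeff_mk, hc]⟩

/-- If the annihilator of `v` is generated by an idempotent `i` with `i • w ≠ 0`, then `v + i • w`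
has a smaller annihilator. -/
theorem exists_injective_toSpanSingleton {E V : Type*} [CommRing E] [IsSemisimpleRing E]
    [AddCommGroup V] [Module E V] [FaithfulSMul E V] :
    ∃ v : V, Function.Injective (LinearMap.toSpanSingleton E V v) := by
  let A : V → Ideal E := fun v => LinearMap.ker (LinearMap.toSpanSingleton E V v)
  have hA {v : V} {e : E} : e ∈ A v ↔ e • v = 0 := Iff.rfl
  obtain ⟨-, ⟨v, rfl⟩, hmin⟩ := IsArtinian.set_has_minimal (Set.range A) ⟨_, 0, rfl⟩
  refine ⟨v, LinearMap.ker_eq_bot.1 ?_⟩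
  change A v = ⊥
  obtain ⟨i, hi, hspan⟩ := IsSemisimpleRing.ideal_eq_span_idempotent (A v)
  have hiv : i • v = 0 := hA.1 (hspan ▸ Ideal.mem_span_singleton_self i)
  rw [hspan, Ideal.span_singleton_eq_bot]
  refine FaithfulSMul.eq_of_smul_eq_smul (α := V) fun w => ?_
  rw [zero_smul]
  by_contra hw
  have hiw : i • (v + i • w) = i • w := by rw [smul_add, hiv, zero_add, ← mul_smul, hi.eq]
  refine hmin (A (v + i • w)) ⟨_, rfl⟩ (lt_of_le_of_ne (fun x hx => ?_) fun heq => hw ?_)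
  · rw [hA] at hx ⊢
    have hxw : x • i • w = 0 := by rw [← hiw, smul_comm, hx, smul_zero]
    rwa [smul_add, hxw, add_zero] at hx
  · rw [← hiw, ← hA, heq, hspan]
    exact Ideal.mem_span_singleton_self i

section OneTmul

variable {A Q N : Type*} [CommRing A] [CommRing Q] [Algebra A Q] [AddCommGroup N] [Module A N]

theorem one_tmul_injective [Module.Flat A N] (h : Function.Injective (algebraMap A Q)) :
    Function.Injective fun x : N => (1 : Q) ⊗ₜ[A] x := by
  convert (Module.Flat.rTensor_preserves_injective_linearMap (M := N) (Algebra.linearMap A Q)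
    h).comp (TensorProduct.lid A N).symm.injective using 1
  ext x
  simp

theorem one_tmul_smul (s : A) (x : N) :
    (1 : Q) ⊗ₜ[A] (s • x) = algebraMap A Q s • ((1 : Q) ⊗ₜ[A] x) := by
  rw [TensorProduct.tmul_smul, algebraMap_smul]

theorem exists_smul_eq_one_tmul [Nontrivial Q] [IsFractionRing A Q] (x : Q ⊗[A] N) :
    ∃ s : A, algebraMap A Q s ≠ 0 ∧ ∃ t : N, algebraMap A Q s • x = 1 ⊗ₜ t := by
  obtain ⟨⟨t, s⟩, h⟩ :=
    IsLocalizedModule.surj (nonZeroDivisors A) (TensorProduct.mk A Q N 1) x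
  exact ⟨s, (IsLocalization.map_units Q s).ne_zero, t, (algebraMap_smul Q s.1 x).trans h⟩

end OneTmul

namespace LocalShtuka

variable {k : Type*} {R : Type*} [Field k] [Fintype k] [CommRing R] [IsLocalRing R] [Algebra k R]
  {P : CharPoint R} (M : LocalShtuka k P)
  (L : Type*) [Field L] [Algebra R L] [IsFractionRing R L]

theorem tauSep_mk (m : M.carrier) : M.tauSep L (BaseChange.mk _ m) =
    BaseChange.along P.toLoc (locToSep L P) (seriesToSep R L) (locToSep_comp L P)
    (M.τ (BaseChange.mk P.toLoc (BaseChange.mk (sigmaHat k R) m))) :=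
  BaseChange.extend_mk _ _ _

section TateBasis

variable {n : Type*} (b : Module.Basis n R⟦X⟧ M.carrier)

theorem isUnit_toMatrix_tauSep [Fintype n] [DecidableEq n] :
    IsUnit ((BaseChange.basis (seriesToSep R L) b).toMatrix
    fun j => M.tauSep L (BaseChange.basis (seriesToSep R L) b j)).det := by
  let bl := BaseChange.basis P.toLoc b
  let bs := BaseChange.basis P.toLoc (BaseChange.basis (sigmaHat k R) b)
  have h := (bl.isUnit_det (bs.map M.τ)).map (locToSep L P)
  rw [Module.Basis.det_apply, RingHom.map_det] at h
  convert h using 2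
  ext1 i j
  rw [RingHom.mapMatrix_apply, Matrix.map_apply, Module.Basis.toMatrix_apply,
    Module.Basis.toMatrix_apply, BaseChange.basis_apply, tauSep_mk, BaseChange.basis_repr_along,
    Module.Basis.map_apply, BaseChange.basis_apply, BaseChange.basis_apply]

include b in
theorem exists_fixed_basis [Finite n] :
    ∃ u : Module.Basis n (SeparableClosure L)⟦X⟧ (M.sepModule L), ∀ j, M.tauSep L (u j) = u j := by
  classical
  have := Fintype.ofFinite n
  let := (toSep k R L).toAlgebra
  let bs := BaseChange.basis (seriesToSep R L) b
  have hq : (Fintype.card k : SeparableClosure L) = 0 := by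
    rw [← map_natCast (toSep k R L), FiniteField.cast_card_eq_zero, map_zero]
  obtain ⟨U, hU, hlang⟩ := exists_lang_powerSeries_matrix
    (s := (FiniteField.frobeniusAlgHom k _).toRingHom) Fintype.one_lt_card hq (fun _ => rfl)
    (M.isUnit_toMatrix_tauSep L b)
  have hu : IsUnit (bs.det fun j => ∑ i, U i j • bs i) := by
    rw [Module.Basis.det_apply]
    convert hU using 2
    ext1 i j
    rw [Module.Basis.toMatrix_apply, Module.Basis.repr_sum_self]
  obtain ⟨hli, hspan⟩ := (Module.Basis.is_basis_iff_det bs).2 hu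
  refine ⟨Module.Basis.mk hli hspan.ge, fun j => bs.ext_elem fun i => ?_⟩
  rw [Module.Basis.mk_apply, Module.Basis.repr_sum_self, map_sum, map_sum]
  conv_rhs => rw [← hlang]
  simp only [map_smulₛₗ, Finsupp.finsetSum_apply, Finsupp.smul_apply, Matrix.mul_apply,
    Module.Basis.toMatrix_apply, Matrix.map_apply, smul_eq_mul]
  exact Finset.sum_congr rfl fun l _ => mul_comm _ _

theorem sigmaSep_repr_eq_of_tauSep_eq [Finite n]
    {u : Module.Basis n (SeparableClosure L)⟦X⟧ (M.sepModule L)}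
    (hu : ∀ j, M.tauSep L (u j) = u j) {x : M.sepModule L} (hx : M.tauSep L x = x) (i : n) :
    sigmaSep k R L (u.repr x i) = u.repr x i := by
  have := Fintype.ofFinite n
  have hsum : M.tauSep L x = ∑ j, sigmaSep k R L (u.repr x j) • u j := by
    conv_lhs => rw [← u.sum_repr x, map_sum]
    simp only [map_smulₛₗ, hu]
  conv_rhs => rw [← hx, hsum, u.repr_sum_self]

theorem coe_sum_smul_tate [Fintype n] (c : n → k⟦X⟧) (t : n → M.tateModule L) :
    ((∑ j, c j • t j : M.tateModule L) : M.sepModule L) =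
      ∑ j, PowerSeries.map (toSep k R L) (c j) • (t j : M.sepModule L) := by
  rw [AddSubmonoidClass.coe_finsetSum]
  rfl

include b in
theorem exists_tate_basis [Finite n] :
    ∃ (u : Module.Basis n (SeparableClosure L)⟦X⟧ (M.sepModule L))
      (t : Module.Basis n k⟦X⟧ (M.tateModule L)), ∀ j, (t j).1 = u j := by
  have := Fintype.ofFinite n
  obtain ⟨u, hu⟩ := M.exists_fixed_basis L b
  let v : n → M.tateModule L := fun j => ⟨u j, hu j⟩
  have hli : LinearIndependent k⟦X⟧ v := by
    rw [Fintype.linearIndependent_iff]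
    intro c hc j
    have hcu := (M.coe_sum_smul_tate L c v).symm.trans (congrArg Subtype.val hc)
    exact (map_eq_zero_iff _ (PowerSeries.map_injective _ (toSep k R L).injective)).1
      (Fintype.linearIndependent_iff.1 u.linearIndependent _ hcu j)
  have hspan : ⊤ ≤ Submodule.span k⟦X⟧ (Set.range v) := by
    rintro x -
    choose c hc using fun j => mem_range_map_of_frobSeries_eq (toSep k R L)
      (M.sigmaSep_repr_eq_of_tauSep_eq L hu x.2 j)
    refine (Submodule.mem_span_range_iff_exists_fun _).2 ⟨c, Subtype.ext ?_⟩
    rw [coe_sum_smul_tate]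
    simp only [hc]
    exact u.sum_repr x.1
  exact ⟨u, Module.Basis.mk hli hspan, fun j => by rw [Module.Basis.mk_apply]⟩

include b in
theorem linearIndependent_coe_tate [Finite n] {w : n → M.tateModule L}
    (hw : LinearIndependent k⟦X⟧ w) :
    LinearIndependent (SeparableClosure L)⟦X⟧ fun j => (w j : M.sepModule L) := by
  classical
  have := Fintype.ofFinite n
  obtain ⟨u, t, ht⟩ := M.exists_tate_basis L b
  have hrepr (x : M.tateModule L) (i : n) :
      u.repr x.1 i = PowerSeries.map (toSep k R L) (t.repr x i) := by
    conv_lhs => rw [← t.sum_repr x, coe_sum_smul_tate]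
    simp only [ht, u.repr_sum_self]
  have hdet : u.det (fun j => (w j).1) = PowerSeries.map (toSep k R L) (t.det w) := by
    rw [Module.Basis.det_apply, Module.Basis.det_apply, RingHom.map_det]
    congr 1
    ext1 i j
    exact hrepr (w j) i
  rw [← det_ne_zero_iff_linearIndependent u, hdet]
  exact (map_ne_zero_iff _ (PowerSeries.map_injective _ (toSep k R L).injective)).2
    ((det_ne_zero_iff_linearIndependent t).2 hw)

end TateBasis

theorem coe_endTate (f : M.End) (x : M.tateModule L) :
    (M.endTate L f x : M.sepModule L) = BaseChange.map (seriesToSep R L) f.1 x.1 := rfl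

theorem qEndTate_one_tmul (f : M.End) (x : M.tateModule L) :
    M.qEndTate L (1 ⊗ₜ f) (1 ⊗ₜ x) = 1 ⊗ₜ (M.endTate L f x) := by
  rw [qEndTate, tensorLift_tmul, map_one, one_mul]
  rfl

theorem endTate_injective : Function.Injective (M.endTate L) := by
  let b := Module.finBasis R⟦X⟧ M.carrier
  obtain ⟨u, t, ht⟩ := M.exists_tate_basis L b
  rw [injective_iff_map_eq_zero]
  intro f hf
  have hmap : BaseChange.map (seriesToSep R L) f.1 = 0 :=
    u.ext fun j => by rw [← ht, ← coe_endTate, hf]; rfl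
  have hinj := BaseChange.mk_injective (seriesToSep R L) b (PowerSeries.map_injective _
    ((algebraMap L (SeparableClosure L)).injective.comp (IsFractionRing.injective R L)))
  ext m
  apply hinj
  rw [← BaseChange.map_mk, hmap]
  simp

namespace CM

variable {M} {E : Type*} [CommRing E] [Algebra k⸨X⸩ E] (C : M.CM E)

theorem exists_smul_mem_end (e : E) : ∃ s : k⟦X⟧, algebraMap k⟦X⟧ k⸨X⸩ s ≠ 0 ∧ ∃ f : M.End,
    C.ι (algebraMap k⟦X⟧ k⸨X⸩ s • e) = 1 ⊗ₜ f := by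
  obtain ⟨s, hs, f, h⟩ := exists_smul_eq_one_tmul (C.ι e)
  exact ⟨s, hs, f, by rw [map_smul, h]⟩

theorem exists_basis_end [Module.Finite k⸨X⸩ E] :
    ∃ (e : Module.Basis (Fin M.rank) k⸨X⸩ E) (f : Fin M.rank → M.End),
      ∀ j, C.ι (e j) = 1 ⊗ₜ f j := by
  let e := Module.finBasisOfFinrankEq k⸨X⸩ E C.finrank_eq
  choose s hs f hf using fun j => C.exists_smul_mem_end (e j)
  exact ⟨e.isUnitSMul fun j => (hs j).isUnit, f,
    fun j => by rw [Module.Basis.isUnitSMul_apply, hf]⟩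

theorem qEndTate_algebraMap (a : k⸨X⸩) (x : M.rationalTate L) :
    M.qEndTate L (C.ι (algebraMap k⸨X⸩ E a)) x = a • x := by
  have h : C.ι (algebraMap k⸨X⸩ E a) = a ⊗ₜ 1 := C.ι.commutes a
  rw [h, qEndTate, tensorLift_tmul, map_one, mul_one, Module.algebraMap_end_apply]

theorem qEndTate_comp_injective : Function.Injective ((M.qEndTate L).comp C.ι.toRingHom) := by
  obtain ⟨-, t, -⟩ := M.exists_tate_basis L (Module.finBasis R⟦X⟧ M.carrier)
  have : Module.Free k⟦X⟧ (M.tateModule L) := .of_basis t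
  rw [injective_iff_map_eq_zero]
  intro e he
  obtain ⟨s, hs, f, hf⟩ := C.exists_smul_mem_end e
  have hf0 : f = 0 := by
    refine (injective_iff_map_eq_zero _).1 (M.endTate_injective L) f (LinearMap.ext fun x => ?_)
    refine one_tmul_injective (IsFractionRing.injective k⟦X⟧ k⸨X⸩) ?_
    change (1 : k⸨X⸩) ⊗ₜ[k⟦X⟧] M.endTate L f x = 1 ⊗ₜ 0
    rw [← qEndTate_one_tmul, ← hf, TensorProduct.tmul_zero, Algebra.smul_def, map_mul, map_mul]
    exact (congrArg (M.qEndTate L _) (LinearMap.congr_fun he _)).trans (map_zero _)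
  rw [hf0, TensorProduct.tmul_zero] at hf
  exact (smul_eq_zero_iff_right hs).1 (C.injective (hf.trans (map_zero _).symm))

instance : FaithfulSMul E (C.tate L) :=
  ⟨fun h => C.qEndTate_comp_injective L (LinearMap.ext h)⟩

variable [IsSemisimpleRing E]

theorem exists_qEndTate_apply_injective :
    ∃ v : M.rationalTate L, Function.Injective fun e : E => M.qEndTate L (C.ι e) v :=
  exists_injective_toSpanSingleton (E := E) (V := C.tate L)

theorem tate_equiv [Module.Finite k⸨X⸩ E] : Nonempty (C.tate L ≃ₗ[E] E) := by
  obtain ⟨v, hv⟩ := C.exists_qEndTate_apply_injective L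
  let g : E →ₗ[k⸨X⸩] M.rationalTate L :=
    { toFun := fun e => M.qEndTate L (C.ι e) v
      map_add' := fun x y => by rw [map_add, map_add, LinearMap.add_apply]
      map_smul' := fun a x => by
        rw [Algebra.smul_def, map_mul, map_mul, Module.End.mul_apply, qEndTate_algebraMap]
        rfl }
  obtain ⟨-, t, -⟩ := M.exists_tate_basis L (Module.finBasis R⟦X⟧ M.carrier)
  have : Module.Finite k⸨X⸩ (M.rationalTate L) := Module.Finite.of_basis (t.baseChange k⸨X⸩)
  have hrank : Module.finrank k⸨X⸩ E = Module.finrank k⸨X⸩ (M.rationalTate L) := by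
    rw [C.finrank_eq, Module.finrank_eq_card_basis (t.baseChange k⸨X⸩), Fintype.card_fin]
    rfl
  have hsurj : Function.Surjective g :=
    (LinearMap.injective_iff_surjective_of_finrank_eq_finrank hrank).1 hv
  exact ⟨(LinearEquiv.ofBijective (LinearMap.toSpanSingleton E (C.tate L) v) ⟨hv, hsurj⟩).symm⟩

theorem exists_linearIndependent_endTate {n : Type*} [Finite n] (e : Module.Basis n k⸨X⸩ E)
    (f : n → M.End) (hf : ∀ j, C.ι (e j) = 1 ⊗ₜ f j) :
    ∃ x : M.tateModule L, LinearIndependent k⟦X⟧ fun j => M.endTate L (f j) x := by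
  have := Fintype.ofFinite n
  obtain ⟨v, hv⟩ := C.exists_qEndTate_apply_injective L
  obtain ⟨s, hs, x, hsv⟩ := exists_smul_eq_one_tmul v
  refine ⟨x, Fintype.linearIndependent_iff.2 fun c hc j => ?_⟩
  have hx : M.qEndTate L (C.ι (∑ j, algebraMap k⟦X⟧ k⸨X⸩ (c j) • e j)) (1 ⊗ₜ x) =
      (1 : k⸨X⸩) ⊗ₜ[k⟦X⟧] (∑ j, c j • M.endTate L (f j) x) := by
    rw [map_sum, map_sum, LinearMap.sum_apply, TensorProduct.tmul_sum]
    refine Finset.sum_congr rfl fun j _ => ?_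
    rw [Algebra.smul_def, map_mul, map_mul, Module.End.mul_apply, hf, qEndTate_one_tmul,
      qEndTate_algebraMap, one_tmul_smul]
  rw [hc, TensorProduct.tmul_zero, ← hsv, map_smul] at hx
  have hzero : ∑ j, algebraMap k⟦X⟧ k⸨X⸩ (c j) • e j = 0 := by
    refine hv ((hs.isUnit.smul_eq_zero.1 hx).trans ?_)
    simp only [map_zero, LinearMap.zero_apply]
  exact (map_eq_zero_iff _ (IsFractionRing.injective k⟦X⟧ k⸨X⸩)).1
    (Fintype.linearIndependent_iff.1 e.linearIndependent _ hzero j)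

theorem orbitDet_end_ne_zero [IsDomain R] {n : Type*} [Fintype n] [DecidableEq n]
    (b : Module.Basis n R⟦X⟧ M.carrier) (e : Module.Basis n k⸨X⸩ E) (f : n → M.End)
    (hf : ∀ j, C.ι (e j) = 1 ⊗ₜ f j) : orbitDet b (fun j => (f j).1) ≠ 0 := by
  let L := FractionRing R
  obtain ⟨x, hx⟩ := C.exists_linearIndependent_endTate L e f hf
  have hdet := orbitDet_ne_zero ((det_ne_zero_iff_linearIndependent
    (BaseChange.basis (seriesToSep R L) b)).2 (M.linearIndependent_coe_tate L b hx))
  rw [← map_orbitDet] at hdet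
  exact fun h0 => hdet (by rw [h0, map_zero])

end CM

end LocalShtuka

section PRankOne

open Module

variable {F : Type*} [Field F] {p : ℕ} [hp : Fact p.Prime] [CharP F p]

variable (F p) in
/-- The field `F` of characteristic `p` has `p`-rank one: `[F : F ^ p] = p`, so that every element
which is not a `p`-th power is a `p`-basis. -/
def HasPRankOne : Prop := finrank (frobenius F p).fieldRange F = p

theorem finrank_adjoin_of_forall_pow_ne {y : F} (hy : ∀ w, w ^ p ≠ y) :
    finrank (frobenius F p).fieldRange (IntermediateField.adjoin (frobenius F p).fieldRange {y}) =
      p := by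
  let a : (frobenius F p).fieldRange := ⟨y ^ p, y, rfl⟩
  have hirr : Irreducible (Polynomial.X ^ p - Polynomial.C a) := by
    refine X_pow_sub_C_irreducible_of_prime hp.out ?_
    rintro ⟨-, b, rfl⟩ hb
    exact hy b (frobenius_inj F p (congrArg Subtype.val hb))
  have hroot : Polynomial.aeval y (Polynomial.X ^ p - Polynomial.C a) = 0 := by
    simp only [map_sub, map_pow, Polynomial.aeval_X, Polynomial.aeval_C]
    exact sub_self _
  have hmonic := Polynomial.monic_X_pow_sub_C a hp.out.ne_zero
  rw [IntermediateField.adjoin.finrank ⟨_, hmonic, hroot⟩,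
    ← minpoly.eq_of_irreducible_of_monic hirr hroot hmonic, Polynomial.natDegree_X_pow_sub_C]

theorem hasPRankOne_of_forall_subfield {y : F} (hy : ∀ w, w ^ p ≠ y)
    (h : ∀ S : Subfield F, (∀ x, x ^ p ∈ S) → y ∈ S → S = ⊤) : HasPRankOne F p := by
  have htop : IntermediateField.adjoin (frobenius F p).fieldRange {y} = ⊤ :=
    IntermediateField.toSubfield_injective <| h _
      (fun x => IntermediateField.algebraMap_mem _
        (⟨x ^ p, x, rfl⟩ : (frobenius F p).fieldRange))
      (IntermediateField.mem_adjoin_simple_self _ y)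
  rw [HasPRankOne, ← IntermediateField.finrank_top', ← htop]
  exact finrank_adjoin_of_forall_pow_ne hy

theorem finrank_frobenius_fieldRange_eq (Q : Type*) [Field Q] [CharP Q p] [Algebra Q F]
    [FiniteDimensional Q F] :
    finrank (frobenius F p).fieldRange F = finrank (frobenius Q p).fieldRange Q := by
  let B := (algebraMap Q F).fieldRange
  have hB : B.map (frobenius F p) = (frobenius Q p).fieldRange.map (algebraMap Q F) := by
    simp only [B, RingHom.fieldRange_eq_map, Subfield.map_map, RingHom.frobenius_comm]
  have hBB : B.map (frobenius F p) ≤ B := by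
    rw [hB]
    rintro _ ⟨x, -, rfl⟩
    exact ⟨x, rfl⟩
  have hFrob : Subfield.relfinrank (B.map (frobenius F p)) (frobenius F p).fieldRange =
      Subfield.relfinrank B ⊤ := by
    rw [RingHom.fieldRange_eq_map, Subfield.relfinrank_map_map]
  have hbase : Subfield.relfinrank (B.map (frobenius F p)) B =
      finrank (frobenius Q p).fieldRange Q := by
    rw [hB, ← Subfield.relfinrank_top_right, ← Subfield.relfinrank_map_map _ _ (algebraMap Q F),
      ← RingHom.fieldRange_eq_map]
  have hpos : 0 < Subfield.relfinrank B ⊤ := by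
    rw [Subfield.relfinrank_top_right, ← Algebra.finrank_eq_of_equiv_equiv
      (algebraMap Q F).rangeRestrictFieldEquiv (RingEquiv.refl F) (RingHom.ext fun _ => rfl)]
    exact finrank_pos
  refine Nat.eq_of_mul_eq_mul_left hpos ?_
  calc Subfield.relfinrank B ⊤ * finrank (frobenius F p).fieldRange F
      = finrank (B.map (frobenius F p)) F := by
        rw [← hFrob]
        exact Subfield.relfinrank_mul_finrank_top fun _ ⟨x, _, hx⟩ => ⟨x, hx⟩
    _ = Subfield.relfinrank B ⊤ * finrank (frobenius Q p).fieldRange Q := by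
        rw [← Subfield.relfinrank_mul_finrank_top hBB, hbase, Subfield.relfinrank_top_right,
          mul_comm]

namespace HasPRankOne

theorem of_finite {Q : Type*} [Field Q] [CharP Q p] [Algebra Q F] [FiniteDimensional Q F]
    (h : HasPRankOne Q p) : HasPRankOne F p :=
  (finrank_frobenius_fieldRange_eq Q).trans h

variable (h : HasPRankOne F p)
include h

theorem exists_pow_ne : ∃ y : F, ∀ w, w ^ p ≠ y := by
  by_contra! hn
  have htop : (frobenius F p).fieldRange = ⊤ := eq_top_iff.2 fun x _ => hn x
  rw [HasPRankOne, ← Subfield.relfinrank_top_right, htop, Subfield.relfinrank_self] at h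
  exact hp.out.one_lt.ne h

theorem subfield_eq_top_of_pow_mem {y : F} (hy : ∀ w, w ^ p ≠ y) {S : Subfield F}
    (hS : ∀ x, x ^ p ∈ S) (hyS : y ∈ S) : S = ⊤ := by
  have hle : (frobenius F p).fieldRange ≤ S := by
    rintro _ ⟨x, rfl⟩
    exact hS x
  have : FiniteDimensional (frobenius F p).fieldRange F :=
    .of_finrank_pos (hp.out.pos.trans_eq h.symm)
  have htop : IntermediateField.adjoin (frobenius F p).fieldRange {y} = ⊤ := by
    rw [← IntermediateField.toSubalgebra_inj, IntermediateField.top_toSubalgebra,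
      ← Algebra.toSubmodule_eq_top]
    exact Submodule.eq_top_of_finrank_eq ((finrank_adjoin_of_forall_pow_ne hy).trans h.symm)
  have hadjoin : IntermediateField.adjoin (frobenius F p).fieldRange {y} ≤
      Subfield.extendScalars hle :=
    IntermediateField.adjoin_le_iff.2 (Set.singleton_subset_iff.2 hyS)
  rw [htop] at hadjoin
  exact eq_top_iff.2 fun x _ => hadjoin (IntermediateField.mem_top (x := x))

theorem subfield_eq_top {y : F} (hy : ∀ w, w ^ p ≠ y) (n : ℕ) {S : Subfield F}
    (hS : ∀ x, x ^ p ^ n ∈ S) (hyS : y ∈ S) : S = ⊤ := by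
  induction n with
  | zero => exact eq_top_iff.2 fun x _ => by simpa using hS x
  | succ n ih =>
    have hcomap : S.comap (iterateFrobenius F p n) = ⊤ := by
      refine h.subfield_eq_top_of_pow_mem hy (fun x => ?_) (S.pow_mem hyS _)
      rw [Subfield.mem_comap, iterateFrobenius_def, ← pow_mul, ← pow_succ']
      exact hS x
    exact ih fun x => (hcomap ▸ Subfield.mem_top x : x ∈ S.comap (iterateFrobenius F p n))

theorem finrank_iterateFrobenius (n : ℕ) :
    finrank (iterateFrobenius F p n).fieldRange F = p ^ n := by
  induction n with
  | zero =>
    have htop : (iterateFrobenius F p 0).fieldRange = ⊤ :=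
      eq_top_iff.2 fun x _ => ⟨x, iterateFrobenius_zero_apply ..⟩
    rw [htop, ← Subfield.relfinrank_top_right, Subfield.relfinrank_self, pow_zero]
  | succ n ih =>
    have hmap : (iterateFrobenius F p (n + 1)).fieldRange =
        (frobenius F p).fieldRange.map (iterateFrobenius F p n) := by
      simp only [RingHom.fieldRange_eq_map, Subfield.map_map, iterateFrobenius_add,
        iterateFrobenius_one]
    have hle : (iterateFrobenius F p (n + 1)).fieldRange ≤ (iterateFrobenius F p n).fieldRange := by
      rw [hmap]
      rintro _ ⟨x, -, rfl⟩
      exact ⟨x, rfl⟩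
    have hstep : Subfield.relfinrank (iterateFrobenius F p (n + 1)).fieldRange
        (iterateFrobenius F p n).fieldRange = p := by
      rw [hmap, RingHom.fieldRange_eq_map (iterateFrobenius F p n), Subfield.relfinrank_map_map,
        Subfield.relfinrank_top_right]
      exact h
    rw [← Subfield.relfinrank_mul_finrank_top hle, ih, hstep, pow_succ']

theorem finite_iterateFrobenius (n : ℕ) :
    FiniteDimensional (iterateFrobenius F p n).fieldRange F :=
  .of_finrank_pos (by rw [h.finrank_iterateFrobenius]; exact pow_pos hp.out.pos n)

theorem adjoin_eq_top {y : F} (hy : ∀ w, w ^ p ≠ y) (n : ℕ) :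
    IntermediateField.adjoin (iterateFrobenius F p n).fieldRange {y} = ⊤ :=
  IntermediateField.toSubfield_injective <| h.subfield_eq_top hy n
    (fun x => IntermediateField.algebraMap_mem _
      (⟨x ^ p ^ n, x, rfl⟩ : (iterateFrobenius F p n).fieldRange))
    (IntermediateField.mem_adjoin_simple_self _ y)

theorem minpoly_eq {y : F} (hy : ∀ w, w ^ p ≠ y) (n : ℕ) :
    minpoly (iterateFrobenius F p n).fieldRange y =
      Polynomial.X ^ p ^ n - Polynomial.C ⟨y ^ p ^ n, y, rfl⟩ := by
  have := h.finite_iterateFrobenius n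
  have hint : IsIntegral (iterateFrobenius F p n).fieldRange y := Algebra.IsIntegral.isIntegral y
  have hmonic := Polynomial.monic_X_pow_sub_C
    (⟨y ^ p ^ n, y, rfl⟩ : (iterateFrobenius F p n).fieldRange) (pow_ne_zero n hp.out.ne_zero)
  refine (Polynomial.eq_of_monic_of_dvd_of_natDegree_le (minpoly.monic hint) hmonic
    (minpoly.dvd _ _ ?_) ?_).symm
  · simp only [map_sub, map_pow, Polynomial.aeval_X, Polynomial.aeval_C]
    exact sub_self (y ^ p ^ n)
  · rw [Polynomial.natDegree_X_pow_sub_C, ← IntermediateField.adjoin.finrank hint,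
      h.adjoin_eq_top hy, IntermediateField.finrank_top', h.finrank_iterateFrobenius]

end HasPRankOne

theorem iterateFrobenius_fieldRange_le_separableClosure {Q : Type*} [Field Q]
    [Algebra Q F] [FiniteDimensional Q F] {m : ℕ} (hm : Field.finInsepDegree Q F = p ^ m) :
    (iterateFrobenius F p m).fieldRange ≤ (separableClosure Q F).toSubfield := by
  let S := separableClosure Q F
  have : ExpChar S p := .prime hp.out
  rintro _ ⟨x, rfl⟩
  have hle : IsPurelyInseparable.elemExponent S x ≤ m := by
    rw [← Nat.pow_le_pow_iff_right hp.out.one_lt, ← hm,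
      ← IsPurelyInseparable.minpoly_natDegree_eq' S p x]
    exact minpoly.natDegree_le x
  rw [iterateFrobenius_def, ← Nat.add_sub_of_le hle, pow_add, pow_mul,
    ← IsPurelyInseparable.algebraMap_elemReduct_eq' S p x]
  exact S.toSubfield.pow_mem (Subtype.property _) _

theorem HasPRankOne.exists_pow_finInsepDegree {Q : Type*} [Field Q] [CharP Q p] [Algebra Q F]
    [FiniteDimensional Q F] (h : HasPRankOne Q p) (z : Q) :
    ∃ w : F, w ^ Field.finInsepDegree Q F = algebraMap Q F z := by
  have : ExpChar Q p := .prime hp.out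
  obtain ⟨m, hm⟩ := finInsepDegree_eq_pow (F := Q) (E := F) p
  let S := separableClosure Q F
  have hrank := Subfield.relfinrank_mul_finrank_top
    (iterateFrobenius_fieldRange_le_separableClosure (F := F) hm)
  have hS : finrank S.toSubfield F = p ^ m := hm
  rw [(h.of_finite (F := F)).finrank_iterateFrobenius, hS] at hrank
  have hone := Nat.eq_of_mul_eq_mul_right (pow_pos hp.out.pos m) (hrank.trans (one_mul _).symm)
  obtain ⟨w, hw⟩ := Subfield.relfinrank_eq_one_iff.1 hone (S.algebraMap_mem z)
  exact ⟨w, by rw [hm]; exact hw⟩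

end PRankOne

section Expansion

open PowerSeries

variable {F : Type*} [Field F] {p : ℕ} [hp : Fact p.Prime] [CharP F p]

namespace HasPRankOne

variable (h : HasPRankOne F p)
include h

theorem ringHom_ext_of_pow_eq {y : F} (hy : ∀ w, w ^ p ≠ y) {B : Type*} [Semiring B] (n : ℕ)
    {θ θ' : F →+* B} (hpow : ∀ x, θ x ^ p ^ n = θ' x ^ p ^ n) (hyy : θ y = θ' y) :
    θ = θ' := by
  have htop : θ.eqLocusField θ' = ⊤ := by
    refine h.subfield_eq_top hy n (fun x => ?_) hyy
    change θ (x ^ p ^ n) = θ' (x ^ p ^ n)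
    rw [map_pow, map_pow, hpow]
  exact RingHom.ext fun x => (htop ▸ Subfield.mem_top x : x ∈ θ.eqLocusField θ')

theorem exists_lift {y : F} (hy : ∀ w, w ^ p ≠ y) (n : ℕ) {B : Type*} [CommRing B] (g : F →+* B)
    {y' : B} (hy' : y' ^ p ^ n = g y ^ p ^ n) :
    ∃ θ : F →+* B, θ y = y' ∧ ∀ x, θ x ^ p ^ n = g x ^ p ^ n := by
  let A := (iterateFrobenius F p n).fieldRange
  let : Algebra A B := (g.comp A.subtype).toAlgebra
  have hA (x : F) : algebraMap A B ⟨x ^ p ^ n, x, rfl⟩ = g x ^ p ^ n := map_pow g x _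
  have := h.finite_iterateFrobenius n
  let pb := IntermediateField.adjoin.powerBasis (Algebra.IsIntegral.isIntegral (R := A) y)
  have hgen : pb.gen = IntermediateField.AdjoinSimple.gen A y := rfl
  have hroot : Polynomial.aeval y' (minpoly A pb.gen) = 0 := by
    rw [hgen, IntermediateField.minpoly_gen, h.minpoly_eq hy, map_sub, map_pow,
      Polynomial.aeval_X, Polynomial.aeval_C, hy', hA, sub_self]
  let e := (IntermediateField.equivOfEq (h.adjoin_eq_top hy n)).trans IntermediateField.topEquiv
  have he : e.symm y = pb.gen := by
    rw [AlgEquiv.symm_apply_eq, hgen]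
    rfl
  let θ : F →ₐ[A] B := (pb.lift y' hroot).comp e.symm.toAlgHom
  refine ⟨θ, ?_, fun x => ?_⟩
  · change pb.lift y' hroot (e.symm y) = y'
    rw [he, PowerBasis.lift_gen]
  · rw [← map_pow, ← hA]
    exact θ.commutes ⟨x ^ p ^ n, x, rfl⟩

end HasPRankOne

variable {Λ : Type*} [Field Λ] [CharP Λ p]

omit hp in
theorem charP_powerSeries : CharP Λ⟦X⟧ p := charP_of_injective_ringHom C_injective p

theorem X_pow_dvd_pow_sub_pow_iff {f g : Λ⟦X⟧} (n : ℕ) :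
    (X : Λ⟦X⟧) ^ p ^ n ∣ f ^ p ^ n - g ^ p ^ n ↔ constantCoeff f = constantCoeff g := by
  have : CharP Λ⟦X⟧ p := charP_powerSeries
  rw [← sub_pow_char_pow, UniqueFactorizationMonoid.pow_dvd_pow_iff_dvd
    (pow_ne_zero n hp.out.ne_zero), X_dvd_iff, map_sub, sub_eq_zero]

theorem mk_pow_eq_mk_pow_iff {f g : Λ⟦X⟧} (n : ℕ) :
    Ideal.Quotient.mk (Ideal.span {(X : Λ⟦X⟧)} ^ p ^ n) f ^ p ^ n = Ideal.Quotient.mk _ g ^ p ^ n ↔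
      constantCoeff f = constantCoeff g := by
  rw [← map_pow, ← map_pow, Ideal.Quotient.eq, Ideal.span_singleton_pow,
    Ideal.mem_span_singleton, X_pow_dvd_pow_sub_pow_iff]

omit [CharP Λ p] in
theorem eq_of_forall_mk_eq {f g : Λ⟦X⟧}
    (h : ∀ n, Ideal.Quotient.mk (Ideal.span {(X : Λ⟦X⟧)} ^ p ^ n) f = Ideal.Quotient.mk _ g) :
    f = g := by
  ext m
  have hm := h m
  rw [Ideal.Quotient.eq, Ideal.span_singleton_pow, Ideal.mem_span_singleton] at hm
  rw [← sub_eq_zero, ← map_sub]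
  exact X_pow_dvd_iff.1 hm m (Nat.lt_pow_self hp.out.one_lt)

namespace HasPRankOne

variable (h : HasPRankOne F p)
include h

theorem ringHom_ext {y : F} (hy : ∀ w, w ^ p ≠ y) {θ θ' : F →+* Λ⟦X⟧}
    (hc : ∀ x, constantCoeff (θ x) = constantCoeff (θ' x)) (hyy : θ y = θ' y) : θ = θ' := by
  refine RingHom.ext fun x => eq_of_forall_mk_eq (p := p) fun n => ?_
  let π := Ideal.Quotient.mk (Ideal.span {(X : Λ⟦X⟧)} ^ p ^ n)
  have hπ : π.comp θ = π.comp θ' :=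
    h.ringHom_ext_of_pow_eq hy n (fun x => (mk_pow_eq_mk_pow_iff n).2 (hc x)) (congrArg π hyy)
  exact RingHom.congr_fun hπ x

/-- The homomorphism is the limit of the unique lifts of `ψ` to `Λ⟦X⟧ ⧸ (X ^ p ^ n)` sending `y` to
`ψ y + X`. -/
theorem exists_expansion {y : F} (hy : ∀ w, w ^ p ≠ y) (ψ : F →+* Λ) :
    ∃ θ : F →+* Λ⟦X⟧, (∀ x, constantCoeff (θ x) = ψ x) ∧ θ y = C (ψ y) + X := by
  let I : Ideal Λ⟦X⟧ := Ideal.span {X}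
  have hlift (n : ℕ) : ∃ θ : F →+* Λ⟦X⟧ ⧸ I ^ p ^ n, θ y = Ideal.Quotient.mk _ (C (ψ y) + X) ∧
      ∀ x, θ x ^ p ^ n = Ideal.Quotient.mk _ (C (ψ x)) ^ p ^ n :=
    h.exists_lift hy n ((Ideal.Quotient.mk _).comp (C.comp ψ))
      ((mk_pow_eq_mk_pow_iff n).2 (by simp))
  choose θ hθy hθ using hlift
  have hconst {n : ℕ} {x : F} {f : Λ⟦X⟧} (hf : Ideal.Quotient.mk _ f = θ n x) :
      constantCoeff f = ψ x := by
    rw [← constantCoeff_C (ψ x), ← mk_pow_eq_mk_pow_iff (p := p) n, ← hθ, ← hf]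
  have hmono : StrictMono fun n => p ^ n := pow_right_strictMono₀ hp.out.one_lt
  have hcompat {m : ℕ} :
      (Ideal.Quotient.factorPow I (hmono.monotone m.le_succ)).comp (θ (m + 1)) = θ m := by
    refine h.ringHom_ext_of_pow_eq hy m (fun x => ?_) ?_
    · obtain ⟨f, hf⟩ := Ideal.Quotient.mk_surjective (θ (m + 1) x)
      rw [RingHom.comp_apply, ← hf, hθ]
      exact (mk_pow_eq_mk_pow_iff m).2 ((hconst hf).trans (constantCoeff_C _).symm)
    · rw [RingHom.comp_apply, hθy, hθy]
      rfl
  let Θ : F →+* Λ⟦X⟧ := IsAdicComplete.StrictMono.liftRingHom I hmono θ hcompat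
  have hΘ (n : ℕ) (x : F) : Ideal.Quotient.mk (I ^ p ^ n) (Θ x) = θ n x :=
    IsAdicComplete.StrictMono.mk_liftRingHom I hmono θ hcompat x
  exact ⟨Θ, fun x => hconst (hΘ 0 x),
    eq_of_forall_mk_eq (p := p) fun n => (hΘ n y).trans (hθy n)⟩

end HasPRankOne

end Expansion

section Laurent

open PowerSeries

variable {p : ℕ} [hp : Fact p.Prime]

theorem coeff_pow_char {R : Type*} [CommRing R] [CharP R p] (g : R⟦X⟧) (m : ℕ) :
    coeff m (g ^ p) = if p ∣ m then coeff (m / p) g ^ p else 0 := by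
  have : ExpChar R p := .prime hp.out
  have hg : map (frobenius R p) (expand p hp.out.ne_zero g) = g ^ p :=
    MvPowerSeries.map_frobenius_expand p hp.out.ne_zero
  rw [← hg, coeff_map, coeff_expand]
  split_ifs <;> simp [frobenius_def, hp.out.ne_zero]

theorem exists_eq_sum_X_pow_mul_pow {k : Type*} [Field k] [PerfectField k] [CharP k p] (f : k⟦X⟧) :
    ∃ g : ℕ → k⟦X⟧, f = ∑ i ∈ Finset.range p, X ^ i * g i ^ p := by
  have : ExpChar k p := .prime hp.out
  have : PerfectRing k p := PerfectField.toPerfectRing p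
  choose r hr using surjective_frobenius k p
  refine ⟨fun i => mk fun m => r (coeff (p * m + i) f), PowerSeries.ext fun m => ?_⟩
  simp only [frobenius_def] at hr
  simp only [map_sum, coeff_X_pow_mul', coeff_pow_char, coeff_mk, hr]
  rw [Finset.sum_eq_single (m % p)]
  · have hdvd : p ∣ m - m % p := Nat.dvd_sub_mod m
    have hle : m % p ≤ m := Nat.mod_le m p
    rw [if_pos hle, if_pos hdvd, Nat.mul_div_cancel' hdvd, Nat.sub_add_cancel hle]
  · intro i hi hne
    split_ifs with hle hdvd
    · have hmod : i ≡ m [MOD p] := (Nat.modEq_iff_dvd' hle).2 hdvd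
      exact absurd ((Nat.mod_eq_of_lt (Finset.mem_range.1 hi)).symm.trans hmod) hne
    all_goals rfl
  · exact fun hm => absurd (Finset.mem_range.2 (Nat.mod_lt m hp.out.pos)) hm

theorem pow_ne_laurentSeries_X {k : Type*} [Field k] (w : k⸨X⸩) :
    w ^ p ≠ algebraMap k⟦X⟧ k⸨X⸩ X := by
  intro hw
  have hX : algebraMap k⟦X⟧ k⸨X⸩ X = HahnSeries.single 1 1 := HahnSeries.ofPowerSeries_X
  have horder := congrArg HahnSeries.order hw
  rw [HahnSeries.order_pow, hX, HahnSeries.order_single one_ne_zero, nsmul_eq_mul] at horder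
  exact hp.out.one_lt.ne' (Nat.dvd_one.1 (Int.natCast_dvd_natCast.1 ⟨_, horder.symm⟩))

theorem hasPRankOne_laurentSeries (k : Type*) [Field k] [PerfectField k] [CharP k⸨X⸩ p] :
    HasPRankOne k⸨X⸩ p := by
  have : CharP k p := (algebraMap k k⸨X⸩).charP (algebraMap k k⸨X⸩).injective p
  refine hasPRankOne_of_forall_subfield pow_ne_laurentSeries_X fun S hS hX => ?_
  have hint (f : k⟦X⟧) : algebraMap k⟦X⟧ k⸨X⸩ f ∈ S := by
    obtain ⟨g, hg⟩ := exists_eq_sum_X_pow_mul_pow (p := p) f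
    rw [hg, map_sum]
    refine S.sum_mem fun i _ => ?_
    rw [map_mul, map_pow, map_pow]
    exact S.mul_mem (S.pow_mem hX i) (hS _)
  refine eq_top_iff.2 fun x _ => ?_
  obtain ⟨a, b, -, rfl⟩ := IsFractionRing.div_surjective (A := k⟦X⟧) x
  exact S.div_mem (hint a) (hint b)

end Laurent

namespace LocalShtuka

section EmbeddingCount

variable {k : Type*} [Field k] {Λ : Type*} [Field Λ]
  {E : Type*} [CommRing E] [Algebra k⸨X⸩ E] {g : k⸨X⸩ →+* Λ}

theorem Emb.isMaximal_ker [Module.Finite k⸨X⸩ E] (ψ : Emb k E g) : (RingHom.ker ψ.1).IsMaximal := by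
  have : IsArtinianRing E := IsArtinianRing.of_finite k⸨X⸩ E
  have : (RingHom.ker ψ.1).IsPrime := RingHom.ker_isPrime ψ.1
  exact IsArtinianRing.isMaximal_of_isPrime _

/-- The factor of the semisimple ring `E` cut out by an embedding, as a point of the spectrum. -/
def Emb.factor [Module.Finite k⸨X⸩ E] (ψ : Emb k E g) : MaximalSpectrum E :=
  ⟨RingHom.ker ψ.1, ψ.isMaximal_ker⟩

/-- The inseparability degree over `k⸨X⸩` of the residue field of `E` at `m`, which is the factor
field `E_{v,i}` of `E_v`. -/
noncomputable def residueInsepDegree (m : MaximalSpectrum E) : ℕ :=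
  letI : Field (E ⧸ m.asIdeal) := Ideal.Quotient.field _
  Field.finInsepDegree k⸨X⸩ (E ⧸ m.asIdeal)

theorem CM.insepDegree_eq [Module.Finite k⸨X⸩ E] (ψ : Emb k E g) :
    CM.insepDegree ψ = residueInsepDegree (k := k) ψ.factor := rfl

instance Emb.finite [Module.Finite k⸨X⸩ E] : Finite (Emb k E g) := by
  let := g.toAlgebra
  let toAlgHom (ψ : Emb k E g) : E →ₐ[k⸨X⸩] Λ :=
    { ψ.1 with commutes' := fun a => RingHom.congr_fun ψ.2 a }
  exact Finite.of_injective toAlgHom fun ψ ψ' h =>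
    Subtype.ext (RingHom.ext fun e => DFunLike.congr_fun h e)

/-- The embedding of `E` into an extension field of `Λ` induced by an embedding into `Λ`. -/
def Emb.extend {Ω : Type*} [Field Ω] (ι : Λ →+* Ω) (ψ : Emb k E g) : Emb k E (ι.comp g) :=
  ⟨ι.comp ψ.1, by rw [RingHom.comp_assoc, ψ.2]⟩

theorem Emb.bijective_extend {Ω : Type*} [Field Ω] (ι : Λ →+* Ω)
    (hemb : ∀ (ψ : Emb k E (ι.comp g)) (a : E), ψ.1 a ∈ ι.range) :
    Function.Bijective (Emb.extend ι : Emb k E g → Emb k E (ι.comp g)) := by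
  refine ⟨fun ψ ψ' h => Subtype.ext (RingHom.ext fun e => ι.injective ?_), fun φ => ?_⟩
  · exact RingHom.congr_fun (congrArg Subtype.val h) e
  · let ψ : E →+* Λ := (ι.rangeRestrictFieldEquiv.symm : ι.fieldRange →+* Λ).comp
      (φ.1.codRestrict ι.fieldRange (hemb φ))
    have hψ : ι.comp ψ = φ.1 := RingHom.ext fun e =>
      ι.rangeRestrictFieldEquiv_apply_symm_apply _
    refine ⟨⟨ψ, RingHom.ext fun a => ι.injective ?_⟩, Subtype.ext hψ⟩
    exact (RingHom.congr_fun hψ _).trans (RingHom.congr_fun φ.2 a)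

theorem Emb.factor_extend [Module.Finite k⸨X⸩ E] {Ω : Type*} [Field Ω] (ι : Λ →+* Ω)
    (ψ : Emb k E g) : (ψ.extend ι).factor = ψ.factor :=
  MaximalSpectrum.ext (RingHom.ker_comp_of_injective ψ.1 ι.injective)

theorem card_factor_mul_residueInsepDegree [Module.Finite k⸨X⸩ E] [IsAlgClosed Λ]
    (m : MaximalSpectrum E) :
    Nat.card {ψ : Emb k E g // ψ.factor = m} * residueInsepDegree (k := k) m =
      Module.finrank k⸨X⸩ (E ⧸ m.asIdeal) := by
  let : Field (E ⧸ m.asIdeal) := Ideal.Quotient.field _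
  let := g.toAlgebra
  let toEmb (φ : (E ⧸ m.asIdeal) →ₐ[k⸨X⸩] Λ) : {ψ : Emb k E g // ψ.factor = m} :=
    ⟨⟨φ.toRingHom.comp (Ideal.Quotient.mk _), RingHom.ext fun a => φ.commutes a⟩,
      MaximalSpectrum.ext <| (RingHom.ker_comp_of_injective _ φ.toRingHom.injective).trans
        (Ideal.mk_ker (I := m.asIdeal))⟩
  have hbij : Function.Bijective toEmb := by
    refine ⟨fun φ φ' h => AlgHom.ext fun x => ?_, fun ψ => ?_⟩
    · obtain ⟨e, rfl⟩ := Ideal.Quotient.mk_surjective x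
      exact RingHom.congr_fun (congrArg (fun ψ => ψ.1.1) h) e
    · obtain ⟨ψ, rfl⟩ := ψ
      exact ⟨{ RingHom.kerLift ψ.1 with commutes' := fun a => RingHom.congr_fun ψ.2 a }, rfl⟩
  rw [← Nat.card_congr (Equiv.ofBijective toEmb hbij), ← Field.finSepDegree_eq_of_isAlgClosed]
  exact Field.finSepDegree_mul_finInsepDegree k⸨X⸩ (E ⧸ m.asIdeal)

theorem sum_insepDegree_of_isAlgClosed [Module.Finite k⸨X⸩ E] [IsSemisimpleRing E] [IsAlgClosed Λ]
    [Fintype (Emb k E g)] : ∑ ψ : Emb k E g, CM.insepDegree ψ = Module.finrank k⸨X⸩ E := by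
  classical
  have : IsArtinianRing E := IsArtinianRing.of_finite k⸨X⸩ E
  have : Fintype (MaximalSpectrum E) := Fintype.ofFinite _
  have e : E ≃ₗ[k⸨X⸩] (∀ m : MaximalSpectrum E, E ⧸ m.asIdeal) :=
    (IsArtinianRing.equivPi E).toLinearEquiv.restrictScalars k⸨X⸩
  rw [e.finrank_eq, Module.finrank_pi_fintype, ← Finset.sum_fiberwise (g := Emb.factor)]
  refine Finset.sum_congr rfl fun m _ => ?_
  calc ∑ ψ with ψ.factor = m, CM.insepDegree ψ
      = ∑ ψ : Emb k E g with ψ.factor = m, residueInsepDegree (k := k) m :=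
        Finset.sum_congr rfl fun ψ hψ => by rw [CM.insepDegree_eq, (Finset.mem_filter.1 hψ).2]
    _ = Module.finrank k⸨X⸩ (E ⧸ m.asIdeal) := by
        rw [Finset.sum_const, smul_eq_mul, ← Fintype.card_subtype, ← Nat.card_eq_fintype_card,
          card_factor_mul_residueInsepDegree]

theorem sum_insepDegree [Module.Finite k⸨X⸩ E] [IsSemisimpleRing E] [Fintype (Emb k E g)]
    (hemb : ∀ (ψ : Emb k E ((algebraMap Λ (AlgebraicClosure Λ)).comp g)) (a : E),
      ψ.1 a ∈ (algebraMap Λ (AlgebraicClosure Λ)).range) :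
    ∑ ψ : Emb k E g, CM.insepDegree ψ = Module.finrank k⸨X⸩ E := by
  have := Fintype.ofFinite (Emb k E ((algebraMap Λ (AlgebraicClosure Λ)).comp g))
  rw [← sum_insepDegree_of_isAlgClosed (g := (algebraMap Λ (AlgebraicClosure Λ)).comp g)]
  refine Fintype.sum_bijective _ (Emb.bijective_extend _ hemb) _ _ fun ψ => ?_
  rw [CM.insepDegree_eq, CM.insepDegree_eq, Emb.factor_extend]

end EmbeddingCount

end LocalShtuka

section Substitution

open PowerSeries

theorem exists_trunc_add_X_pow_mul {Λ : Type*} [CommSemiring Λ] (f : Λ⟦X⟧) (n : ℕ) :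
    ∃ (u : Polynomial Λ) (g : Λ⟦X⟧), f = (u : Λ⟦X⟧) + X ^ n * g :=
  ⟨trunc n f, _, (eq_X_pow_mul_shift_add_trunc n f).trans (add_comm _ _)⟩

variable {Λ : Type*} [CommRing Λ]

theorem powerSeries_ringHom_ext {s s' : Λ⟦X⟧ →+* Λ⟦X⟧} (hC : ∀ c, s (C c) = s' (C c))
    (hX : s X = s' X) (hX₀ : constantCoeff (s X) = 0) : s = s' := by
  have hpoly : s.comp Polynomial.coeToPowerSeries.ringHom =
      s'.comp Polynomial.coeToPowerSeries.ringHom :=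
    Polynomial.ringHom_ext (by simpa using hC) (by simpa using hX)
  refine RingHom.ext fun f => PowerSeries.ext fun n => ?_
  obtain ⟨u, g, hf⟩ := exists_trunc_add_X_pow_mul f (n + 1)
  have hu : s u = s' u := RingHom.congr_fun hpoly u
  have hdvd : X ^ (n + 1) ∣ s f - s' f := by
    rw [hf, map_add, map_add, hu, add_sub_add_left_eq_sub, map_mul, map_mul, map_pow, map_pow,
      ← hX, ← mul_sub]
    exact (pow_dvd_pow_of_dvd (X_dvd_iff.2 hX₀) _).mul_right _
  rw [← sub_eq_zero, ← map_sub]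
  exact X_pow_dvd_iff.1 hdvd n n.lt_succ_self

theorem exists_powerSeries_subst {t : Λ⟦X⟧} (ht : constantCoeff t = 0) :
    ∃ s : Λ⟦X⟧ →+* Λ⟦X⟧, (∀ c, s (C c) = C c) ∧ s X = t ∧
      ∀ f, constantCoeff (s f) = constantCoeff f := by
  have hsubst := HasSubst.of_constantCoeff_zero' ht
  let s : Λ⟦X⟧ →ₐ[Λ] Λ⟦X⟧ := substAlgHom hsubst
  have hC (c : Λ) : s (C c) = C c := s.commutes c
  have hX : s X = t := substAlgHom_X hsubst
  refine ⟨s.toRingHom, hC, hX, fun f => ?_⟩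
  obtain ⟨g, hg⟩ : X ∣ f - C (constantCoeff f) := by rw [X_dvd_iff]; simp
  have hs : s f = C (constantCoeff f) + t * s g := by
    rw [← hX, ← map_mul, ← hg, map_sub, hC, add_sub_cancel]
  exact (congrArg constantCoeff hs).trans (by simp [ht])

variable {k : Type*} [Field k] [PerfectField k] {p : ℕ} [Fact p.Prime] [CharP k⸨X⸩ p]
  {Λ : Type*} [Field Λ] [CharP Λ p] {F : Type*} [Field F] [Algebra k⸨X⸩ F] [Module.Finite k⸨X⸩ F]

theorem exists_expansion_of_finite {y : F} (hy : ∀ w, w ^ p ≠ y) {ψ : F →+* Λ}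
    {q : k⸨X⸩ →+* Λ⟦X⟧} {c : Λ} (hq : q (algebraMap k⟦X⟧ k⸨X⸩ X) = C c + X)
    (hψ : ∀ a, ψ (algebraMap k⸨X⸩ F a) = constantCoeff (q a)) :
    ∃ (θ : F →+* Λ⟦X⟧) (s : Λ⟦X⟧ →+* Λ⟦X⟧), (∀ x, constantCoeff (θ x) = ψ x) ∧
      θ y = C (ψ y) + X ∧ (∀ a, s (C a) = C a) ∧ ∀ a, θ (algebraMap k⸨X⸩ F a) = s (q a) := by
  have : CharP F p := charP_of_injective_algebraMap (algebraMap k⸨X⸩ F).injective p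
  have hrank := hasPRankOne_laurentSeries k (p := p)
  obtain ⟨θ, hθ, hθy⟩ := (hrank.of_finite (F := F)).exists_expansion hy ψ
  let z := algebraMap k⟦X⟧ k⸨X⸩ X
  obtain ⟨s, hsC, hsX, hs⟩ :=
    exists_powerSeries_subst (t := θ (algebraMap k⸨X⸩ F z) - C c) <| by
      rw [map_sub, hθ, hψ, hq]; simp
  have hθs : θ.comp (algebraMap k⸨X⸩ F) = s.comp q := by
    refine hrank.ringHom_ext pow_ne_laurentSeries_X (fun a => ?_) ?_
    · rw [RingHom.comp_apply, RingHom.comp_apply, hθ, hψ, hs]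
    · rw [RingHom.comp_apply, RingHom.comp_apply, hq, map_add, hsC, hsX, add_sub_cancel]
  exact ⟨θ, s, hθ, hθy, hsC, RingHom.congr_fun hθs⟩

end Substitution

namespace LocalShtuka

section Expansion

open BaseChange (Ring)

variable {k : Type*} [Field k] {Λ : Type*} [Field Λ] {E : Type*} [CommRing E] [Algebra k⸨X⸩ E]
  {q : k⸨X⸩ →+* Λ⟦X⟧} {c : Λ}

/-- `Θ` satisfies the conditions of `CM.Expansion`: it is an expansion of `ψ : E → Λ` along `y`,
where `q : k⸨X⸩ → Λ⟦X⟧` is an arbitrary homomorphism in place of `z ↦ ζ + (z - ζ)`. -/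
structure IsExpansion (ψ : Emb k E (PowerSeries.constantCoeff.comp q)) (y : CM.Factor ψ)
    (Θ : Ring q E →+* Λ⟦X⟧) : Prop where
  map_C : ∀ c : Λ, Θ (Ring.inl q E (PowerSeries.C c)) = PowerSeries.C c
  constantCoeff_map : ∀ e : E, PowerSeries.constantCoeff (Θ (Ring.inr q E e)) = ψ.1 e
  map_uniformizer : ∀ e : E, Ideal.Quotient.mk _ e = y →
    Θ (Ring.inr q E e) = PowerSeries.C (ψ.1 e) + PowerSeries.X

variable {ψ : Emb k E (PowerSeries.constantCoeff.comp q)} {y : CM.Factor ψ}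
  {Θ : Ring q E →+* Λ⟦X⟧}

theorem map_inl_X (hq : q (algebraMap k⟦X⟧ k⸨X⸩ PowerSeries.X) = PowerSeries.C c + PowerSeries.X)
    (hC : ∀ c : Λ, Θ (Ring.inl q E (PowerSeries.C c)) = PowerSeries.C c) :
    Θ (Ring.inl q E PowerSeries.X) =
      Θ (Ring.inr q E (algebraMap k⸨X⸩ E (algebraMap k⟦X⟧ k⸨X⸩ PowerSeries.X))) -
        PowerSeries.C c := by
  rw [BaseChange.Ring.inr_algebraMap, hq, map_add, map_add, hC, add_sub_cancel_left]

theorem constantCoeff_inl_X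
    (hq : q (algebraMap k⟦X⟧ k⸨X⸩ PowerSeries.X) = PowerSeries.C c + PowerSeries.X)
    (hC : ∀ c : Λ, Θ (Ring.inl q E (PowerSeries.C c)) = PowerSeries.C c)
    (hΘ : ∀ e : E, PowerSeries.constantCoeff (Θ (Ring.inr q E e)) = ψ.1 e) :
    PowerSeries.constantCoeff (Θ (Ring.inl q E PowerSeries.X)) = 0 := by
  have hψ := RingHom.congr_fun ψ.2 (algebraMap k⟦X⟧ k⸨X⸩ PowerSeries.X)
  rw [RingHom.comp_apply, RingHom.comp_apply, hq] at hψ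
  rw [map_inl_X hq hC, map_sub, hΘ, hψ]
  simp

variable [Module.Finite k⸨X⸩ E]

theorem ker_comp_inr (hΘ : ∀ e : E, PowerSeries.constantCoeff (Θ (Ring.inr q E e)) = ψ.1 e) :
    RingHom.ker (Θ.comp (Ring.inr q E)) = RingHom.ker ψ.1 := by
  have : IsArtinianRing E := IsArtinianRing.of_finite k⸨X⸩ E
  have hprime := RingHom.ker_isPrime (Θ.comp (Ring.inr q E))
  refine (IsArtinianRing.isMaximal_of_isPrime _).eq_of_le ψ.isMaximal_ker.ne_top fun x hx => ?_
  rw [RingHom.mem_ker, RingHom.comp_apply] at hx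
  rw [RingHom.mem_ker, ← hΘ, hx, map_zero]

theorem exists_factor (hΘ : ∀ e : E, PowerSeries.constantCoeff (Θ (Ring.inr q E e)) = ψ.1 e) :
    ∃ θ : CM.Factor ψ →+* Λ⟦X⟧, ∀ e, θ (Ideal.Quotient.mk _ e) = Θ (Ring.inr q E e) :=
  ⟨Ideal.Quotient.lift _ (Θ.comp (Ring.inr q E)) fun _ he => (ker_comp_inr hΘ).ge he, fun _ => rfl⟩

variable [PerfectField k] {p : ℕ} [hp : Fact p.Prime] [CharP k⸨X⸩ p] [CharP Λ p]

theorem IsExpansion.unique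
    (hq : q (algebraMap k⟦X⟧ k⸨X⸩ PowerSeries.X) = PowerSeries.C c + PowerSeries.X)
    (hy : ∀ w, w ^ p ≠ y) {Θ' : Ring q E →+* Λ⟦X⟧}
    (h : IsExpansion ψ y Θ) (h' : IsExpansion ψ y Θ') : Θ = Θ' := by
  have := ψ.isMaximal_ker
  let : Field (CM.Factor ψ) := Ideal.Quotient.field _
  have : CharP (CM.Factor ψ) p :=
    charP_of_injective_algebraMap (algebraMap k⸨X⸩ (CM.Factor ψ)).injective p
  have hrank : HasPRankOne (CM.Factor ψ) p := (hasPRankOne_laurentSeries k).of_finite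
  obtain ⟨θ, hθ⟩ := exists_factor h.constantCoeff_map
  obtain ⟨θ', hθ'⟩ := exists_factor h'.constantCoeff_map
  have hθθ' : θ = θ' := by
    refine hrank.ringHom_ext hy (fun x => ?_) ?_
    · obtain ⟨e, rfl⟩ := Ideal.Quotient.mk_surjective x
      rw [hθ, hθ', h.constantCoeff_map, h'.constantCoeff_map]
    · obtain ⟨e, rfl⟩ := Ideal.Quotient.mk_surjective y
      rw [hθ, hθ', h.map_uniformizer e rfl, h'.map_uniformizer e rfl]
  have hinr (e : E) : Θ (Ring.inr q E e) = Θ' (Ring.inr q E e) := by rw [← hθ, ← hθ', hθθ']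
  have hinl : Θ.comp (Ring.inl q E) = Θ'.comp (Ring.inl q E) := by
    refine powerSeries_ringHom_ext (fun c => (h.map_C c).trans (h'.map_C c).symm) ?_
      (constantCoeff_inl_X hq h.map_C h.constantCoeff_map)
    rw [RingHom.comp_apply, RingHom.comp_apply, map_inl_X hq h.map_C, map_inl_X hq h'.map_C, hinr]
  exact BaseChange.Ring.ringHom_ext q (RingHom.congr_fun hinl) hinr

theorem exists_isExpansion
    (hq : q (algebraMap k⟦X⟧ k⸨X⸩ PowerSeries.X) = PowerSeries.C c + PowerSeries.X)
    (hy : ∀ w, w ^ p ≠ y) : ∃ Θ : Ring q E →+* Λ⟦X⟧, IsExpansion ψ y Θ := by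
  have := ψ.isMaximal_ker
  let : Field (CM.Factor ψ) := Ideal.Quotient.field _
  obtain ⟨θ, s, hθ, hθy, hsC, hθs⟩ :=
    exists_expansion_of_finite hy (ψ := RingHom.kerLift ψ.1) hq (RingHom.congr_fun ψ.2)
  refine ⟨BaseChange.Ring.lift q s (fun b x => mul_comm _ _) (θ.comp (Ideal.Quotient.mk _)) hθs,
    ⟨fun c => ?_, fun e => ?_, ?_⟩⟩
  · rw [BaseChange.Ring.lift_inl, hsC]
  · rw [BaseChange.Ring.lift_inr]
    exact hθ _
  · rintro e rfl
    rw [BaseChange.Ring.lift_inr]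
    exact hθy

variable (p) in
include hp in
/-- Since `k⸨X⸩` has `p`-rank one, `z = w ^ d` in the factor field of inseparability degree `d`, so
`z - ψ(z) = (w - ψ(w)) ^ d`. -/
theorem X_pow_insepDegree_dvd
    (hq : q (algebraMap k⟦X⟧ k⸨X⸩ PowerSeries.X) = PowerSeries.C c + PowerSeries.X)
    (hC : ∀ c : Λ, Θ (Ring.inl q E (PowerSeries.C c)) = PowerSeries.C c)
    (hΘ : ∀ e : E, PowerSeries.constantCoeff (Θ (Ring.inr q E e)) = ψ.1 e) :
    (PowerSeries.X : Λ⟦X⟧) ^ CM.insepDegree ψ ∣ Θ (Ring.inl q E PowerSeries.X) := by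
  have := ψ.isMaximal_ker
  let : Field (CM.Factor ψ) := Ideal.Quotient.field _
  have : CharP (CM.Factor ψ) p :=
    charP_of_injective_algebraMap (algebraMap k⸨X⸩ (CM.Factor ψ)).injective p
  have : ExpChar k⸨X⸩ p := .prime hp.out
  have hd : CM.insepDegree ψ = Field.finInsepDegree k⸨X⸩ (CM.Factor ψ) := rfl
  obtain ⟨m, hm⟩ := finInsepDegree_eq_pow (F := k⸨X⸩) (E := CM.Factor ψ) p
  let z := algebraMap k⟦X⟧ k⸨X⸩ PowerSeries.X
  obtain ⟨w, hw⟩ :=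
    (hasPRankOne_laurentSeries k (p := p)).exists_pow_finInsepDegree (F := CM.Factor ψ) z
  obtain ⟨e, rfl⟩ := Ideal.Quotient.mk_surjective w
  obtain ⟨θ, hθ⟩ := exists_factor hΘ
  have hz : Θ (Ring.inr q E (algebraMap k⸨X⸩ E z)) = Θ (Ring.inr q E e) ^ p ^ m := by
    rw [← hθ, ← hθ, ← map_pow, ← hm, hw]
    rfl
  have hc := constantCoeff_inl_X hq hC hΘ
  rw [map_inl_X hq hC, map_sub, hz, map_pow, hΘ, sub_eq_zero, PowerSeries.constantCoeff_C] at hc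
  rw [map_inl_X hq hC, hz, hd, hm, ← hc, map_pow, X_pow_dvd_pow_sub_pow_iff, hΘ,
    PowerSeries.constantCoeff_C]

end Expansion

end LocalShtuka

section AdicCompleteness

theorem isPrecomplete_of_finite {R : Type*} [CommRing R] (I : Ideal R) [IsPrecomplete I R]
    (M : Type*) [AddCommGroup M] [Module R M] [Module.Finite R M] : IsPrecomplete I M := by
  rw [← AdicCompletion.of_surjective_iff, ← LinearMap.range_eq_top, eq_top_iff]
  rintro x -
  obtain ⟨t, rfl⟩ := AdicCompletion.ofTensorProduct_surjective_of_finite I M x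
  induction t with
  | zero => exact zero_mem _
  | add s t hs ht => exact map_add (AdicCompletion.ofTensorProduct I M) s t ▸ add_mem hs ht
  | tmul r m =>
    obtain ⟨a, rfl⟩ := AdicCompletion.of_surjective I R r
    rw [AdicCompletion.ofTensorProduct_tmul]
    exact ⟨a • m, (map_smul _ a m).trans (algebraMap_smul (AdicCompletion I R) a _).symm⟩

section

variable {R A B : Type*} [CommRing R] [CommRing A] [Algebra R A] [Module.Finite R A] [CommRing B]
  {φ : A →+* B} {x : R}

theorem surjective_of_exists_dvd_sub_map [IsPrecomplete (Ideal.span {x}) R]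
    (hB : ∀ b, (∀ n, φ (algebraMap R A x) ^ n ∣ b) → b = 0)
    (hsurj : ∀ b, ∃ a, φ (algebraMap R A x) ∣ b - φ a) : Function.Surjective φ := by
  let I := (Ideal.span {x}).map (algebraMap R A)
  have hI : I.map φ = Ideal.span {φ (algebraMap R A x)} := by
    simp only [I, Ideal.map_span, Set.image_singleton]
  have : IsPrecomplete I A :=
    IsPrecomplete.map_algebraMap_iff.2 (isPrecomplete_of_finite (Ideal.span {x}) A)
  have : IsHausdorff (I.map φ) B := by
    refine ⟨fun b hb => hB b fun n => ?_⟩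
    simpa [SModEq.zero, hI, Ideal.span_singleton_pow, Ideal.mem_span_singleton] using hb n
  refine surjective_of_mk_map_comp_surjective (I := I) φ fun b => ?_
  obtain ⟨b, rfl⟩ := Ideal.Quotient.mk_surjective b
  obtain ⟨a, ha⟩ := hsurj b
  refine ⟨a, (Ideal.Quotient.eq.2 ?_).symm⟩
  rwa [hI, Ideal.mem_span_singleton]

theorem injective_of_dvd_of_map_dvd [IsDomain R] [IsNoetherianRing R] [Module.IsTorsionFree R A]
    (hx : ¬ IsUnit x) (hreg : φ (algebraMap R A x) ∈ nonZeroDivisors B)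
    (hinj : ∀ a, φ (algebraMap R A x) ∣ φ a → algebraMap R A x ∣ a) : Function.Injective φ := by
  have hpow (n : ℕ) : ∀ a, φ a = 0 → ∃ a', a = x ^ n • a' := by
    induction n with
    | zero => exact fun a _ => ⟨a, by simp⟩
    | succ n ih =>
      intro a ha
      obtain ⟨a₁, rfl⟩ := hinj a (ha ▸ dvd_zero _)
      rw [map_mul, mul_left_mem_nonZeroDivisors_eq_zero_iff hreg] at ha
      obtain ⟨a₂, rfl⟩ := ih a₁ ha
      exact ⟨a₂, by rw [← Algebra.smul_def, smul_smul, pow_succ']⟩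
  have := IsHausdorff.of_isTorsionFree (Ideal.span {x}) A (by rwa [Ne, Ideal.span_singleton_eq_top])
  refine (injective_iff_map_eq_zero φ).2 fun a ha => IsHausdorff.haus this a fun n => ?_
  obtain ⟨a', rfl⟩ := hpow n a ha
  rw [SModEq.zero, Ideal.span_singleton_pow]
  exact Submodule.smul_mem_smul (Ideal.mem_span_singleton_self _) Submodule.mem_top

end

end AdicCompleteness

section Decomposition

open BaseChange (Ring)
open PowerSeries

variable {Λ : Type*} [Field Λ] {Q : Type*} [Field Q] {E : Type*} [CommRing E] [Algebra Q E]
  {q : Q →+* Λ⟦X⟧} {Ψ : Type*}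

/-- A family of `Λ`-algebra homomorphisms `E ⊗ Λ⟦X⟧ → Λ⟦X⟧` that reduce to pairwise distinct
homomorphisms `ψ i : E → Λ` and hit uniformizers. -/
structure IsExpansionFamily (ψ : Ψ → E →+* Λ) (Θ : Ψ → Ring q E →+* Λ⟦X⟧) : Prop where
  injective : Function.Injective ψ
  map_C : ∀ i c, Θ i (Ring.inl q E (C c)) = C c
  constantCoeff_map : ∀ i e, constantCoeff (Θ i (Ring.inr q E e)) = ψ i e
  exists_uniformizer : ∀ i, ∃ e, Θ i (Ring.inr q E e) = C (ψ i e) + X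

namespace IsExpansionFamily

variable {ψ : Ψ → E →+* Λ} {Θ : Ψ → Ring q E →+* Λ⟦X⟧} (H : IsExpansionFamily ψ Θ)

section Approximation

include H

theorem exists_X_pow_dvd_sub (i : Ψ) (n : ℕ) (v : Λ⟦X⟧) : ∃ w, X ^ n ∣ Θ i w - v := by
  obtain ⟨e, he⟩ := H.exists_uniformizer i
  obtain ⟨u, g, rfl⟩ := exists_trunc_add_X_pow_mul v n
  let w : Ring q E := u.eval₂ ((Ring.inl q E).comp C)
    (Ring.inr q E e - Ring.inl q E (C (ψ i e)))
  have hw : Θ i w = u := by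
    have hC : (Θ i).comp ((Ring.inl q E).comp C) = C := RingHom.ext fun c => H.map_C i c
    rw [Polynomial.hom_eval₂, hC, map_sub, he, H.map_C, add_sub_cancel_left,
      Polynomial.eval₂_C_X_eq_coe]
  exact ⟨w, -g, by rw [hw]; ring⟩

theorem isCoprime_comap {i j : Ψ} (hij : i ≠ j) (m n : ℕ) :
    IsCoprime ((Ideal.span {X ^ m}).comap (Θ i)) ((Ideal.span {X ^ n}).comap (Θ j)) := by
  obtain ⟨e, he⟩ : ∃ e, ψ i e ≠ ψ j e := by
    by_contra! hn
    exact hij (H.injective (RingHom.ext hn))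
  let a (l : Ψ) : Ring q E := Ring.inr q E e - Ring.inl q E (C (ψ l e))
  have ha (l : Ψ) (n : ℕ) : a l ^ n ∈ (Ideal.span {X ^ n}).comap (Θ l) := by
    rw [Ideal.mem_comap, Ideal.mem_span_singleton, map_pow]
    refine pow_dvd_pow_of_dvd (X_dvd_iff.2 ?_) n
    rw [map_sub, map_sub, H.map_C, H.constantCoeff_map, constantCoeff_C, sub_self]
  have hunit : IsUnit (a j - a i) := by
    rw [sub_sub_sub_cancel_left, ← map_sub, ← map_sub]
    exact ((sub_ne_zero.2 he).isUnit.map C).map (Ring.inl q E)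
  have hcop : IsCoprime (a i) (a j) := by
    obtain ⟨u, hu⟩ := hunit.exists_left_inv
    exact ⟨-u, u, by rw [← hu]; ring⟩
  obtain ⟨x, y, hxy⟩ := hcop.pow (m := m) (n := n)
  exact Ideal.isCoprime_iff_exists.2
    ⟨_, Ideal.mul_mem_left _ x (ha i m), _, Ideal.mul_mem_left _ y (ha j n), hxy⟩

theorem exists_forall_X_pow_dvd_sub [Finite Ψ] (n : Ψ → ℕ) (v : Ψ → Λ⟦X⟧) :
    ∃ w, ∀ i, X ^ n i ∣ Θ i w - v i := by
  have := Fintype.ofFinite Ψ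
  choose w hw using fun i => H.exists_X_pow_dvd_sub i (n i) (v i)
  obtain ⟨r, hr⟩ := Ideal.exists_forall_sub_mem_ideal
    (fun i j hij => H.isCoprime_comap hij (n i) (n j)) w
  refine ⟨r, fun i => ?_⟩
  have hri : X ^ n i ∣ Θ i (r - w i) := Ideal.mem_span_singleton.1 (hr i)
  simpa only [map_sub, sub_add_sub_cancel] using dvd_add hri (hw i)

end Approximation

section Truncation

variable {ι : Type*} [Fintype ι] (e : Module.Basis ι Q E)

variable (q) in
/-- The element of `E ⊗ Λ⟦X⟧` with constant coordinates `c`. -/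
noncomputable def ofConst (c : ι → Λ) : Ring q E :=
  ∑ j, Ring.inl q E (C (c j)) * Ring.inr q E (e j)

theorem exists_eq_ofConst_add (w : Ring q E) :
    ∃ c w', w = ofConst q e c + Ring.inl q E X * w' := by
  let b := Ring.basis q e
  refine ⟨fun j => constantCoeff (b.repr w j),
    ∑ j, PowerSeries.mk (fun m => coeff (m + 1) (b.repr w j)) • b j, ?_⟩
  rw [ofConst, ← Ring.smul_eq_inl_mul, Finset.smul_sum, ← Finset.sum_add_distrib]
  refine (b.sum_repr w).symm.trans (Finset.sum_congr rfl fun j _ => ?_)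
  rw [← Ring.basis_apply, ← Ring.smul_eq_inl_mul, smul_smul, ← add_smul, add_comm,
    ← eq_X_mul_shift_add_const]

variable (Θ) in
/-- The linear map sending constant coordinates to the expansions truncated at `n`. -/
noncomputable def truncation (hC : ∀ i c, Θ i (Ring.inl q E (C c)) = C c) (n : Ψ → ℕ) :
    (ι → Λ) →ₗ[Λ] ((i : Ψ) → Fin (n i) → Λ) where
  toFun c i m := coeff m (Θ i (ofConst q e c))
  map_add' c c' := by
    funext i m
    simp [ofConst, add_mul, Finset.sum_add_distrib]
  map_smul' a c := by
    funext i m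
    simp only [ofConst, map_sum, map_mul, Pi.smul_apply, smul_eq_mul, RingHom.id_apply, hC,
      coeff_C_mul, Finset.mul_sum, mul_assoc]

include H

theorem truncation_surjective [Finite Ψ] (n : Ψ → ℕ) (hn : ∀ i, X ^ n i ∣ Θ i (Ring.inl q E X)) :
    Function.Surjective (truncation Θ e H.map_C n) := by
  intro v
  obtain ⟨w, hw⟩ := H.exists_forall_X_pow_dvd_sub n
    (fun i => PowerSeries.mk fun m => if h : m < n i then v i ⟨m, h⟩ else 0)
  obtain ⟨c, w', rfl⟩ := exists_eq_ofConst_add e w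
  refine ⟨c, funext fun i => funext fun m => ?_⟩
  have hc := hw i
  rw [map_add, map_mul, add_sub_right_comm, dvd_add_left ((hn i).mul_right _)] at hc
  have hcoeff := X_pow_dvd_iff.1 hc m m.2
  rwa [map_sub, sub_eq_zero, coeff_mk, dif_pos m.2] at hcoeff

theorem sum_le [Fintype Ψ] [Module.Finite Q E] (n : Ψ → ℕ)
    (hn : ∀ i, X ^ n i ∣ Θ i (Ring.inl q E X)) :
    ∑ i, n i ≤ Module.finrank Q E := by
  have hle := LinearMap.finrank_le_finrank_of_surjective
    (f := truncation Θ (Module.finBasis Q E) H.map_C n) (H.truncation_surjective _ n hn)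
  simpa [Module.finrank_pi_fintype] using hle

end Truncation

section Bijective

variable [Fintype Ψ] [Module.Finite Q E] {d : Ψ → ℕ} (hd : ∀ i, X ^ d i ∣ Θ i (Ring.inl q E X))
  (hsum : ∑ i, d i = Module.finrank Q E)

include H hd hsum

theorem not_X_pow_succ_dvd (i : Ψ) : ¬ X ^ (d i + 1) ∣ Θ i (Ring.inl q E X) := by
  classical
  intro h
  have hle : ∑ j, (d j + if j = i then 1 else 0) ≤ Module.finrank Q E :=
    H.sum_le _ fun j => by
      split_ifs with hj
      · exact hj ▸ h
      · exact hd j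
  rw [Finset.sum_add_distrib, hsum, Finset.sum_ite_eq', if_pos (Finset.mem_univ i)] at hle
  exact Nat.not_succ_le_self _ hle

theorem associated_map_inl_X (i : Ψ) : Associated (X ^ d i) (Θ i (Ring.inl q E X)) := by
  obtain ⟨u, hu⟩ := hd i
  have hunit : IsUnit u := by
    rw [isUnit_iff_constantCoeff, isUnit_iff_ne_zero]
    refine fun hu₀ => H.not_X_pow_succ_dvd hd hsum i ?_
    rw [hu, pow_succ]
    exact mul_dvd_mul_left _ (X_dvd_iff.2 hu₀)
  exact hu ▸ associated_mul_unit_right _ u hunit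

omit [Module.Finite Q E] in
theorem truncation_injective {ι : Type*} [Fintype ι] (e : Module.Basis ι Q E) :
    Function.Injective (truncation Θ e H.map_C d) := by
  rw [LinearMap.injective_iff_surjective_of_finrank_eq_finrank]
  · exact H.truncation_surjective e d hd
  · rw [Module.finrank_pi_fintype, Module.finrank_pi_fintype]
    simp [hsum, Module.finrank_eq_card_basis e]

theorem inl_X_dvd_of_forall_dvd {w : Ring q E}
    (hw : ∀ i, Θ i (Ring.inl q E X) ∣ Θ i w) : Ring.inl q E X ∣ w := by
  let e := Module.finBasis Q E
  obtain ⟨c, w', rfl⟩ := exists_eq_ofConst_add e w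
  have htrunc : truncation Θ e H.map_C d c = 0 := by
    funext i m
    have hi := (hd i).trans (hw i)
    rw [map_add, map_mul, dvd_add_left ((hd i).mul_right _)] at hi
    exact X_pow_dvd_iff.1 hi m m.2
  rw [H.truncation_injective hd hsum e (htrunc.trans (map_zero _).symm)]
  simp [ofConst]

theorem bijective_pi (hX : ∀ i, X ∣ Θ i (Ring.inl q E X)) : Function.Bijective (RingHom.pi Θ) := by
  let b := Ring.basis q (Module.finBasis Q E)
  have := Module.Finite.of_basis b
  have := Module.Free.of_basis b
  have hne (i : Ψ) : Θ i (Ring.inl q E X) ≠ 0 := fun h =>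
    H.not_X_pow_succ_dvd hd hsum i (h ▸ dvd_zero _)
  refine ⟨injective_of_dvd_of_map_dvd (R := Λ⟦X⟧) X_prime.not_isUnit ?_ fun w hw => ?_,
    surjective_of_exists_dvd_sub_map (R := Λ⟦X⟧) (x := X) (fun v hv => ?_) fun v => ?_⟩
  · refine mem_nonZeroDivisors_iff_right.2 fun v hv => funext fun i => ?_
    exact (mul_eq_zero.1 (congrFun hv i)).resolve_right (hne i)
  · exact H.inl_X_dvd_of_forall_dvd hd hsum fun i => (Pi.evalRingHom _ i).map_dvd hw
  · refine funext fun i => PowerSeries.ext fun m => X_pow_dvd_iff.1 ?_ m m.lt_succ_self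
    exact (pow_dvd_pow_of_dvd (hX i) _).trans ((Pi.evalRingHom _ i).map_dvd (hv (m + 1)))
  · obtain ⟨w, hw⟩ := H.exists_forall_X_pow_dvd_sub d v
    choose u hu using fun i => (H.associated_map_inl_X hd hsum i).symm.dvd.trans
      ((dvd_sub_comm).1 (hw i))
    exact ⟨w, u, funext hu⟩

end Bijective

end IsExpansionFamily

end Decomposition

section CyclicModule

theorem exists_span_singleton_eq_top {W N : Type*} [CommRing W] [IsPrincipalIdealRing W]
    [AddCommGroup N] [Module W N] {f : N →ₗ[W] N} (hf : Function.Injective f) {v₀ : N}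
    (hv₀ : LinearMap.range f ≤ Submodule.span W {v₀}) : ∃ v : N, Submodule.span W {v} = ⊤ := by
  let J : Ideal W := (LinearMap.range f).comap (LinearMap.toSpanSingleton W N v₀)
  obtain ⟨w₁, hJ⟩ := (IsPrincipalIdealRing.principal J).principal
  have hw₁ : w₁ ∈ J := hJ.ge (Submodule.mem_span_singleton_self w₁)
  obtain ⟨v, hv : f v = w₁ • v₀⟩ := hw₁
  refine ⟨v, eq_top_iff.2 fun x _ => ?_⟩
  obtain ⟨w, hw⟩ := Submodule.mem_span_singleton.1 (hv₀ ⟨x, rfl⟩)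
  have hwJ : w ∈ J := ⟨x, hw.symm⟩
  obtain ⟨u, rfl⟩ := Submodule.mem_span_singleton.1 (hJ.le hwJ)
  refine Submodule.mem_span_singleton.2 ⟨u, hf ?_⟩
  rw [map_smul, hv, ← hw, smul_smul, smul_eq_mul]

variable {A N n : Type*} [CommRing A] [AddCommGroup N] [Module A N] [Fintype n] [DecidableEq n]

theorem isUnit_det_of_top_le_span (b : Module.Basis n A N) {v : n → N}
    (hv : ⊤ ≤ Submodule.span A (Set.range v)) : IsUnit (b.det v) := by
  have := Module.Finite.of_basis b
  have hsurj : Function.Surjective (b.constr A v) := by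
    rw [← LinearMap.range_eq_top, b.constr_range]
    exact top_le_iff.1 hv
  have hdet := (LinearEquiv.ofBijective _
    (OrzechProperty.bijective_of_surjective_endomorphism _ hsurj)).isUnit_det'
  have hcomp : b.det v = LinearMap.det (b.constr A v) := by
    rw [← mul_one (LinearMap.det _), ← b.det_self, ← b.det_comp]
    exact congrArg b.det (funext fun i => (b.constr_basis A v i).symm)
  rw [hcomp]
  exact hdet

theorem exists_basis_of_isUnit_det (b : Module.Basis n A N) {v : n → N} (hv : IsUnit (b.det v)) :
    ∃ t : Module.Basis n A N, ∀ j, t j = v j := by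
  obtain ⟨hli, hspan⟩ := (Module.Basis.is_basis_iff_det b).2 hv
  exact ⟨Module.Basis.mk hli hspan.ge, fun j => Module.Basis.mk_apply hli hspan.ge j⟩

end CyclicModule

section RingAction

open BaseChange (Ring)

variable {A : Type*} [CommRing A] {Q : Type*} [Field Q] {E : Type*} [CommRing E] [Algebra Q E]
  (q : Q →+* A) {N : Type*} [AddCommGroup N] [Module A N] (ρ : E →+* Module.End A N)
  (hρ : ∀ a, ρ (algebraMap Q E a) = algebraMap A _ (q a))

/-- The action of `E ⊗ A` on an `A`-module that carries an action of `E`. -/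
noncomputable def ringAction : Ring q E →+* Module.End A N :=
  BaseChange.Ring.lift q (algebraMap A _) (fun b x => Algebra.commutes b x) ρ hρ

theorem ringAction_inl (c : A) : ringAction q ρ hρ (Ring.inl q E c) = algebraMap A _ c :=
  BaseChange.Ring.lift_inl ..

theorem ringAction_inr (a : E) : ringAction q ρ hρ (Ring.inr q E a) = ρ a :=
  BaseChange.Ring.lift_inr ..

variable {n : Type*} (e : Module.Basis n Q E)

theorem ringAction_apply [Fintype n] (w : Ring q E) (x : N) :
    ringAction q ρ hρ w x = ∑ j, (Ring.basis q e).repr w j • ρ (e j) x := by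
  conv_lhs => rw [← (Ring.basis q e).sum_repr w]
  simp only [BaseChange.Ring.smul_eq_inl_mul, BaseChange.Ring.basis_apply, map_sum, map_mul,
    LinearMap.sum_apply, Module.End.mul_apply, ringAction_inl, ringAction_inr,
    Module.algebraMap_end_apply]

theorem bijective_ringAction_apply [Finite n] {v : N} {t : Module.Basis n A N}
    (ht : ∀ j, t j = ρ (e j) v) :
    Function.Bijective fun w => ringAction q ρ hρ w v := by
  have := Fintype.ofFinite n
  have h : (fun w => ringAction q ρ hρ w v) = (Ring.basis q e).equivFun ≪≫ₗ t.equivFun.symm := by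
    funext w
    simp only [ringAction_apply q ρ hρ e, LinearEquiv.trans_apply,
      Module.Basis.equivFun_symm_apply, Module.Basis.equivFun_apply, ht]
  rw [h]
  exact LinearEquiv.bijective _

variable [Fintype n] [DecidableEq n]

/-- Cramer's rule: the `E ⊗ A`-span of `v` is the `A`-span of the orbit of `v` under a basis of `E`,
and contains every multiple of the determinant of this orbit. -/
theorem exists_ringAction_eq_det_smul (b : Module.Basis n A N) (v x : N) :
    ∃ w, ringAction q ρ hρ w v = b.det (fun j => ρ (e j) v) • x := by
  let V := b.toMatrix fun j => ρ (e j) v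
  let c := V.cramer (b.repr x)
  refine ⟨∑ j, c j • Ring.basis q e j, b.equivFun.injective ?_⟩
  calc b.equivFun (ringAction q ρ hρ _ v) = V.mulVec c := by
        ext i
        simp only [ringAction_apply q ρ hρ e, Module.Basis.repr_sum_self]
        simp [Matrix.mulVec, dotProduct, V, mul_comm, Module.Basis.toMatrix_apply]
    _ = b.equivFun (b.det (fun j => ρ (e j) v) • x) := by
        rw [Matrix.mulVec_cramer, map_smul, Module.Basis.det_apply]
        rfl

include hρ in
theorem exists_isUnit_det [IsDomain A] [IsPrincipalIdealRing (Ring q E)] (b : Module.Basis n A N)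
    {v₀ : N} (h₀ : b.det (fun j => ρ (e j) v₀) ≠ 0) :
    ∃ v, IsUnit (b.det fun j => ρ (e j) v) := by
  let δ := b.det fun j => ρ (e j) v₀
  let : Module (Ring q E) N := Module.compHom N (ringAction q ρ hρ)
  have hsmul (w : Ring q E) (x : N) : w • x = ringAction q ρ hρ w x := rfl
  let f : N →ₗ[Ring q E] N := LinearMap.lsmul (Ring q E) N (Ring.inl q E δ)
  have hf (x : N) : f x = δ • x := by
    rw [LinearMap.lsmul_apply, hsmul, ringAction_inl, Module.algebraMap_end_apply]
  have hinj : Function.Injective f := fun x y hxy => by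
    rw [hf, hf, ← b.equivFun.injective.eq_iff, map_smul, map_smul] at hxy
    exact b.equivFun.injective (smul_right_injective _ h₀ hxy)
  obtain ⟨v, hv⟩ := exists_span_singleton_eq_top hinj (v₀ := v₀) (by
    rintro _ ⟨x, rfl⟩
    obtain ⟨w, hw⟩ := exists_ringAction_eq_det_smul q ρ hρ e b v₀ x
    exact Submodule.mem_span_singleton.2 ⟨w, hw.trans (hf x).symm⟩)
  refine ⟨v, isUnit_det_of_top_le_span b fun x _ => ?_⟩
  obtain ⟨w, rfl⟩ := Submodule.mem_span_singleton.1 (hv.ge (Submodule.mem_top (x := x)))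
  rw [hsmul, ringAction_apply q ρ hρ e]
  exact Submodule.sum_mem _ fun j _ => Submodule.smul_mem _ _ (Submodule.subset_span ⟨j, rfl⟩)

end RingAction

namespace LocalShtuka

section Expansion

open BaseChange (Ring)

variable {k : Type*} [Field k] [PerfectField k] {p : ℕ} [hp : Fact p.Prime] [CharP k⸨X⸩ p]
  {Λ : Type*} [Field Λ] [CharP Λ p] {E : Type*} [CommRing E] [Algebra k⸨X⸩ E]
  [Module.Finite k⸨X⸩ E] [IsSemisimpleRing E] {q : k⸨X⸩ →+* Λ⟦X⟧} {c : Λ}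

omit [PerfectField k] [Module.Finite k⸨X⸩ E] [IsSemisimpleRing E] in
theorem isExpansionFamily {y : (ψ : Emb k E (PowerSeries.constantCoeff.comp q)) → CM.Factor ψ}
    {Θ : Emb k E (PowerSeries.constantCoeff.comp q) → Ring q E →+* Λ⟦X⟧}
    (hΘ : ∀ ψ, IsExpansion ψ (y ψ) (Θ ψ)) : IsExpansionFamily (fun ψ => ψ.1) Θ where
  injective := Subtype.val_injective
  map_C ψ := (hΘ ψ).map_C
  constantCoeff_map ψ := (hΘ ψ).constantCoeff_map
  exists_uniformizer ψ := (Ideal.Quotient.mk_surjective (y ψ)).imp (hΘ ψ).map_uniformizer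

variable (p)

include hp in
theorem bijective_pi_of_isExpansion
    (hq : q (algebraMap k⟦X⟧ k⸨X⸩ PowerSeries.X) = PowerSeries.C c + PowerSeries.X)
    (hemb : ∀ (ψ : Emb k E ((algebraMap Λ (AlgebraicClosure Λ)).comp
      (PowerSeries.constantCoeff.comp q))) (a : E),
      ψ.1 a ∈ (algebraMap Λ (AlgebraicClosure Λ)).range)
    {y : (ψ : Emb k E (PowerSeries.constantCoeff.comp q)) → CM.Factor ψ}
    {Θ : Emb k E (PowerSeries.constantCoeff.comp q) → Ring q E →+* Λ⟦X⟧}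
    (hΘ : ∀ ψ, IsExpansion ψ (y ψ) (Θ ψ)) : Function.Bijective (RingHom.pi Θ) := by
  have := Fintype.ofFinite (Emb k E (PowerSeries.constantCoeff.comp q))
  exact (isExpansionFamily hΘ).bijective_pi
    (fun ψ => X_pow_insepDegree_dvd p hq (hΘ ψ).map_C (hΘ ψ).constantCoeff_map)
    (sum_insepDegree hemb)
    fun ψ => PowerSeries.X_dvd_iff.2
      (constantCoeff_inl_X hq (hΘ ψ).map_C (hΘ ψ).constantCoeff_map)

omit [CharP Λ p] [IsSemisimpleRing E] in
include hp in
theorem exists_factor_pow_ne {g : k⸨X⸩ →+* Λ} (ψ : Emb k E g) :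
    ∃ y : CM.Factor ψ, ∀ w, w ^ p ≠ y := by
  have := ψ.isMaximal_ker
  let : Field (CM.Factor ψ) := Ideal.Quotient.field _
  have : CharP (CM.Factor ψ) p :=
    charP_of_injective_algebraMap (algebraMap k⸨X⸩ (CM.Factor ψ)).injective p
  exact ((hasPRankOne_laurentSeries k).of_finite (F := CM.Factor ψ)).exists_pow_ne

include hp in
theorem isPrincipalIdealRing_of_isAlgClosed [IsAlgClosed Λ]
    (hq : q (algebraMap k⟦X⟧ k⸨X⸩ PowerSeries.X) = PowerSeries.C c + PowerSeries.X) :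
    IsPrincipalIdealRing (Ring q E) := by
  choose y hy using fun ψ : Emb k E (PowerSeries.constantCoeff.comp q) => exists_factor_pow_ne p ψ
  choose Θ hΘ using fun ψ => exists_isExpansion hq (hy ψ)
  have hbij := bijective_pi_of_isExpansion p hq (fun ψ a =>
    IsAlgClosed.algebraMap_bijective_of_isIntegral (k := Λ) (K := AlgebraicClosure Λ).2 (ψ.1 a)) hΘ
  let g := RingEquiv.ofBijective _ hbij
  exact IsPrincipalIdealRing.of_surjective g.symm g.symm.surjective

theorem exists_prime_charP_laurentSeries (k : Type*) [Field k] [Finite k] :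
    ∃ p : ℕ, Fact p.Prime ∧ CharP k⸨X⸩ p := by
  obtain ⟨p, hp⟩ := CharP.exists k
  exact ⟨p, ⟨CharP.char_is_prime k p⟩,
    charP_of_injective_algebraMap (algebraMap k k⸨X⸩).injective p⟩

end Expansion

section Specialization

variable {R : Type*} [CommRing R] [IsLocalRing R] [IsAdicComplete (IsLocalRing.maximalIdeal R) R]

theorem taylorShift_injective (P : CharPoint R) : Function.Injective (taylorShift P) := by
  let P' : CharPoint R := ⟨-P.ζ, neg_mem P.mem, neg_ne_zero.2 P.ne_zero⟩
  have hC (c : R) : taylorShift P' (PowerSeries.C c) = PowerSeries.C c :=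
    (taylorShift P').commutes c
  have hX : taylorShift P' (taylorShift P PowerSeries.X) = PowerSeries.X := by
    rw [taylorShift_X, map_add, taylorShift_X, hC, map_neg, add_neg_cancel_left]
  have h : (taylorShift P').toRingHom.comp (taylorShift P).toRingHom = RingHom.id _ :=
    powerSeries_ringHom_ext ((taylorShift P').comp (taylorShift P)).commutes hX
      ((congrArg _ hX).trans PowerSeries.constantCoeff_X)
  exact Function.LeftInverse.injective (g := taylorShift P') (RingHom.congr_fun h)

theorem frobSeries_injective {k S : Type*} [Field k] [Fintype k] [CommRing S] [IsReduced S]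
    (φ : k →+* S) : Function.Injective (frobSeries φ) :=
  PowerSeries.map_injective _ <| by
    rw [injective_iff_map_eq_zero]
    exact fun x hx => eq_zero_of_pow_eq_zero hx

variable {P : CharPoint R} (L : Type*) [Field L] [Algebra R L]

theorem constantCoeff_comp_toSeries : (PowerSeries.constantCoeff (R := L)).comp (toSeries L P) =
    (algebraMap R L).comp (evalZeta P) := by
  ext x
  rw [RingHom.comp_apply, ← PowerSeries.coeff_zero_eq_constantCoeff_apply, toSeries,
    RingHom.comp_apply, PowerSeries.coeff_map, PowerSeries.coeff_zero_eq_constantCoeff_apply]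
  rfl

variable [IsFractionRing R L]

theorem toSeries_injective : Function.Injective (toSeries L P) :=
  (PowerSeries.map_injective _ (IsFractionRing.injective R L)).comp (taylorShift_injective P)

theorem qToSeries_X {k : Type*} [Field k] [Fintype k] [Algebra k R] :
    qToSeries k L P (algebraMap k⟦X⟧ k⸨X⸩ PowerSeries.X) =
      PowerSeries.C (algebraMap R L P.ζ) + PowerSeries.X := by
  rw [qToSeries_algebraMap, PowerSeries.algebraMap_apply'', PowerSeries.map_X]
  change PowerSeries.map (algebraMap R L) (taylorShift P PowerSeries.X) = _
  rw [taylorShift_X, map_add, PowerSeries.map_C, PowerSeries.map_X]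

end Specialization

section Generator

variable {k : Type*} [Field k] [Fintype k] {R : Type*} [CommRing R] [IsLocalRing R]
  [Algebra k R] {P : CharPoint R} (M : LocalShtuka k P)

section OrbitDet

variable {B C : Type*} [CommRing B] [CommRing C] (g : R⟦X⟧ →+* B) {n : Type*}
  (b : Module.Basis n R⟦X⟧ M.carrier)

/-- The basis of a base change of `σ̂^*M` induced by a basis of `M`. -/
noncomputable def pullbackBasis : Module.Basis n B (BaseChange g M.sigmaPullback) :=
  BaseChange.basis g (BaseChange.basis (sigmaHat k R) b)

variable [Fintype n] [DecidableEq n] (f : n → M.End)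

theorem map_orbitDet_endPullback :
    MvPolynomial.map g (MvPolynomial.map (sigmaHat k R) (orbitDet b fun j => (f j).1)) =
      orbitDet (M.pullbackBasis g b) (fun j => M.endPullback g (f j)) := by
  rw [map_orbitDet, map_orbitDet]
  rfl

theorem map_det_endPullback (h : B →+* C) (g' : R⟦X⟧ →+* C) (hg : h.comp g = g')
    (x : BaseChange g M.sigmaPullback) :
    h ((M.pullbackBasis g b).det fun j => M.endPullback g (f j) x) =
      (M.pullbackBasis g' b).det fun j =>
        M.endPullback g' (f j) (BaseChange.along g h g' hg x) := by
  rw [← eval_orbitDet, ← eval_orbitDet, ← map_orbitDet_endPullback, ← map_orbitDet_endPullback,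
    ← MvPolynomial.eval₂_eq_eval_map, MvPolynomial.eval₂_comp_left, hg,
    MvPolynomial.eval₂_eq_eval_map]
  congr 2
  funext l
  exact (BaseChange.basis_repr_along g h g' hg _ x l).symm

variable {g M b f} in
theorem CM.orbitDet_endPullback_ne_zero [IsDomain R] {E : Type*} [CommRing E] [Algebra k⸨X⸩ E]
    [IsSemisimpleRing E] (C : M.CM E) (e : Module.Basis n k⸨X⸩ E)
    (hf : ∀ j, C.ι (e j) = 1 ⊗ₜ f j) (hg : Function.Injective g) :
    orbitDet (M.pullbackBasis g b) (fun j => M.endPullback g (f j)) ≠ 0 := by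
  rw [← map_orbitDet_endPullback]
  exact (map_ne_zero_iff _ (MvPolynomial.map_injective g hg)).2
    ((map_ne_zero_iff _ (MvPolynomial.map_injective _ (frobSeries_injective (algebraMap k R)))).2
      (C.orbitDet_end_ne_zero b e f hf))

end OrbitDet

variable [IsAdicComplete (IsLocalRing.maximalIdeal R) R]

section QEndPullback

variable {B : Type*} [CommRing B] {g : R⟦X⟧ →+* B} (q : k⸨X⸩ →+* B)
  (hq : ∀ a, q (algebraMap k⟦X⟧ k⸨X⸩ a) = g (algebraMap k⟦X⟧ R⟦X⟧ a))

/-- The action of `QEnd_R(M)` on a base change of `σ̂^*M` to a ring over `Q_v`. -/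
noncomputable def qEndPullback : M.QEnd →+* Module.End B (BaseChange g M.sigmaPullback) :=
  tensorLift ((algebraMap B _).comp q) (fun _ x => Algebra.commutes _ x)
    (M.endPullback g) (fun a => by rw [endPullback_algebraMap, RingHom.comp_apply, hq])

theorem qEndPullback_one_tmul (f : M.End) :
    M.qEndPullback q hq (1 ⊗ₜ f) = M.endPullback g f := by
  rw [qEndPullback, tensorLift_tmul, map_one, one_mul]

theorem qEndPullback_algebraMap (a : k⸨X⸩) :
    M.qEndPullback q hq (algebraMap k⸨X⸩ M.QEnd a) = algebraMap B _ (q a) := by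
  refine (tensorLift_tmul _ _ _ _ a 1).trans ?_
  rw [map_one, mul_one, RingHom.comp_apply]

end QEndPullback

namespace CM

variable {M} [IsDomain R] {E : Type*} [CommRing E] [Algebra k⸨X⸩ E] (C : M.CM E)

section Orbit

variable {n : Type*} [Fintype n] [DecidableEq n] (b : Module.Basis n R⟦X⟧ M.carrier)
  (e : Module.Basis n k⸨X⸩ E) {f : n → M.End} (hf : ∀ j, C.ι (e j) = 1 ⊗ₜ f j)

include hf

theorem exists_isUnit_det_endPullback [IsSemisimpleRing E] [Module.Finite k⸨X⸩ E] {Λ : Type*}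
    [Field Λ] [IsAlgClosed Λ] {g : R⟦X⟧ →+* Λ⟦X⟧} (hg : Function.Injective g) {q : k⸨X⸩ →+* Λ⟦X⟧}
    (hgq : ∀ a, q (algebraMap k⟦X⟧ k⸨X⸩ a) = g (algebraMap k⟦X⟧ R⟦X⟧ a)) {c : Λ}
    (hq : q (algebraMap k⟦X⟧ k⸨X⸩ PowerSeries.X) = PowerSeries.C c + PowerSeries.X) :
    ∃ v, IsUnit ((M.pullbackBasis g b).det fun j => M.endPullback g (f j) v) := by
  obtain ⟨p, hp, _⟩ := exists_prime_charP_laurentSeries k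
  have : CharP Λ p := charP_of_injective_ringHom (PowerSeries.constantCoeff.comp q).injective p
  have := isPrincipalIdealRing_of_isAlgClosed (E := E) p hq
  have : Infinite Λ⟦X⟧ := Infinite.of_injective _ (PowerSeries.C_injective (R := Λ))
  let ρ : E →+* Module.End Λ⟦X⟧ (BaseChange g M.sigmaPullback) :=
    (M.qEndPullback q hgq).comp C.ι.toRingHom
  have hρ (a : k⸨X⸩) : ρ (algebraMap k⸨X⸩ E a) = algebraMap _ _ (q a) :=
    (congrArg (M.qEndPullback q hgq) (C.ι.commutes a)).trans
      (M.qEndPullback_algebraMap q hgq a)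
  have hρf (j : n) : ρ (e j) = M.endPullback g (f j) :=
    (congrArg (M.qEndPullback q hgq) (hf j)).trans (M.qEndPullback_one_tmul q hgq _)
  obtain ⟨v₀, h₀⟩ := exists_det_ne_zero (C.orbitDet_endPullback_ne_zero e hf hg)
  simp only [← hρf] at h₀ ⊢
  exact exists_isUnit_det q ρ hρ e _ h₀

variable (L : Type*) [Field L] [Algebra R L] [IsFractionRing R L]

theorem orbitDet_endPullback_evalZeta_ne_zero [IsSemisimpleRing E] [Module.Finite k⸨X⸩ E] :
    orbitDet (M.pullbackBasis ((algebraMap R L).comp (evalZeta P)) b)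
      (fun j => M.endPullback ((algebraMap R L).comp (evalZeta P)) (f j)) ≠ 0 := by
  let Λ := AlgebraicClosure L
  let i : L⟦X⟧ →+* Λ⟦X⟧ := PowerSeries.map (algebraMap L Λ)
  have hi : Function.Injective i := PowerSeries.map_injective _ (algebraMap L Λ).injective
  obtain ⟨v, hv⟩ := C.exists_isUnit_det_endPullback b e hf (g := i.comp (toSeries L P))
    (hi.comp (toSeries_injective L)) (q := i.comp (qToSeries k L P))
    (fun a => congrArg i (qToSeries_algebraMap k L P a))
    (by rw [RingHom.comp_apply, qToSeries_X, map_add, PowerSeries.map_C, PowerSeries.map_X])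
  have hconst : PowerSeries.constantCoeff.comp (i.comp (toSeries L P)) =
      (algebraMap L Λ).comp ((algebraMap R L).comp (evalZeta P)) := by
    rw [← constantCoeff_comp_toSeries]
    ext x
    simp only [RingHom.comp_apply, ← PowerSeries.coeff_zero_eq_constantCoeff_apply, i,
      PowerSeries.coeff_map]
  have hdet := (hv.map PowerSeries.constantCoeff).ne_zero
  rw [M.map_det_endPullback _ b f _ _ hconst] at hdet
  have hne := orbitDet_ne_zero hdet
  rw [← map_orbitDet_endPullback] at hne ⊢
  contrapose! hne
  rw [← MvPolynomial.map_map (f := (algebraMap R L).comp (evalZeta P)), hne, map_zero]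

end Orbit

variable (L : Type*) [Field L] [Algebra R L] [IsFractionRing R L]

theorem exists_generator [IsSemisimpleRing E] [Module.Finite k⸨X⸩ E] :
    ∃ e : Module.Basis (Fin M.rank) k⸨X⸩ E,
      (∃ (v : M.deRhamSeries L) (t : Module.Basis (Fin M.rank) L⟦X⟧ (M.deRhamSeries L)),
        ∀ j, t j = M.qEndSeries L (C.ι (e j)) v) ∧
      ∃ (v : M.deRhamL L) (t : Module.Basis (Fin M.rank) L (M.deRhamL L)),
        ∀ j, t j = C.actionL L (e j) v := by
  have : Infinite k⸨X⸩ := Infinite.of_injective _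
    ((IsFractionRing.injective k⟦X⟧ k⸨X⸩).comp (Polynomial.coe_injective k))
  have : Infinite L := Infinite.of_injective _ (gamma k L P).injective
  obtain ⟨e, f, hf⟩ := C.exists_basis_end
  let b : Module.Basis (Fin M.rank) R⟦X⟧ M.carrier := Module.finBasis R⟦X⟧ M.carrier
  obtain ⟨x, hx⟩ := exists_det_ne_zero (C.orbitDet_endPullback_evalZeta_ne_zero b e hf L)
  obtain ⟨v, hvx⟩ := BaseChange.along_surjective (toSeries L P)
    PowerSeries.constantCoeff_surj (constantCoeff_comp_toSeries L) x
  have hv : IsUnit ((M.pullbackBasis (toSeries L P) b).det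
      fun j => M.endPullback (toSeries L P) (f j) v) := by
    rw [PowerSeries.isUnit_iff_constantCoeff,
      M.map_det_endPullback _ b f _ _ (constantCoeff_comp_toSeries L), hvx]
    exact hx.isUnit
  obtain ⟨t, ht⟩ := exists_basis_of_isUnit_det _ hv
  obtain ⟨u, hu⟩ := exists_basis_of_isUnit_det _ hx.isUnit
  refine ⟨e, ⟨v, t, fun j => ?_⟩, x, u, fun j => ?_⟩
  · rw [ht, ← M.qEndPullback_one_tmul _ (qToSeries_algebraMap k L P), ← hf]
    rfl
  · rw [hu, ← M.qEndPullback_one_tmul _ (gamma_algebraMap L P), ← hf]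
    rfl

theorem deRham_equiv [IsSemisimpleRing E] [Module.Finite k⸨X⸩ E] :
    Nonempty (C.deRham L ≃ₗ[ESeries k P E L] ESeries k P E L) := by
  obtain ⟨e, ⟨v, t, ht⟩, -⟩ := C.exists_generator L
  have hρ (a : k⸨X⸩) : (M.qEndSeries L).comp C.ι.toRingHom (algebraMap k⸨X⸩ E a) =
      algebraMap _ _ (qToSeries k L P a) :=
    (congrArg (M.qEndSeries L) (C.ι.commutes a)).trans
      (M.qEndPullback_algebraMap _ (qToSeries_algebraMap k L P) a)
  exact ⟨(LinearEquiv.ofBijective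
    (LinearMap.toSpanSingleton (ESeries k P E L) (C.deRham L) (v : C.deRham L))
    (bijective_ringAction_apply (qToSeries k L P) _ hρ e ht)).symm⟩

end CM

end Generator

end LocalShtuka

namespace BaseChange

variable {W : Type*} [CommRing W] {N : Type*} [AddCommGroup N] [Module W N]

/-- The trivialization of a base change induced by a trivialization of the module. -/
noncomputable def equivOfEquiv (g : N ≃ₗ[W] W) {B : Type*} [CommRing B] (f : W →+* B) :
    BaseChange f N ≃ₗ[B] B :=
  (basis f ((Module.Basis.singleton Unit W).map g.symm)).equivFun ≪≫ₗ LinearEquiv.funUnique Unit B B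

theorem equivOfEquiv_mk (g : N ≃ₗ[W] W) {B : Type*} [CommRing B] (f : W →+* B) (x : N) :
    equivOfEquiv g f (mk f x) = f (g x) := by
  refine (basis_repr_mk f _ x ()).trans ?_
  simp

theorem bijective_mk_pi (g : N ≃ₗ[W] W) {ι : Type*} {B : ι → Type*} [∀ i, CommRing (B i)]
    (f : ∀ i, W →+* B i) (hf : Function.Bijective (RingHom.pi f)) :
    Function.Bijective fun (x : N) i => mk (f i) x := by
  have hpi : Function.Bijective fun (y : ∀ i, BaseChange (f i) N) i => equivOfEquiv g (f i) (y i) :=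
    Function.Bijective.piMap fun i => (equivOfEquiv g (f i)).bijective
  refine (Function.Bijective.of_comp_iff' hpi _).1 ?_
  convert hf.comp g.bijective using 1
  funext x i
  exact equivOfEquiv_mk g (f i) x

end BaseChange

namespace LocalShtuka

namespace CM

variable {k : Type*} [Field k] [Fintype k]

omit [Fintype k] in
theorem IsUniformizer.pow_ne {F : Type*} [CommRing F] [Algebra k⸨X⸩ F] {y : F}
    (hy : IsUniformizer k y) {p : ℕ} (hp : p.Prime) (w : F) : w ^ p ≠ y := by
  let : Algebra k⟦X⟧ F := ((algebraMap k⸨X⸩ F).comp (algebraMap k⟦X⟧ k⸨X⸩)).toAlgebra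
  obtain ⟨h, hirr⟩ := hy
  rintro rfl
  exact not_irreducible_pow (M := integralClosure k⟦X⟧ F) (x := ⟨w, IsIntegral.of_pow hp.pos h⟩)
    hp.one_lt.ne' hirr

variable {R : Type*} [CommRing R] [IsLocalRing R]
  [IsAdicComplete (IsLocalRing.maximalIdeal R) R] [Algebra k R] {P : CharPoint R}
  {L : Type*} [Field L] [Algebra R L] [IsFractionRing R L]
  {E : Type*} [CommRing E] [Algebra k⸨X⸩ E]

theorem Expansion.isExpansion {ψ : Emb k E (gamma k L P)} {y : Factor ψ} (Θ : Expansion ψ y) :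
    IsExpansion (q := qToSeries k L P) ψ y Θ.toRingHom :=
  ⟨Θ.map_C, Θ.constantCoeff_map, Θ.map_uniformizer⟩

variable [Module.Finite k⸨X⸩ E]

theorem exists_expansion_unique {ψ : Emb k E (gamma k L P)} {y : Factor ψ}
    (hy : IsUniformizer k y) : ∃ Θ : Expansion ψ y, ∀ Θ', Θ' = Θ := by
  obtain ⟨p, hp, _⟩ := exists_prime_charP_laurentSeries k
  have : CharP L p := charP_of_injective_ringHom (gamma k L P).injective p
  have hyp := hy.pow_ne hp.out
  obtain ⟨Θ, hΘ⟩ := exists_isExpansion (q := qToSeries k L P) (ψ := ψ) (qToSeries_X L) hyp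
  exact ⟨⟨Θ, hΘ.map_C, hΘ.constantCoeff_map, hΘ.map_uniformizer⟩, fun Θ' =>
    Expansion.ext (Θ'.isExpansion.unique (q := qToSeries k L P) (qToSeries_X L) hyp hΘ)⟩

variable [IsDomain R] [IsSemisimpleRing E] {M : LocalShtuka k P} (C : M.CM E)

theorem exists_expansion_decomposition
    (hemb : ∀ (ψ : Emb k E ((algebraMap L (AlgebraicClosure L)).comp (gamma k L P))) (a : E),
      ψ.1 a ∈ (algebraMap L (AlgebraicClosure L)).range)
    (y : (ψ : Emb k E (gamma k L P)) → Factor ψ) (hy : ∀ ψ, IsUniformizer k (y ψ)) :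
    ∃ Θ : ∀ ψ, Expansion ψ (y ψ), (∀ Θ' : ∀ ψ, Expansion ψ (y ψ), Θ' = Θ) ∧
      Function.Bijective (fun (x : ESeries k P E L) ψ => (Θ ψ).toRingHom x) ∧
      Function.Bijective
        (fun (ω : C.deRham L) ψ => (BaseChange.mk (Θ ψ).toRingHom ω : C.HPsiSeries (Θ ψ))) ∧
      ∀ ψ, Nonempty (C.HPsiSeries (Θ ψ) ≃ₗ[L⟦X⟧] L⟦X⟧) := by
  obtain ⟨p, hp, _⟩ := exists_prime_charP_laurentSeries k
  have : CharP L p := charP_of_injective_ringHom (gamma k L P).injective p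
  choose Θ hΘ using fun ψ => exists_expansion_unique (hy ψ)
  have hbij := bijective_pi_of_isExpansion (q := qToSeries k L P) p (qToSeries_X L) hemb
    (fun ψ => (Θ ψ).isExpansion)
  obtain ⟨g⟩ := C.deRham_equiv L
  exact ⟨Θ, fun Θ' => funext fun ψ => hΘ ψ (Θ' ψ), hbij,
    BaseChange.bijective_mk_pi g _ hbij, fun ψ => ⟨BaseChange.equivOfEquiv g _⟩⟩

end CM

end LocalShtuka

section Eigenspaces

theorem isInternal_of_sum_finrank_le {K V ι : Type*} [Field K] [AddCommGroup V] [Module K V]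
    [Module.Finite K V] [Fintype ι] [DecidableEq ι] {G : ι → Submodule K V} (hG : iSupIndep G)
    {d : ι → ℕ} (hd : ∀ i, d i ≤ Module.finrank K (G i))
    (hsum : ∑ i, d i = Module.finrank K V) :
    DirectSum.IsInternal G ∧ ∀ i, Module.finrank K (G i) = d i := by
  have hinj : Function.Injective (DirectSum.coeLinearMap G) := hG.dfinsupp_lsum_injective
  have hle : ∑ i, Module.finrank K (G i) ≤ Module.finrank K V := by
    rw [← Module.finrank_directSum]
    exact LinearMap.finrank_le_finrank_of_injective hinj
  have heq := (Finset.sum_eq_sum_iff_of_le fun i _ => hd i).1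
    (le_antisymm (Finset.sum_le_sum fun i _ => hd i) (hle.trans_eq hsum.symm))
  refine ⟨⟨hinj, ?_⟩, fun i => (heq i (Finset.mem_univ i)).symm⟩
  refine (LinearMap.injective_iff_surjective_of_finrank_eq_finrank ?_).1 hinj
  rw [Module.finrank_directSum, ← hsum]
  exact Finset.sum_congr rfl fun i hi => (heq i hi).symm

namespace IsExpansionFamily

open BaseChange (Ring)
open PowerSeries

variable {Λ : Type*} [Field Λ] {Q : Type*} [Field Q] {E : Type*} [CommRing E] [Algebra Q E]
  {q : Q →+* Λ⟦X⟧} {D : Type*} [AddCommGroup D] [Module Λ D] (ρ : E →+* Module.End Λ D)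
  (hρ : ∀ a, ρ (algebraMap Q E a) = algebraMap Λ _ (constantCoeff (q a)))

/-- The action of `E ⊗ Λ⟦X⟧` through `X ↦ 0` on a `Λ`-vector space that carries an action of
`E`. -/
noncomputable def residueAction : Ring q E →+* Module.End Λ D :=
  BaseChange.Ring.lift q ((algebraMap Λ _).comp constantCoeff)
    (fun _ x => Algebra.commutes _ x) ρ hρ

theorem residueAction_inl (c : Λ⟦X⟧) :
    residueAction ρ hρ (Ring.inl q E c) = algebraMap Λ _ (constantCoeff c) :=
  BaseChange.Ring.lift_inl ..

theorem residueAction_inr (a : E) : residueAction ρ hρ (Ring.inr q E a) = ρ a :=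
  BaseChange.Ring.lift_inr ..

variable {n : Type*} [Fintype n] {e : Module.Basis n Q E} {v : D} {t : Module.Basis n Λ D}
  (ht : ∀ j, t j = ρ (e j) v)

include ht in
theorem residueAction_ofConst (c : n → Λ) :
    residueAction ρ hρ (ofConst q e c) v = t.equivFun.symm c := by
  simp only [ofConst, map_sum, LinearMap.sum_apply, map_mul, Module.End.mul_apply,
    residueAction_inl, residueAction_inr, constantCoeff_C, Module.algebraMap_end_apply,
    Module.Basis.equivFun_symm_apply, ht]

variable {Ψ : Type*} {ψ : Ψ → E →+* Λ} {Θ : Ψ → Ring q E →+* Λ⟦X⟧} (H : IsExpansionFamily ψ Θ)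
  {d : Ψ → ℕ} (hd : ∀ i, X ^ d i ∣ Θ i (Ring.inl q E X))

include ht hd in
theorem truncation_residueAction (w : Ring q E) (i : Ψ) (m : Fin (d i)) :
    truncation Θ e H.map_C d (t.equivFun (residueAction ρ hρ w v)) i m = coeff m (Θ i w) := by
  obtain ⟨c, w', rfl⟩ := exists_eq_ofConst_add e w
  have hc : residueAction ρ hρ (ofConst q e c + Ring.inl q E X * w') v = t.equivFun.symm c := by
    rw [map_add, map_mul, residueAction_inl, constantCoeff_X, map_zero, zero_mul, add_zero,
      residueAction_ofConst ρ hρ ht]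
  rw [hc, LinearEquiv.apply_symm_apply, map_add, map_mul, map_add,
    X_pow_dvd_iff.1 ((hd i).mul_right _) m m.2, add_zero]
  rfl

variable [Fintype Ψ] (hsum : ∑ i, d i = Module.finrank Q E)

include H hρ ht hd hsum

theorem mem_maxGenEigenspace {i : Ψ} {x : D}
    (hx : ∀ j ≠ i, truncation Θ e H.map_C d (t.equivFun x) j = 0) (a : E) :
    x ∈ (ρ a).maxGenEigenspace (ψ i a) := by
  rw [Module.End.mem_maxGenEigenspace]
  refine ⟨d i, ?_⟩
  let w := ofConst q e (t.equivFun x)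
  let y : Ring q E := Ring.inr q E a - Ring.inl q E (C (ψ i a))
  have hw : residueAction ρ hρ w v = x := by
    rw [residueAction_ofConst ρ hρ ht, LinearEquiv.symm_apply_apply]
  have hy : ρ a - ψ i a • 1 = residueAction ρ hρ y := by
    rw [map_sub, residueAction_inr, residueAction_inl, constantCoeff_C,
      Algebra.algebraMap_eq_smul_one]
  have hdvd (j : Ψ) : X ^ d j ∣ Θ j (y ^ d i * w) := by
    rw [map_mul]
    rcases eq_or_ne j i with rfl | hj
    · rw [map_pow]
      refine (pow_dvd_pow_of_dvd (X_dvd_iff.2 ?_) _).mul_right _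
      rw [map_sub, map_sub, H.map_C, H.constantCoeff_map, constantCoeff_C, sub_self]
    · exact (X_pow_dvd_iff.2 fun m hm => congrFun (hx j hj) ⟨m, hm⟩).mul_left _
  rw [hy, ← map_pow, ← hw, ← Module.End.mul_apply, ← map_mul]
  refine t.equivFun.map_eq_zero_iff.1 (H.truncation_injective hd hsum e ?_)
  funext j m
  rw [H.truncation_residueAction ρ hρ ht hd, X_pow_dvd_iff.1 (hdvd j) m m.2, map_zero]
  rfl

omit [Fintype n] in
theorem le_finrank_iInf_maxGenEigenspace [Finite n] (i : Ψ) :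
    d i ≤ Module.finrank Λ (⨅ a : E, (ρ a).maxGenEigenspace (ψ i a) : Submodule Λ D) := by
  classical
  have := Fintype.ofFinite n
  have := Module.Finite.of_basis t
  let T : D ≃ₗ[Λ] ((i : Ψ) → Fin (d i) → Λ) := t.equivFun ≪≫ₗ LinearEquiv.ofBijective
    (truncation Θ e H.map_C d) ⟨H.truncation_injective hd hsum e, H.truncation_surjective e d hd⟩
  let S := T.symm.toLinearMap ∘ₗ LinearMap.single Λ (fun i => Fin (d i) → Λ) i
  have hS (u : Fin (d i) → Λ) : S u ∈ (⨅ a : E, (ρ a).maxGenEigenspace (ψ i a) : Submodule Λ D) :=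
    (Submodule.mem_iInf _).2 <| H.mem_maxGenEigenspace ρ hρ ht hd hsum fun j hj => by
      change T (T.symm (Pi.single i u)) j = 0
      rw [LinearEquiv.apply_symm_apply, Pi.single_eq_of_ne hj]
  have hle := LinearMap.finrank_le_finrank_of_injective (f := S.codRestrict _ hS) <| by
    rw [← LinearMap.ker_eq_bot, LinearMap.ker_codRestrict, LinearMap.ker_eq_bot]
    exact T.symm.injective.comp (Pi.single_injective (M := fun i => Fin (d i) → Λ) i)
  rwa [Module.finrank_fin_fun] at hle

omit [Fintype n] in
theorem isInternal_iInf_maxGenEigenspace [Finite n] [DecidableEq Ψ] :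
    DirectSum.IsInternal (fun i => (⨅ a : E, (ρ a).maxGenEigenspace (ψ i a) : Submodule Λ D)) ∧
      ∀ i, Module.finrank Λ (⨅ a : E, (ρ a).maxGenEigenspace (ψ i a) : Submodule Λ D) = d i := by
  have := Fintype.ofFinite n
  have := Module.Finite.of_basis t
  refine isInternal_of_sum_finrank_le ?_
    (H.le_finrank_iInf_maxGenEigenspace ρ hρ ht hd hsum) ?_
  · refine (Module.End.independent_iInf_maxGenEigenspace_of_forall_mapsTo (fun a : E => ρ a)
      fun a b φ => Module.End.mapsTo_maxGenEigenspace_of_comm ((Commute.all b a).map ρ) φ).comp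
      (f := fun i a => ψ i a) fun i j hij => H.injective (RingHom.ext (congrFun hij))
  · rw [hsum, Module.finrank_eq_card_basis e, Module.finrank_eq_card_basis t]

end IsExpansionFamily

end Eigenspaces

section Semilinear

theorem bijective_toModule_of_isInternal {K ι D : Type*} [DecidableEq ι] [CommRing K]
    [AddCommGroup D] [Module K D] {V : ι → Type*} [∀ i, AddCommGroup (V i)] [∀ i, Module K (V i)]
    {g : ∀ i, V i →ₗ[K] D} (hg : ∀ i, Function.Injective (g i))
    (h : DirectSum.IsInternal fun i => LinearMap.range (g i)) :
    Function.Bijective (DirectSum.toModule K ι D g) := by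
  let e (i : ι) : V i ≃ₗ[K] LinearMap.range (g i) := LinearEquiv.ofInjective (g i) (hg i)
  have hcomp : DirectSum.toModule K ι D g = (DirectSum.coeLinearMap fun i =>
      LinearMap.range (g i)) ∘ₗ (DFinsupp.mapRange.linearEquiv e).toLinearMap :=
    DirectSum.linearMap_ext _ fun i => LinearMap.ext fun x => by
      simp only [LinearMap.comp_apply, DirectSum.toModule_lof, LinearEquiv.coe_coe]
      rw [show DFinsupp.mapRange.linearEquiv e (DirectSum.lof K ι V i x) =
        DirectSum.lof K ι (fun i => LinearMap.range (g i)) i (e i x) from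
          DFinsupp.mapRange_single (hf := fun i => map_zero (e i)), DirectSum.coeLinearMap_lof]
      rfl
  rw [hcomp, LinearMap.coe_comp]
  exact h.comp (DFinsupp.mapRange.linearEquiv e).bijective

theorem maxGenEigenspace_smul_mul {K V : Type*} [Field K] [AddCommGroup V] [Module K V]
    {c : K} (hc : c ≠ 0) (f : Module.End K V) (μ : K) :
    (c • f).maxGenEigenspace (c * μ) = f.maxGenEigenspace μ := by
  ext x
  simp only [Module.End.mem_maxGenEigenspace, mul_smul, ← smul_sub, smul_pow,
    LinearMap.smul_apply, smul_eq_zero_iff_right (pow_ne_zero _ hc)]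

theorem mem_maxGenEigenspace_iff_of_semiconj {A B N D : Type*} [CommRing A] [CommRing B]
    [AddCommGroup N] [Module A N] [AddCommGroup D] [Module B D] {σ : A →+* B} {j : N →ₛₗ[σ] D}
    (hj : Function.Injective j) {φ : Module.End A N} {Φ : Module.End B D}
    (h : Function.Semiconj j φ Φ) (r : A) (x : N) :
    x ∈ φ.maxGenEigenspace r ↔ j x ∈ Φ.maxGenEigenspace (σ r) := by
  have hsub : Function.Semiconj j (φ - r • 1 : Module.End A N)
      (Φ - σ r • 1 : Module.End B D) := fun y => by
    simp only [LinearMap.sub_apply, LinearMap.smul_apply, Module.End.one_apply, map_sub,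
      map_smulₛₗ, h.eq]
  simp only [Module.End.mem_maxGenEigenspace, Module.End.pow_apply, ← (hsub.iterate_right _).eq,
    map_eq_zero_iff j hj]

variable {R : Type*} [CommRing R] {L : Type*} [Field L] [Algebra R L] [IsFractionRing R L]
  {N : Type*} [AddCommGroup N] [Module R N] {D : Type*} [AddCommGroup D] [Module L D]

theorem exists_smul_eq_of_span_eq_top {j : N →ₛₗ[algebraMap R L] D}
    (hj : Submodule.span L (Set.range j) = ⊤) (y : D) :
    ∃ s : R, algebraMap R L s ≠ 0 ∧ ∃ x, algebraMap R L s • y = j x := by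
  have hy : y ∈ Submodule.span L (Set.range j) := hj ▸ Submodule.mem_top
  induction hy using Submodule.span_induction with
  | mem y hy =>
    obtain ⟨x, rfl⟩ := hy
    exact ⟨1, by rw [map_one]; exact one_ne_zero, x, by rw [map_one, one_smul]⟩
  | zero => exact ⟨1, by rw [map_one]; exact one_ne_zero, 0, by rw [smul_zero, map_zero]⟩
  | add y y' _ _ h h' =>
    obtain ⟨s, hs, x, hx⟩ := h
    obtain ⟨s', hs', x', hx'⟩ := h'
    refine ⟨s * s', by rw [map_mul]; exact mul_ne_zero hs hs', s' • x + s • x', ?_⟩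
    rw [map_add, map_smulₛₗ, map_smulₛₗ, ← hx, ← hx', smul_add, map_mul, smul_smul, smul_smul,
      mul_comm (algebraMap R L s')]
  | smul c y _ h =>
    obtain ⟨s, hs, x, hx⟩ := h
    obtain ⟨⟨a, b⟩, hab⟩ := IsLocalization.surj (nonZeroDivisors R) c
    have hb : algebraMap R L b ≠ 0 := (IsLocalization.map_units L b).ne_zero
    refine ⟨b * s, by rw [map_mul]; exact mul_ne_zero hb hs, a • x, ?_⟩
    rw [map_smulₛₗ, ← hx, smul_smul, smul_smul, map_mul, ← hab]
    ring_nf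

end Semilinear

namespace BaseChange

section Along

variable {A B C : Type*} [CommRing A] [CommRing B] [CommRing C] (f : A →+* B)
  {M : Type*} [AddCommGroup M] [Module A M]

theorem span_range_mk : Submodule.span B (Set.range (mk f : M → BaseChange f M)) = ⊤ :=
  eq_top_iff.2 fun x _ => induction f (p := fun x => x ∈ Submodule.span B (Set.range (mk f)))
    (fun _ m => Submodule.smul_mem _ _ (Submodule.subset_span (Set.mem_range_self m)))
    (fun _ _ => Submodule.add_mem _) x

variable {f} {h : B →+* C} {g : A →+* C} (hg : h.comp f = g)

theorem along_injective {n : Type*} [Finite n] (b : Module.Basis n A M)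
    (hh : Function.Injective h) :
    Function.Injective (along f h g hg : BaseChange f M → BaseChange g M) := fun x y hxy =>
  (basis f b).ext_elem fun i => hh (by rw [← basis_repr_along f h g hg, hxy, basis_repr_along])

theorem span_range_along :
    Submodule.span C (Set.range (along f h g hg : BaseChange f M → BaseChange g M)) = ⊤ := by
  rw [eq_top_iff, ← span_range_mk]
  refine Submodule.span_mono ?_
  rintro _ ⟨m, rfl⟩
  exact ⟨mk f m, along_mk h g hg m⟩

theorem semiconj_along_map (φ : Module.End A M) :
    Function.Semiconj (along f h g hg) (map f φ) (map g φ) := fun x =>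
  LinearMap.congr_fun (f := (along f h g hg).comp (map f φ))
    (g := (map g φ).comp (along f h g hg)) (linear_ext fun m => by
      rw [LinearMap.comp_apply, LinearMap.comp_apply, map_mk, along_mk, along_mk, map_mk]) x

theorem isIntegral_of_hasEigenvalue {n : Type*} [Finite n] (b : Module.Basis n A M) {L : Type*}
    [Field L] [Algebra B L] {φ : Module.End A M} {r : L}
    (hr : Module.End.HasEigenvalue (map ((algebraMap B L).comp f) φ) r) : IsIntegral B r := by
  classical
  have := Fintype.ofFinite n
  let N := (LinearMap.toMatrix b b φ).map f
  have := Module.Finite.of_basis (basis ((algebraMap B L).comp f) b)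
  have hN : (map ((algebraMap B L).comp f) φ).charpoly = N.charpoly.map (algebraMap B L) := by
    rw [← Matrix.charpoly_map, ← LinearMap.charpoly_toMatrix _ (basis _ b), toMatrix_map]
    rfl
  refine ⟨N.charpoly, N.charpoly_monic, ?_⟩
  rw [← Polynomial.eval_map, ← hN]
  exact (Module.End.hasEigenvalue_iff_isRoot_charpoly _ r).1 hr

end Along

variable {R : Type*} [CommRing R] {L : Type*} [Field L] [Algebra R L] [IsFractionRing R L]
  {N : Type*} [AddCommGroup N] [Module R N] {D : Type*} [AddCommGroup D] [Module L D]

theorem injective_of_injective_comp_mk {g : BaseChange (algebraMap R L) N →ₗ[L] D}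
    (hg : Function.Injective fun x : N => g (mk _ x)) : Function.Injective g := by
  rw [injective_iff_map_eq_zero]
  intro x hx
  obtain ⟨s, hs, m, hm⟩ := exists_smul_eq_of_span_eq_top (span_range_mk (algebraMap R L)) x
  have hm0 : m = 0 := hg <| by
    change g (mk (algebraMap R L) m) = g (mk _ 0)
    rw [← hm, map_smul, hx, smul_zero, _root_.map_zero, _root_.map_zero]
  rwa [hm0, _root_.map_zero, smul_eq_zero_iff_right hs] at hm

end BaseChange

namespace LocalShtuka

variable {k : Type*} [Field k] [Fintype k] {R : Type*} [CommRing R] [IsLocalRing R]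
  [IsAdicComplete (IsLocalRing.maximalIdeal R) R] [Algebra k R] {P : CharPoint R}
  {L : Type*} [Field L] [Algebra R L] [IsFractionRing R L] {M : LocalShtuka k P}

theorem deRhamRtoL_injective : Function.Injective (M.deRhamRtoL L) :=
  BaseChange.along_injective rfl
    (BaseChange.basis (sigmaHat k R) (Module.finBasis R⟦X⟧ M.carrier))
    (IsFractionRing.injective R L)

omit [IsFractionRing R L] in
theorem span_range_deRhamRtoL : Submodule.span L (Set.range (M.deRhamRtoL L)) = ⊤ :=
  BaseChange.span_range_along rfl

namespace CM

variable {E : Type*} [CommRing E] [Algebra k⸨X⸩ E] (C : M.CM E)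

theorem actionL_algebraMap (c : k⸨X⸩) :
    C.actionL L (algebraMap k⸨X⸩ E c) = algebraMap L _ (gamma k L P c) :=
  (congrArg (M.qEndL L) (C.ι.commutes c)).trans
    (M.qEndPullback_algebraMap _ (gamma_algebraMap L P) c)

theorem actionL_smul (c : k⸨X⸩) (a : E) :
    C.actionL L (c • a) = gamma k L P c • C.actionL L a := by
  rw [Algebra.smul_def, map_mul, actionL_algebraMap, ← Algebra.smul_def]

variable {C} in
theorem actionL_eq_endPullback {a : E} {f : M.End} (h : C.ι a = 1 ⊗ₜ f) :
    C.actionL L a = M.endPullback ((algebraMap R L).comp (evalZeta P)) f :=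
  (congrArg (M.qEndL L) h).trans (M.qEndPullback_one_tmul _ (gamma_algebraMap L P) f)

theorem maxGenEigenspace_actionL_smul (ψ : Emb k E (gamma k L P)) {c : k⸨X⸩} (hc : c ≠ 0) (a : E) :
    (C.actionL L (c • a)).maxGenEigenspace (ψ.1 (c • a)) =
      (C.actionL L a).maxGenEigenspace (ψ.1 a) := by
  have hψ : ψ.1 (c • a) = gamma k L P c * ψ.1 a := by
    rw [Algebra.smul_def, map_mul, ← RingHom.comp_apply, ψ.2]
  rw [hψ, actionL_smul, maxGenEigenspace_smul_mul ((map_ne_zero _).2 hc)]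

variable {C} in
theorem mem_maxGenEigenspace_endPullback {a : E} {f : M.End} (h : C.ι a = 1 ⊗ₜ f) (r : R)
    (x : M.deRhamR) :
    x ∈ (M.endPullback (evalZeta P) f).maxGenEigenspace r ↔
      M.deRhamRtoL L x ∈ (C.actionL L a).maxGenEigenspace (algebraMap R L r) := by
  rw [actionL_eq_endPullback h]
  exact mem_maxGenEigenspace_iff_of_semiconj deRhamRtoL_injective
    (BaseChange.semiconj_along_map rfl _) r x

theorem HPsiRtoL_mk (ψ : Emb k E (gamma k L P)) (x : C.HPsiR ψ) :
    C.HPsiRtoL ψ (BaseChange.mk _ x) = M.deRhamRtoL L x.1 :=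
  BaseChange.extend_mk _ _ _

theorem HPsiRtoL_injective (ψ : Emb k E (gamma k L P)) : Function.Injective (C.HPsiRtoL ψ) :=
  BaseChange.injective_of_injective_comp_mk <| by
    simp only [HPsiRtoL_mk]
    exact deRhamRtoL_injective.comp Subtype.val_injective

variable [Module.Finite k⸨X⸩ E]

theorem insepDegree_ne_zero (ψ : Emb k E (gamma k L P)) : insepDegree ψ ≠ 0 := by
  have := ψ.isMaximal_ker
  let : Field (Factor ψ) := Ideal.Quotient.field _
  exact NeZero.ne (Field.finInsepDegree k⸨X⸩ (Factor ψ))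

variable [IsDomain R] [IsSemisimpleRing E]
  (hemb : ∀ (ψ : Emb k E ((algebraMap L (AlgebraicClosure L)).comp (gamma k L P))) (a : E),
    ψ.1 a ∈ (algebraMap L (AlgebraicClosure L)).range)

include hemb

theorem isInternal_genEigenspace [DecidableEq (Emb k E (gamma k L P))] :
    DirectSum.IsInternal (fun ψ => C.genEigenspace (L := L) ψ) ∧
      ∀ ψ, Module.finrank L (C.genEigenspace (L := L) ψ) = insepDegree ψ := by
  obtain ⟨p, hp, _⟩ := exists_prime_charP_laurentSeries k
  have : CharP L p := charP_of_injective_ringHom (gamma k L P).injective p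
  let Ψ := Emb k E (PowerSeries.constantCoeff.comp (qToSeries k L P))
  let : DecidableEq Ψ := ‹DecidableEq (Emb k E (gamma k L P))›
  have := Fintype.ofFinite Ψ
  choose y hy using fun ψ : Ψ => exists_factor_pow_ne p ψ
  choose Θ hΘ using fun ψ => exists_isExpansion (q := qToSeries k L P) (qToSeries_X L) (hy ψ)
  obtain ⟨e, -, v, t, ht⟩ := C.exists_generator L
  have hdvd (ψ : Ψ) := X_pow_insepDegree_dvd (q := qToSeries k L P) (ψ := ψ) p
    (qToSeries_X L) (hΘ ψ).map_C (hΘ ψ).constantCoeff_map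
  have hρ (a : k⸨X⸩) : C.actionL L (algebraMap k⸨X⸩ E a) =
      algebraMap L _ (PowerSeries.constantCoeff (qToSeries k L P a)) := C.actionL_algebraMap a
  have hsum : ∑ ψ : Ψ, insepDegree ψ = Module.finrank k⸨X⸩ E := sum_insepDegree hemb
  exact (isExpansionFamily (q := qToSeries k L P) hΘ).isInternal_iInf_maxGenEigenspace
    (d := insepDegree) (C.actionL L) hρ ht hdvd hsum

theorem finrank_genEigenspace (ψ : Emb k E (gamma k L P)) :
    Module.finrank L (C.genEigenspace ψ) = insepDegree ψ := by
  classical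
  exact (C.isInternal_genEigenspace hemb).2 ψ

theorem genEigenspace_ne_bot (ψ : Emb k E (gamma k L P)) : C.genEigenspace ψ ≠ ⊥ := by
  intro h
  apply insepDegree_ne_zero ψ
  rw [← C.finrank_genEigenspace hemb, h, finrank_bot]

variable [IsIntegrallyClosed R]

theorem apply_mem_range (ψ : Emb k E (gamma k L P)) (a : E) (f : M.End) (h : C.ι a = 1 ⊗ₜ f) :
    ψ.1 a ∈ (algebraMap R L).range := by
  have hψ : (C.actionL L a).maxGenEigenspace (ψ.1 a) ≠ ⊥ := fun hbot =>
    C.genEigenspace_ne_bot hemb ψ (eq_bot_iff.2 ((iInf_le _ a).trans hbot.le))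
  have hev : (C.actionL L a).HasEigenvalue (ψ.1 a) :=
    Module.End.HasUnifEigenvalue.lt (k := ⊤) one_pos hψ
  rw [actionL_eq_endPullback h] at hev
  exact IsIntegrallyClosed.isIntegral_iff.1 (BaseChange.isIntegral_of_hasEigenvalue
    (BaseChange.basis (sigmaHat k R) (Module.finBasis R⟦X⟧ M.carrier)) hev)

theorem mem_HPsiR_iff (ψ : Emb k E (gamma k L P)) (x : M.deRhamR) :
    x ∈ C.HPsiR ψ ↔ M.deRhamRtoL L x ∈ C.genEigenspace ψ := by
  simp only [HPsiR, genEigenspace, Submodule.mem_iInf]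
  refine ⟨fun h a => ?_, fun h a f r hf hr => ?_⟩
  · obtain ⟨s, hs, f, hf⟩ := C.exists_smul_mem_end a
    obtain ⟨r, hr⟩ := C.apply_mem_range hemb ψ _ f hf
    rw [← C.maxGenEigenspace_actionL_smul ψ hs, ← hr, ← mem_maxGenEigenspace_endPullback hf]
    exact h _ f r hf hr
  · rw [mem_maxGenEigenspace_endPullback hf (L := L), hr]
    exact h a

theorem range_HPsiRtoL (ψ : Emb k E (gamma k L P)) :
    LinearMap.range (C.HPsiRtoL ψ) = C.genEigenspace ψ := by
  refine le_antisymm ?_ fun y hy => ?_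
  · rw [LinearMap.range_eq_map, ← BaseChange.span_range_mk, Submodule.map_span, Submodule.span_le]
    rintro _ ⟨_, ⟨x, rfl⟩, rfl⟩
    rw [HPsiRtoL_mk]
    exact (C.mem_HPsiR_iff hemb ψ _).1 x.2
  · obtain ⟨s, hs, ω, h⟩ := exists_smul_eq_of_span_eq_top span_range_deRhamRtoL y
    have hω : ω ∈ C.HPsiR ψ := by
      rw [C.mem_HPsiR_iff hemb, ← h]
      exact Submodule.smul_mem _ _ hy
    refine ⟨(algebraMap R L s)⁻¹ • BaseChange.mk _ ⟨ω, hω⟩, ?_⟩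
    rw [map_smul, HPsiRtoL_mk, ← h, inv_smul_smul₀ hs]

theorem bijective_toModule_HPsiRtoL [DecidableEq (Emb k E (gamma k L P))] :
    Function.Bijective (DirectSum.toModule L (Emb k E (gamma k L P)) (M.deRhamL L)
      fun ψ => C.HPsiRtoL ψ) :=
  bijective_toModule_of_isInternal C.HPsiRtoL_injective <| by
    simp only [C.range_HPsiRtoL hemb]
    exact (C.isInternal_genEigenspace hemb).1

omit [IsIntegrallyClosed R] in
theorem free_HPsiR [IsPrincipalIdealRing R] (ψ : Emb k E (gamma k L P)) :
    Module.Free R (C.HPsiR ψ) ∧ Module.Finite R (C.HPsiR ψ) ∧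
      Module.finrank R (C.HPsiR ψ) = insepDegree ψ := by
  let b : Module.Basis _ R M.deRhamR := BaseChange.basis (evalZeta P)
    (BaseChange.basis (sigmaHat k R) (Module.finBasis R⟦X⟧ M.carrier))
  have := Module.Finite.of_basis b
  have := Module.Free.of_basis b
  refine ⟨inferInstance, inferInstance, ?_⟩
  rw [← C.finrank_genEigenspace hemb, ← C.range_HPsiRtoL hemb,
    LinearMap.finrank_range_of_inj (C.HPsiRtoL_injective ψ),
    Module.finrank_eq_card_basis (BaseChange.basis (algebraMap R L)
      (Module.Free.chooseBasis R (C.HPsiR ψ))), Module.finrank_eq_card_chooseBasisIndex]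

end CM

end LocalShtuka

theorem proposition3p6_general {k : Type*} [Field k] [Fintype k]
    {R : Type*} [CommRing R] [IsDomain R] [IsDiscreteValuationRing R]
    [IsAdicComplete (IsLocalRing.maximalIdeal R) R]
    [Algebra k R] (P : CharPoint R)
    (L : Type*) [Field L] [Algebra R L] [IsFractionRing R L]
    (M : LocalShtuka k P)
    (E : Type*) [CommRing E] [Algebra k⸨X⸩ E] [Module.Finite k⸨X⸩ E] [IsSemisimpleRing E]
    (C : M.CM E) :
    Nonempty (C.tate L ≃ₗ[E] E) ∧
    Nonempty (C.deRham L ≃ₗ[LocalShtuka.CM.ESeries k P E L] LocalShtuka.CM.ESeries k P E L) ∧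
    ((∀ (ψ : LocalShtuka.Emb k E
          ((algebraMap L (AlgebraicClosure L)).comp (LocalShtuka.gamma k L P))) (a : E),
        ψ.1 a ∈ (algebraMap L (AlgebraicClosure L)).range) →
      (∀ y : (ψ : LocalShtuka.Emb k E (LocalShtuka.gamma k L P)) → LocalShtuka.CM.Factor ψ,
        (∀ ψ, LocalShtuka.CM.IsUniformizer k (y ψ)) →
        ∃ Θ : ∀ ψ, LocalShtuka.CM.Expansion ψ (y ψ),
          (∀ Θ' : ∀ ψ, LocalShtuka.CM.Expansion ψ (y ψ), Θ' = Θ) ∧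
          Function.Bijective (fun (x : LocalShtuka.CM.ESeries k P E L) ψ => (Θ ψ).toRingHom x) ∧
          Function.Bijective
            (fun (ω : C.deRham L) ψ => (BaseChange.mk (Θ ψ).toRingHom ω : C.HPsiSeries (Θ ψ))) ∧
          ∀ ψ, Nonempty (C.HPsiSeries (Θ ψ) ≃ₗ[L⟦X⟧] L⟦X⟧)) ∧
      (∀ (ψ : LocalShtuka.Emb k E (LocalShtuka.gamma k L P)) (a : E) (f : M.End), C.ι a = 1 ⊗ₜ f →
        ψ.1 a ∈ (algebraMap R L).range) ∧
      (open Classical in Function.Bijective (DirectSum.toModule L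
        (LocalShtuka.Emb k E (LocalShtuka.gamma k L P)) (M.deRhamL L)
        (fun ψ => C.HPsiRtoL ψ))) ∧
      (∀ ψ : LocalShtuka.Emb k E (LocalShtuka.gamma k L P),
        LinearMap.range (C.HPsiRtoL ψ) = C.genEigenspace ψ) ∧
      ∀ ψ : LocalShtuka.Emb k E (LocalShtuka.gamma k L P),
        Module.Free R (C.HPsiR ψ) ∧ Module.Finite R (C.HPsiR ψ) ∧
        Module.finrank R (C.HPsiR ψ) = LocalShtuka.CM.insepDegree ψ) := by
  classical
  refine ⟨C.tate_equiv L, C.deRham_equiv L, fun hemb => ⟨?_, ?_, ?_, ?_, ?_⟩⟩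
  · exact C.exists_expansion_decomposition hemb
  · exact C.apply_mem_range hemb
  · exact C.bijective_toModule_HPsiRtoL hemb
  · exact C.range_HPsiRtoL hemb
  · exact C.free_HPsiR hemb

theorem proposition3p6 {k : Type*} [Field k] [Fintype k]
    {R : Type*} [CommRing R] [IsDomain R] [IsDiscreteValuationRing R]
    [IsAdicComplete (IsLocalRing.maximalIdeal R) R] [Finite (IsLocalRing.ResidueField R)]
    [Algebra k R] (P : CharPoint R)
    (L : Type*) [Field L] [Algebra R L] [IsFractionRing R L]
    (M : LocalShtuka k P)
    (E : Type*) [CommRing E] [Algebra k⸨X⸩ E] [Module.Finite k⸨X⸩ E] [IsSemisimpleRing E]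
    (C : M.CM E) :
    -- `R` is a complete discrete valuation ring over `k = 𝔽_v` with finite residue field and
    -- fraction field `L`; the local shtuka `M` over `R` has complex multiplication by `E`.
    -- `H¹_v(M, Q_v)` is free of rank one over `E`
    Nonempty (C.tate L ≃ₗ[E] E) ∧
    -- `H¹_dR(M, L⟦z-ζ⟧)` is free of rank one over `E ⊗ L⟦z-ζ⟧`
    Nonempty (C.deRham L ≃ₗ[LocalShtuka.CM.ESeries k P E L] LocalShtuka.CM.ESeries k P E L) ∧
    -- if `L` contains `ψ(E)` for every `Q_v`-homomorphism `ψ` to an algebraic closure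
    ((∀ (ψ : LocalShtuka.Emb k E
          ((algebraMap L (AlgebraicClosure L)).comp (LocalShtuka.gamma k L P))) (a : E),
        ψ.1 a ∈ (algebraMap L (AlgebraicClosure L)).range) →
      -- for every choice of uniformizers, `E ⊗ L⟦z-ζ⟧ = ∏_ψ L⟦y-ψ(y)⟧`, and this induces
      -- `H¹_dR(M, L⟦z-ζ⟧) = ∏_ψ H^ψ(M, L⟦y-ψ(y)⟧)` with factors free of rank one
      (∀ y : (ψ : LocalShtuka.Emb k E (LocalShtuka.gamma k L P)) → LocalShtuka.CM.Factor ψ,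
        (∀ ψ, LocalShtuka.CM.IsUniformizer k (y ψ)) →
        ∃ Θ : ∀ ψ, LocalShtuka.CM.Expansion ψ (y ψ),
          (∀ Θ' : ∀ ψ, LocalShtuka.CM.Expansion ψ (y ψ), Θ' = Θ) ∧
          Function.Bijective (fun (x : LocalShtuka.CM.ESeries k P E L) ψ => (Θ ψ).toRingHom x) ∧
          Function.Bijective
            (fun (ω : C.deRham L) ψ => (BaseChange.mk (Θ ψ).toRingHom ω : C.HPsiSeries (Θ ψ))) ∧
          ∀ ψ, Nonempty (C.HPsiSeries (Θ ψ) ≃ₗ[L⟦X⟧] L⟦X⟧)) ∧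
      -- for `a` in `E ∩ End_R(M)` the element `ψ(a)` lies in `R`
      (∀ (ψ : LocalShtuka.Emb k E (LocalShtuka.gamma k L P)) (a : E) (f : M.End), C.ι a = 1 ⊗ₜ f →
        ψ.1 a ∈ (algebraMap R L).range) ∧
      -- `H¹_dR(M, L) = ⨁_ψ H^ψ(M, R) ⊗_R L`, the decomposition into generalized eigenspaces
      (open Classical in Function.Bijective (DirectSum.toModule L
        (LocalShtuka.Emb k E (LocalShtuka.gamma k L P)) (M.deRhamL L)
        (fun ψ => C.HPsiRtoL ψ))) ∧
      (∀ ψ : LocalShtuka.Emb k E (LocalShtuka.gamma k L P),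
        LinearMap.range (C.HPsiRtoL ψ) = C.genEigenspace ψ) ∧
      -- `H^ψ(M, R)` is free of rank equal to the inseparability degree of `E_{i(ψ)}` over `Q_v`
      ∀ ψ : LocalShtuka.Emb k E (LocalShtuka.gamma k L P),
        Module.Free R (C.HPsiR ψ) ∧ Module.Finite R (C.HPsiR ψ) ∧
        Module.finrank R (C.HPsiR ψ) = LocalShtuka.CM.insepDegree ψ) :=
  proposition3p6_general P L M E C
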